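/- Let $k=k_0\oplus k_1$ be a commutative superring (a $\mathbb Z/2$-graded unital ring with $ab=(-1)^{p(a)p(b)}ba$ for homogeneous $a,b$, and $a^2=0$ for odd $a$), and let $\mathfrak g=\mathfrak g_0\oplus\mathfrak g_1$ be a Lie $k$-superalgebra: a graded right $k$-module, with $\alpha m:=(-1)^{p(\alpha)p(m)}m\alpha$, and an even $k$-bilinear bracket satisfying $[X,Y]=-(-1)^{p(X)p(Y)}[Y,X]$, $[X,X]=0$ for $X$ even, $[[X,Y],Z]=[X,[Y,Z]]-(-1)^{p(X)p(Y)}[Y,[X,Z]]$, and $[Y,[Y,Y]]=0$ for $Y$ odd. Assume that either $\mathbb Q\subseteq k$, or there is an integer $N\ge 2$ such that $\mathfrak g$ is $N$-nilpotent (that is, $\operatorname{ad}X_1\circ\cdots\circ\operatorname{ad}X_N=0$ for all $X_1,\dots,X_N\in\mathfrak g$) and $2,\dots,N$ are invertible in $k$. (In both cases $\tfrac12\in k$.) Let $S(\mathfrak g)$ be the symmetric superalgebra, $S^n(\mathfrak g)$ the $k$-submodule generated by products of $n$ elements of $\mathfrak g$, $\Delta$ the comultiplication of $S(\mathfrak g)$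 (the algebra morphism with $\Delta(X)=X\otimes1+1\otimes X$ for $X\in\mathfrak g$), and $x:S(\mathfrak g)\to\mathfrak g$ the $k$-linear map that is the identity on $\mathfrak g=S^1(\mathfrak g)$ and zero on $S^n(\mathfrak g)$, $n\neq1$. For $F,G\in\operatorname{Hom}(S(\mathfrak g),\mathfrak g)$ put $[F,G]=[\cdot,\cdot]\circ(F\otimes G)\circ\Delta$ and $(\operatorname{ad}x)(G)=[x,G]$; regard $a\in\mathfrak g$ as the map $S(\mathfrak g)\to\mathfrak g$ with $1\mapsto a$ and $S^n(\mathfrak g)\mapsto 0$ for $n\ge1$. Let $\varphi(t)=t/(e^t-1)=\sum_n c_nt^n$ (taken modulo $t^N$ in the $N$-nilpotent case), and for $a\in\mathfrak g$ let $\varphi^a=\sum_n c_n(\operatorname{ad}x)^n(a):S(\mathfrak g)\to\mathfrak g$ and $\Phi_1^a=\mathrm{Mult}\circ(\mathrm{id}\otimes\varphi^a)\circ\Delta:S(\mathfrak g)\to S(\mathfrak g)$. Let $U(\mathfrak g)$ be the enveloping superalgebra, the quotient of the tensor algebra by the relations $a\otimes b-(-1)^{p(a)p(b)}b\otimes a-[a,b]$,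 with canonical map $j:\mathfrak g\to U(\mathfrak g)$; let $U_n$ be the $k$-submodule generated by the products of at most $n$ elements of $j(\mathfrak g)$, and $U_{-1}=0$. Then there is a unique morphism of $k$-superalgebras $\Phi:U(\mathfrak g)\to\operatorname{Hom}(S(\mathfrak g),S(\mathfrak g))$ with $\Phi(j(a))=\Phi_1^a$ for all $a\in\mathfrak g$, and the following hold. (i) The symbol map $\sigma:U(\mathfrak g)\to S(\mathfrak g)$, $\sigma(u)=\Phi(u)(1)$, is invertible. (ii) Its inverse $\beta=\sigma^{-1}:S(\mathfrak g)\to U(\mathfrak g)$ is an even isomorphism of $k$-modules such that (a) $\beta(S^n(\mathfrak g))\subseteq U_n$ for all $n\ge 0$; (b) the associated graded map of $\beta$ is the canonical map $\tilde j:S(\mathfrak g)\to\operatorname{gr}U(\mathfrak g)$, $X_1\cdots X_n\mapsto j(X_1)\cdots j(X_n)\bmod U_{n-1}$; (c) $\beta$ commutes with every derivation (even or odd) and with every automorphism of $\mathfrak g$, each of which extends uniquely to $S(\mathfrak g)$ and to $U(\mathfrak g)$. In other words, $\mathfrak g$ satisfies the strong Poincaré–Birkhoff–Witt theorem with the isomorphism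 $\beta$. -/

import Mathlib

open scoped DirectSum TensorProduct

noncomputable section

/-! ### Superrings and supermodules

A superring is a ring `k` with a `ZMod 2`-grading `𝓚` (even part `𝓚 0`, odd part `𝓚 1`). The sign
`(-1)^(p(a)p(b))` for `a ∈ 𝓚 i`, `b ∈ 𝓚 j` is `(-1 : ℤˣ) ^ (i * j)`. -/

/-- The superring `k` is commutative: `ab = (-1)^(p(a)p(b)) ba` for homogeneous `a`, `b`, and
`a² = 0` for odd `a`. -/
class CommSuperring {k : Type*} [Ring k] (𝓚 : ZMod 2 → AddSubgroup k) [GradedRing 𝓚] : Prop where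
  mul_comm_sign : ∀ {i j : ZMod 2} {a b : k}, a ∈ 𝓚 i → b ∈ 𝓚 j →
    a * b = ((-1 : ℤˣ) ^ (i * j)) • (b * a)
  odd_mul_self : ∀ {a : k}, a ∈ 𝓚 1 → a * a = 0

/-- The compatibility of a right `k`-module structure on `M` (`m a` is `MulOpposite.op a • m`) with
the parity grading `𝓜`. The left module structure is the one determined by the right one through
`a m = (-1)^(p(a)p(m)) m a`. -/
class SuperModule {k M : Type*} [Ring k] [AddCommGroup M] [Module k M] [Module kᵐᵒᵖ M]
    (𝓚 : ZMod 2 → AddSubgroup k) (𝓜 : ZMod 2 → AddSubgroup M) : Prop where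
  smul_mem : ∀ {i j : ZMod 2} {a : k} {m : M}, a ∈ 𝓚 i → m ∈ 𝓜 j → MulOpposite.op a • m ∈ 𝓜 (j + i)
  left_smul : ∀ {i j : ZMod 2} {a : k} {m : M}, a ∈ 𝓚 i → m ∈ 𝓜 j →
    a • m = ((-1 : ℤˣ) ^ (i * j)) • (MulOpposite.op a • m)

/-! ### The tensor algebra -/

section Alg

variable (k M : Type*) [Ring k] [AddCommGroup M] [Module k M] [Module kᵐᵒᵖ M]

/-- The defining relations of the tensor algebra `T(M)` of the `k`-bimodule `M` as a ring generated
by symbols for the elements of `k` and of `M`: `k` maps to it by a ring morphism, `M` by a morphism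
of bimodules. -/
inductive SuperTensor.Rel : FreeRing (k ⊕ M) → FreeRing (k ⊕ M) → Prop
  | one : Rel (.of (.inl 1)) 1
  | add (a b : k) : Rel (.of (.inl (a + b))) (.of (.inl a) + .of (.inl b))
  | mul (a b : k) : Rel (.of (.inl (a * b))) (.of (.inl a) * .of (.inl b))
  | vadd (x y : M) : Rel (.of (.inr (x + y))) (.of (.inr x) + .of (.inr y))
  | left (a : k) (x : M) : Rel (.of (.inr (a • x))) (.of (.inl a) * .of (.inr x))
  | right (a : k) (x : M) :
      Rel (.of (.inr (MulOpposite.op a • x))) (.of (.inr x) * .of (.inl a))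

/-- The tensor algebra `T(M)` over `k`: the universal ring with a ring morphism from `k` and a
morphism of `k`-bimodules from `M`. -/
def SuperTensor : Type _ := RingQuot (SuperTensor.Rel k M)

instance : Ring (SuperTensor k M) := inferInstanceAs (Ring (RingQuot _))

namespace SuperTensor

/-- The structure map `k → T(M)`. -/
def scalar : k →+* SuperTensor k M where
  toFun a := RingQuot.mkRingHom (Rel k M) (.of (.inl a))
  map_one' := by rw [RingQuot.mkRingHom_rel Rel.one]; exact map_one _
  map_zero' := by
    have := RingQuot.mkRingHom_rel (Rel.add (M := M) (0 : k) 0)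
    rw [map_add, add_zero] at this
    exact left_eq_add.mp this
  map_add' a b := by rw [RingQuot.mkRingHom_rel (Rel.add a b)]; exact map_add _ _ _
  map_mul' a b := by rw [RingQuot.mkRingHom_rel (Rel.mul a b)]; exact map_mul _ _ _

/-- The canonical map `M → T(M)`. -/
def vec : M →+ SuperTensor k M :=
  AddMonoidHom.mk' (fun x => RingQuot.mkRingHom (Rel k M) (.of (.inr x)))
    fun x y => by rw [RingQuot.mkRingHom_rel (Rel.vadd x y)]; exact map_add _ _ _

variable {k M}

/-- The universal property of `T(M)`. -/
def lift {R : Type*} [Ring R] (f : k →+* R) (h : M →+ R)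
    (hl : ∀ a x, h (a • x) = f a * h x) (hr : ∀ a x, h (MulOpposite.op a • x) = h x * f a) :
    SuperTensor k M →+* R :=
  RingQuot.lift ⟨FreeRing.lift (Sum.elim f h), by
    intro x y hxy
    cases hxy <;> simp [hl, hr]⟩

theorem lift_scalar {R : Type*} [Ring R] (f : k →+* R) (h : M →+ R) (hl hr) (a : k) :
    lift f h hl hr (scalar k M a) = f a := by
  change RingQuot.lift _ (RingQuot.mkRingHom (Rel k M) _) = _
  rw [RingQuot.lift_mkRingHom_apply]; simp

theorem lift_vec {R : Type*} [Ring R] (f : k →+* R) (h : M →+ R) (hl hr) (x : M) :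
    lift f h hl hr (vec k M x) = h x := by
  change RingQuot.lift _ (RingQuot.mkRingHom (Rel k M) _) = _
  rw [RingQuot.lift_mkRingHom_apply]; simp

theorem hom_ext {R : Type*} [Ring R] {f g : SuperTensor k M →+* R}
    (h1 : ∀ a, f (scalar k M a) = g (scalar k M a)) (h2 : ∀ x, f (vec k M x) = g (vec k M x)) :
    f = g := by
  refine RingQuot.ringQuot_ext (r := Rel k M) f g ?_
  refine FreeRing.hom_ext ?_
  rintro (a | x)
  · exact h1 a
  · exact h2 x

theorem vec_left (a : k) (x : M) : vec k M (a • x) = scalar k M a * vec k M x := by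
  change RingQuot.mkRingHom (Rel k M) _ = RingQuot.mkRingHom (Rel k M) _ * RingQuot.mkRingHom (Rel k M) _
  rw [RingQuot.mkRingHom_rel (Rel.left a x)]; exact map_mul _ _ _

theorem vec_right (a : k) (x : M) :
    vec k M (MulOpposite.op a • x) = vec k M x * scalar k M a := by
  change RingQuot.mkRingHom (Rel k M) _ = RingQuot.mkRingHom (Rel k M) _ * RingQuot.mkRingHom (Rel k M) _
  rw [RingQuot.mkRingHom_rel (Rel.right a x)]; exact map_mul _ _ _

end SuperTensor
end Alg

/-! ### Parity -/

/-- For `s : k → R` and `v : M → R`, `ParityWord 𝓚 𝓜 s v i w` says that `w` is a product of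
elements `s a` and `v x` with `a`, `x` homogeneous and with parities adding up to `i`. -/
inductive ParityWord {k M R : Type*} [Ring k] [AddCommGroup M] [Ring R]
    (𝓚 : ZMod 2 → AddSubgroup k) (𝓜 : ZMod 2 → AddSubgroup M) (s : k → R) (v : M → R) :
    ZMod 2 → R → Prop
  | scalar {i : ZMod 2} {a : k} : a ∈ 𝓚 i → ParityWord 𝓚 𝓜 s v i (s a)
  | vec {i : ZMod 2} {x : M} : x ∈ 𝓜 i → ParityWord 𝓚 𝓜 s v i (v x)
  | mul {i j : ZMod 2} {w z : R} : ParityWord 𝓚 𝓜 s v i w → ParityWord 𝓚 𝓜 s v j z →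
      ParityWord 𝓚 𝓜 s v (i + j) (w * z)

/-- The additive span of the words of parity `i`. -/
def parityPart {k M R : Type*} [Ring k] [AddCommGroup M] [Ring R]
    (𝓚 : ZMod 2 → AddSubgroup k) (𝓜 : ZMod 2 → AddSubgroup M) (s : k → R) (v : M → R)
    (i : ZMod 2) : Submodule ℤ R :=
  Submodule.span ℤ {w | ParityWord 𝓚 𝓜 s v i w}

theorem units_smul_map {F A B : Type*} [AddCommGroup A] [AddCommGroup B] [FunLike F A B]
    [AddMonoidHomClass F A B] (f : F) (e : ℤˣ) (x : A) : f (e • x) = e • f x := by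
  rw [Units.smul_def, Units.smul_def, map_zsmul]

/-! ### The symmetric algebra -/

section Sym
variable (k : Type*) {M : Type*} [Ring k] [AddCommGroup M] [Module k M] [Module kᵐᵒᵖ M]
  (𝓜 : ZMod 2 → AddSubgroup M)

/-- The relations `x ⊗ y = (-1)^(p(x)p(y)) y ⊗ x` and `x ⊗ x = 0` for `x` odd. -/
inductive SuperSym.Rel : SuperTensor k M → SuperTensor k M → Prop
  | comm {i j : ZMod 2} {x y : M} : x ∈ 𝓜 i → y ∈ 𝓜 j →
      Rel (SuperTensor.vec k M x * SuperTensor.vec k M y)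
        (((-1 : ℤˣ) ^ (i * j)) • (SuperTensor.vec k M y * SuperTensor.vec k M x))
  | sq {x : M} : x ∈ 𝓜 1 → Rel (SuperTensor.vec k M x * SuperTensor.vec k M x) 0

/-- The symmetric algebra `S(M)`, a quotient of `T(M)`. -/
def SuperSym : Type _ := RingQuot (SuperSym.Rel k 𝓜)

instance : Ring (SuperSym k 𝓜) := inferInstanceAs (Ring (RingQuot _))

namespace SuperSym

/-- The projection `T(M) → S(M)`. -/
def mk : SuperTensor k M →+* SuperSym k 𝓜 := RingQuot.mkRingHom (Rel k 𝓜)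

/-- The structure map `k → S(M)`. -/
def scalar : k →+* SuperSym k 𝓜 := (mk k 𝓜).comp (SuperTensor.scalar k M)

/-- The canonical map `M → S(M)`. -/
def vec : M →+ SuperSym k 𝓜 := (mk k 𝓜).toAddMonoidHom.comp (SuperTensor.vec k M)

variable {k 𝓜}


/-- The universal property of `S(M)`. -/
def lift {R : Type*} [Ring R] (f : k →+* R) (h : M →+ R)
    (hl : ∀ a x, h (a • x) = f a * h x) (hr : ∀ a x, h (MulOpposite.op a • x) = h x * f a)
    (hc : ∀ (i j : ZMod 2) (x y : M), x ∈ 𝓜 i → y ∈ 𝓜 j →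
      h x * h y = ((-1 : ℤˣ) ^ (i * j)) • (h y * h x))
    (hs : ∀ x : M, x ∈ 𝓜 1 → h x * h x = 0) :
    SuperSym k 𝓜 →+* R :=
  RingQuot.lift ⟨SuperTensor.lift f h hl hr, by
    rintro _ _ (⟨hx, hy⟩ | hx)
    · rw [units_smul_map]
      simp [SuperTensor.lift_vec, hc _ _ _ _ hx hy]
    · simp [SuperTensor.lift_vec, hs _ hx]⟩

section
variable {R : Type*} [Ring R] (f : k →+* R) (h : M →+ R)
    (hl : ∀ a x, h (a • x) = f a * h x) (hr : ∀ a x, h (MulOpposite.op a • x) = h x * f a)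
    (hc : ∀ (i j : ZMod 2) (x y : M), x ∈ 𝓜 i → y ∈ 𝓜 j →
      h x * h y = ((-1 : ℤˣ) ^ (i * j)) • (h y * h x))
    (hs : ∀ x : M, x ∈ 𝓜 1 → h x * h x = 0)

theorem lift_scalar (a : k) : lift f h hl hr hc hs (scalar k 𝓜 a) = f a := by
  change RingQuot.lift _ (RingQuot.mkRingHom (Rel k 𝓜) _) = _
  rw [RingQuot.lift_mkRingHom_apply, SuperTensor.lift_scalar]

theorem lift_vec (x : M) : lift f h hl hr hc hs (vec k 𝓜 x) = h x := by
  change RingQuot.lift _ (RingQuot.mkRingHom (Rel k 𝓜) _) = _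
  rw [RingQuot.lift_mkRingHom_apply, SuperTensor.lift_vec]
end

theorem hom_ext {R : Type*} [Ring R] {f g : SuperSym k 𝓜 →+* R}
    (h1 : ∀ a, f (scalar k 𝓜 a) = g (scalar k 𝓜 a)) (h2 : ∀ x, f (vec k 𝓜 x) = g (vec k 𝓜 x)) :
    f = g :=
  RingQuot.ringQuot_ext (r := Rel k 𝓜) f g (SuperTensor.hom_ext h1 h2)

theorem vec_left (a : k) (x : M) : vec k 𝓜 (a • x) = scalar k 𝓜 a * vec k 𝓜 x :=
  (congrArg (mk k 𝓜) (SuperTensor.vec_left a x)).trans (map_mul _ _ _)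

theorem vec_right (a : k) (x : M) :
    vec k 𝓜 (MulOpposite.op a • x) = vec k 𝓜 x * scalar k 𝓜 a :=
  (congrArg (mk k 𝓜) (SuperTensor.vec_right a x)).trans (map_mul _ _ _)

theorem vec_comm {i j : ZMod 2} {x y : M} (hx : x ∈ 𝓜 i) (hy : y ∈ 𝓜 j) :
    vec k 𝓜 x * vec k 𝓜 y = ((-1 : ℤˣ) ^ (i * j)) • (vec k 𝓜 y * vec k 𝓜 x) := by
  have h := RingQuot.mkRingHom_rel (Rel.comm (k := k) hx hy)
  rw [map_mul, units_smul_map, map_mul] at h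
  exact h

theorem vec_sq {x : M} (hx : x ∈ 𝓜 1) : vec k 𝓜 x * vec k 𝓜 x = 0 := by
  have h := RingQuot.mkRingHom_rel (Rel.sq (k := k) hx)
  rw [map_mul, map_zero] at h
  exact h

end SuperSym

section Grading
set_option linter.unusedSectionVars false
variable {k} (𝓚 : ZMod 2 → AddSubgroup k)

namespace SuperSym

/-- The even (`i = 0`) and odd (`i = 1`) parts of `S(M)`. -/
def part (i : ZMod 2) : Submodule ℤ (SuperSym k 𝓜) := parityPart 𝓚 𝓜 (scalar k 𝓜) (vec k 𝓜) i

theorem scalar_mem_part {i : ZMod 2} {a : k} (ha : a ∈ 𝓚 i) : scalar k 𝓜 a ∈ part 𝓜 𝓚 i :=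
  Submodule.subset_span (ParityWord.scalar ha)

theorem vec_mem_part {i : ZMod 2} {x : M} (hx : x ∈ 𝓜 i) : vec k 𝓜 x ∈ part 𝓜 𝓚 i :=
  Submodule.subset_span (ParityWord.vec hx)

variable [GradedRing 𝓚]

instance : SetLike.GradedMonoid (part 𝓜 𝓚) where
  one_mem := by
    rw [← map_one (scalar k 𝓜)]
    exact scalar_mem_part 𝓜 𝓚 SetLike.GradedOne.one_mem
  mul_mem i j w z hw hz := by
    induction hw, hz using Submodule.span_induction₂ with
    | mem_mem x y hx hy => exact Submodule.subset_span (ParityWord.mul hx hy)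
    | zero_left y hy => rw [zero_mul]; exact zero_mem _
    | zero_right y hy => rw [mul_zero]; exact zero_mem _
    | add_left x y z _ _ _ h1 h2 => rw [add_mul]; exact add_mem h1 h2
    | add_right x y z _ _ _ h1 h2 => rw [mul_add]; exact add_mem h1 h2
    | smul_left r x y _ _ h => rw [smul_mul_assoc]; exact Submodule.smul_mem _ _ h
    | smul_right r x y _ _ h => rw [mul_smul_comm]; exact Submodule.smul_mem _ _ h

variable [DirectSum.Decomposition 𝓜]

/-- Auxiliary: `k → ⨁ i, S(M)_i`. -/
def gradeScalar : k →+* ⨁ i, part 𝓜 𝓚 i :=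
  (DirectSum.toSemiring
    (fun i => (DirectSum.of (fun i => part 𝓜 𝓚 i) i).comp
      (((scalar k 𝓜).toAddMonoidHom.comp (𝓚 i).subtype).codRestrict (part 𝓜 𝓚 i)
        fun a => scalar_mem_part 𝓜 𝓚 a.2))
    (by
      refine DirectSum.of_eq_of_gradedMonoid_eq (Sigma.subtype_ext rfl ?_)
      exact map_one (scalar k 𝓜))
    (by
      intro i j a b
      simp only [AddMonoidHom.comp_apply]
      rw [DirectSum.of_mul_of]
      refine DirectSum.of_eq_of_gradedMonoid_eq (Sigma.subtype_ext rfl ?_)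
      exact map_mul (scalar k 𝓜) _ _)).comp
  (DirectSum.decomposeRingEquiv 𝓚).toRingHom

/-- Auxiliary: `M → ⨁ i, S(M)_i`. -/
def gradeVec : M →+ ⨁ i, part 𝓜 𝓚 i :=
  (DirectSum.toAddMonoid
    (fun i => (DirectSum.of (fun i => part 𝓜 𝓚 i) i).comp
      (((vec k 𝓜).comp (𝓜 i).subtype).codRestrict (part 𝓜 𝓚 i)
        fun x => vec_mem_part 𝓜 𝓚 x.2))).comp
  (DirectSum.decomposeAddEquiv 𝓜).toAddMonoidHom

theorem gradeScalar_of {i : ZMod 2} {a : k} (ha : a ∈ 𝓚 i) :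
    gradeScalar 𝓜 𝓚 a = DirectSum.of (fun i => part 𝓜 𝓚 i) i ⟨_, scalar_mem_part 𝓜 𝓚 ha⟩ := by
  simp only [gradeScalar, RingHom.comp_apply]
  change DirectSum.toSemiring _ _ _ (DirectSum.decompose 𝓚 a) = _
  rw [DirectSum.decompose_of_mem 𝓚 ha]
  exact DirectSum.toSemiring_of _ _ _ _ _

theorem gradeVec_of {i : ZMod 2} {x : M} (hx : x ∈ 𝓜 i) :
    gradeVec 𝓜 𝓚 x = DirectSum.of (fun i => part 𝓜 𝓚 i) i ⟨_, vec_mem_part 𝓜 𝓚 hx⟩ := by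
  have h : (DirectSum.decomposeAddEquiv 𝓜).toAddMonoidHom x =
      DirectSum.of (fun i => 𝓜 i) i ⟨x, hx⟩ := DirectSum.decompose_of_mem 𝓜 hx
  rw [gradeVec, AddMonoidHom.comp_apply, h]
  exact DirectSum.toAddMonoid_of _ _ _

variable [SuperModule 𝓚 𝓜]

theorem left_smul_mem {i j : ZMod 2} {a : k} {x : M} (ha : a ∈ 𝓚 i) (hx : x ∈ 𝓜 j) :
    a • x ∈ 𝓜 (i + j) := by
  rw [SuperModule.left_smul ha hx, Units.smul_def, add_comm]
  exact zsmul_mem (SuperModule.smul_mem ha hx) _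

/-- The decomposition of `S(M)` into its even and odd parts. -/
def grade : SuperSym k 𝓜 →+* ⨁ i, part 𝓜 𝓚 i :=
  lift (gradeScalar 𝓜 𝓚) (gradeVec 𝓜 𝓚)
    (fun a x => by
      induction a using DirectSum.Decomposition.inductionOn 𝓚 with
      | zero => simp
      | add a b ha hb => rw [add_smul, map_add, ha, hb, map_add, add_mul]
      | homogeneous a =>
        induction x using DirectSum.Decomposition.inductionOn 𝓜 with
        | zero => simp
        | add x y hx hy => rw [smul_add, map_add, hx, hy, map_add, mul_add]
        | homogeneous x =>
          rw [gradeVec_of 𝓜 𝓚 (left_smul_mem 𝓜 𝓚 a.2 x.2), gradeScalar_of 𝓜 𝓚 a.2,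
            gradeVec_of 𝓜 𝓚 x.2, DirectSum.of_mul_of]
          exact DirectSum.of_eq_of_gradedMonoid_eq (Sigma.subtype_ext rfl (vec_left _ _)))
    (fun a x => by
      induction a using DirectSum.Decomposition.inductionOn 𝓚 with
      | zero => simp
      | add a b ha hb =>
        rw [MulOpposite.op_add, add_smul, map_add, ha, hb, map_add, mul_add]
      | homogeneous a =>
        induction x using DirectSum.Decomposition.inductionOn 𝓜 with
        | zero => simp
        | add x y hx hy => rw [smul_add, map_add, hx, hy, map_add, add_mul]
        | homogeneous x =>
          rw [gradeVec_of 𝓜 𝓚 (SuperModule.smul_mem a.2 x.2), gradeScalar_of 𝓜 𝓚 a.2,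
            gradeVec_of 𝓜 𝓚 x.2, DirectSum.of_mul_of]
          exact DirectSum.of_eq_of_gradedMonoid_eq (Sigma.subtype_ext rfl (vec_right _ _)))
    (fun i j x y hx hy => by
      rw [gradeVec_of 𝓜 𝓚 hx, gradeVec_of 𝓜 𝓚 hy, DirectSum.of_mul_of, DirectSum.of_mul_of,
        ← units_smul_map]
      refine DirectSum.of_eq_of_gradedMonoid_eq (Sigma.subtype_ext (add_comm _ _) ?_)
      exact vec_comm hx hy)
    (fun x hx => by
      rw [gradeVec_of 𝓜 𝓚 hx, DirectSum.of_mul_of]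
      convert map_zero (DirectSum.of (fun i => part 𝓜 𝓚 i) (1 + 1))
      exact Subtype.ext (vec_sq hx))

theorem grade_of (i : ZMod 2) (w : SuperSym k 𝓜) (hw : w ∈ part 𝓜 𝓚 i) :
    grade 𝓜 𝓚 w = DirectSum.of (fun i => part 𝓜 𝓚 i) i ⟨w, hw⟩ := by
  induction hw using Submodule.span_induction with
  | mem w hw =>
    induction hw with
    | scalar ha => rw [grade, lift_scalar]; exact gradeScalar_of 𝓜 𝓚 ha
    | vec hx => rw [grade, lift_vec]; exact gradeVec_of 𝓜 𝓚 hx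
    | mul hw hz ih1 ih2 =>
      rw [map_mul, ih1, ih2, DirectSum.of_mul_of]
      rfl
  | zero => rw [map_zero]; exact (map_zero _).symm
  | add x y hx hy h1 h2 => rw [map_add, h1, h2, ← map_add]; rfl
  | smul r x hx h => rw [map_zsmul, h, ← map_zsmul]; rfl

theorem coe_grade (w : SuperSym k 𝓜) :
    DirectSum.coeAddMonoidHom (part 𝓜 𝓚) (grade 𝓜 𝓚 w) = w := by
  have : (DirectSum.coeRingHom (part 𝓜 𝓚)).comp (grade 𝓜 𝓚) = RingHom.id _ := by
    refine hom_ext (fun a => ?_) (fun x => ?_)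
    · rw [RingHom.comp_apply]
      induction a using DirectSum.Decomposition.inductionOn 𝓚 with
      | zero => simp
      | add a b ha hb => simp only [map_add, ha, hb]
      | homogeneous a =>
        rw [grade_of 𝓜 𝓚 _ _ (scalar_mem_part 𝓜 𝓚 a.2)]
        exact DirectSum.coeAddMonoidHom_of _ _ _
    · rw [RingHom.comp_apply]
      induction x using DirectSum.Decomposition.inductionOn 𝓜 with
      | zero => simp
      | add a b ha hb => simp only [map_add, ha, hb]
      | homogeneous x =>
        rw [grade_of 𝓜 𝓚 _ _ (vec_mem_part 𝓜 𝓚 x.2)]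
        exact DirectSum.coeAddMonoidHom_of _ _ _
  exact congrArg (fun f => f w) this

/-- `S(M)` is a superring. -/
instance : GradedRing (part 𝓜 𝓚) where
  decompose' := grade 𝓜 𝓚
  left_inv := coe_grade 𝓜 𝓚
  right_inv x := by
    induction x using DirectSum.induction_on with
    | zero => simp
    | of i x => rw [DirectSum.coeAddMonoidHom_of, grade_of 𝓜 𝓚 i _ x.2]
    | add x y hx hy => rw [map_add, map_add, hx, hy]

variable [CommSuperring 𝓚]

theorem scalar_comm {i j : ZMod 2} {a : k} {w : SuperSym k 𝓜} (ha : a ∈ 𝓚 i)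
    (hw : w ∈ part 𝓜 𝓚 j) :
    scalar k 𝓜 a * w = ((-1 : ℤˣ) ^ (i * j)) • (w * scalar k 𝓜 a) := by
  induction hw using Submodule.span_induction with
  | mem w hw =>
    induction hw with
    | scalar hb =>
      rw [← map_mul, CommSuperring.mul_comm_sign ha hb, units_smul_map, map_mul]
    | @vec j x hx =>
      rw [← vec_left, SuperModule.left_smul ha hx, units_smul_map, vec_right]
    | @mul j l w z hw hz h1 h2 =>
      rw [← mul_assoc, h1, smul_mul_assoc, mul_assoc, h2, mul_smul_comm, smul_smul, mul_assoc,
        mul_add, uzpow_add]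
  | zero => simp
  | add x y _ _ h1 h2 => rw [mul_add, h1, h2, add_mul, smul_add]
  | smul r x _ h => rw [mul_smul_comm, h, smul_mul_assoc, smul_comm]

/-- The tensor product `S(M) ⊗ S(M)` over `ℤ`, with the product
`(a ⊗ b)(c ⊗ d) = (-1)^(p(b)p(c)) ac ⊗ bd`. -/
abbrev TensorInt : Type _ := (part 𝓜 𝓚) ᵍ⊗[ℤ] (part 𝓜 𝓚)

/-- The ideal generated by the elements `a ⊗ 1 - 1 ⊗ a` with `a` in `k`. -/
def balancing : Ideal (TensorInt 𝓜 𝓚) :=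
  Ideal.span {z | ∃ (i : ZMod 2) (a : k), a ∈ 𝓚 i ∧
    z = (scalar k 𝓜 a) ᵍ⊗ₜ[ℤ] (1 : SuperSym k 𝓜) - (1 : SuperSym k 𝓜) ᵍ⊗ₜ[ℤ] (scalar k 𝓜 a)}

variable {𝓜 𝓚} in
theorem tensorInt_induction {P : TensorInt 𝓜 𝓚 → Prop} (zero : P 0)
    (add : ∀ x y, P x → P y → P (x + y))
    (tmul : ∀ (i j : ZMod 2) (w z : SuperSym k 𝓜), w ∈ part 𝓜 𝓚 i → z ∈ part 𝓜 𝓚 j →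
      P (w ᵍ⊗ₜ[ℤ] z)) (x : TensorInt 𝓜 𝓚) : P x := by
  induction x using TensorProduct.induction_on with
  | zero => exact zero
  | add x y hx hy => exact add x y hx hy
  | tmul w z =>
    change P (w ᵍ⊗ₜ[ℤ] z)
    induction w using DirectSum.Decomposition.inductionOn (part 𝓜 𝓚) with
    | zero => rw [GradedTensorProduct.tmul, TensorProduct.zero_tmul, map_zero]; exact zero
    | add w w' h1 h2 =>
      rw [GradedTensorProduct.tmul, TensorProduct.add_tmul, map_add]; exact add _ _ h1 h2
    | homogeneous w =>
      induction z using DirectSum.Decomposition.inductionOn (part 𝓜 𝓚) with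
      | zero => rw [GradedTensorProduct.tmul, TensorProduct.tmul_zero, map_zero]; exact zero
      | add w w' h1 h2 =>
        rw [GradedTensorProduct.tmul, TensorProduct.tmul_add, map_add]; exact add _ _ h1 h2
      | homogeneous z => exact tmul _ _ _ _ w.2 z.2

variable {𝓜 𝓚} in
theorem tmul_mul_tmul {i j : ZMod 2} (a : SuperSym k 𝓜) {b c : SuperSym k 𝓜} (d : SuperSym k 𝓜)
    (hb : b ∈ part 𝓜 𝓚 i) (hc : c ∈ part 𝓜 𝓚 j) :
    ((a ᵍ⊗ₜ[ℤ] b) * (c ᵍ⊗ₜ[ℤ] d) : TensorInt 𝓜 𝓚) =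
      ((-1 : ℤˣ) ^ (i * j)) • ((a * c) ᵍ⊗ₜ[ℤ] (b * d)) :=
  GradedTensorProduct.tmul_coe_mul_coe_tmul (part 𝓜 𝓚) (part 𝓜 𝓚) a ⟨b, hb⟩ ⟨c, hc⟩ d

variable {𝓜 𝓚} in
theorem units_smul_tmul (e : ℤˣ) (w z : SuperSym k 𝓜) :
    (((e • w) ᵍ⊗ₜ[ℤ] z : TensorInt 𝓜 𝓚)) = e • (w ᵍ⊗ₜ[ℤ] z) := by
  exact units_smul_map (((GradedTensorProduct.of ℤ (part 𝓜 𝓚) (part 𝓜 𝓚)).toLinearMap ∘ₗ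
    (TensorProduct.mk ℤ (SuperSym k 𝓜) (SuperSym k 𝓜)).flip z)) e w

variable {𝓜 𝓚} in
theorem tmul_units_smul (e : ℤˣ) (w z : SuperSym k 𝓜) :
    ((w ᵍ⊗ₜ[ℤ] (e • z) : TensorInt 𝓜 𝓚)) = e • (w ᵍ⊗ₜ[ℤ] z) := by
  exact units_smul_map (((GradedTensorProduct.of ℤ (part 𝓜 𝓚) (part 𝓜 𝓚)).toLinearMap ∘ₗ
    (TensorProduct.mk ℤ (SuperSym k 𝓜) (SuperSym k 𝓜)) w)) e z

instance : (balancing 𝓜 𝓚).IsTwoSided := by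
  have one0 : (1 : SuperSym k 𝓜) ∈ part 𝓜 𝓚 0 := SetLike.GradedOne.one_mem
  have key : ∀ (i : ZMod 2) (a : k), a ∈ 𝓚 i → ∀ z : TensorInt 𝓜 𝓚,
      ((scalar k 𝓜 a) ᵍ⊗ₜ[ℤ] (1 : SuperSym k 𝓜) -
        (1 : SuperSym k 𝓜) ᵍ⊗ₜ[ℤ] (scalar k 𝓜 a)) * z ∈ balancing 𝓜 𝓚 := by
    intro i a ha z
    induction z using tensorInt_induction with
    | zero => rw [mul_zero]; exact zero_mem _
    | add x y hx hy => rw [mul_add]; exact add_mem hx hy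
    | tmul j l w z hw hz =>
      have hs := scalar_mem_part 𝓜 𝓚 ha
      have e1 : ((scalar k 𝓜 a) ᵍ⊗ₜ[ℤ] (1 : SuperSym k 𝓜) -
          (1 : SuperSym k 𝓜) ᵍ⊗ₜ[ℤ] (scalar k 𝓜 a)) * (w ᵍ⊗ₜ[ℤ] z) =
          ((-1 : ℤˣ) ^ (i * j + i * l)) • ((w ᵍ⊗ₜ[ℤ] z : TensorInt 𝓜 𝓚) *
          ((scalar k 𝓜 a) ᵍ⊗ₜ[ℤ] (1 : SuperSym k 𝓜) -
          (1 : SuperSym k 𝓜) ᵍ⊗ₜ[ℤ] (scalar k 𝓜 a))) := by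
        rw [sub_mul, mul_sub, tmul_mul_tmul _ _ one0 hw, tmul_mul_tmul _ _ hs hw,
          tmul_mul_tmul _ _ hz hs, tmul_mul_tmul _ _ hz one0, scalar_comm 𝓜 𝓚 ha hw,
          scalar_comm 𝓜 𝓚 ha hz, units_smul_tmul, tmul_units_smul]
        simp only [one_mul, mul_one, zero_mul, mul_zero, uzpow_zero, one_smul, smul_sub, smul_smul,
          uzpow_add, mul_comm l i, mul_assoc, Int.units_mul_self]
      rw [e1, Units.smul_def]
      have hg : (scalar k 𝓜 a) ᵍ⊗ₜ[ℤ] (1 : SuperSym k 𝓜) -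
          (1 : SuperSym k 𝓜) ᵍ⊗ₜ[ℤ] (scalar k 𝓜 a) ∈ balancing 𝓜 𝓚 :=
        Ideal.subset_span ⟨i, a, ha, rfl⟩
      exact zsmul_mem (Ideal.mul_mem_left _ _ hg) _
  refine .mk fun {a} b ha => ?_
  induction ha using Submodule.span_induction with
  | mem x hx => obtain ⟨i, a, ha, rfl⟩ := hx; exact key i a ha b
  | zero => rw [zero_mul]; exact zero_mem _
  | add x y _ _ h1 h2 => rw [add_mul]; exact add_mem h1 h2
  | smul r x _ h => rw [smul_eq_mul, mul_assoc]; exact Ideal.mul_mem_left _ _ h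

/-- The superring `S(M) ⊗ S(M)`, with the tensor product over `k`. -/
def Square : Type _ := TensorInt 𝓜 𝓚 ⧸ balancing 𝓜 𝓚

instance : Ring (Square 𝓜 𝓚) := inferInstanceAs (Ring (TensorInt 𝓜 𝓚 ⧸ balancing 𝓜 𝓚))

/-- The projection from the tensor product over `ℤ` to the tensor product over `k`. -/
def tmk : TensorInt 𝓜 𝓚 →+* Square 𝓜 𝓚 := Ideal.Quotient.mk (balancing 𝓜 𝓚)

/-- The morphism `w ↦ w ⊗ 1`. -/
def inl : SuperSym k 𝓜 →+* Square 𝓜 𝓚 :=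
  (tmk 𝓜 𝓚).comp (GradedTensorProduct.includeLeft (part 𝓜 𝓚) (part 𝓜 𝓚)).toRingHom

/-- The morphism `w ↦ 1 ⊗ w`. -/
def inr : SuperSym k 𝓜 →+* Square 𝓜 𝓚 :=
  (tmk 𝓜 𝓚).comp (GradedTensorProduct.includeRight (part 𝓜 𝓚) (part 𝓜 𝓚)).toRingHom

theorem inl_scalar (a : k) : inl 𝓜 𝓚 (scalar k 𝓜 a) = inr 𝓜 𝓚 (scalar k 𝓜 a) := by
  induction a using DirectSum.Decomposition.inductionOn 𝓚 with
  | zero => simp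
  | add a b ha hb => simp only [map_add, ha, hb]
  | homogeneous a =>
    have h : (scalar k 𝓜 (a : k)) ᵍ⊗ₜ[ℤ] (1 : SuperSym k 𝓜) -
        (1 : SuperSym k 𝓜) ᵍ⊗ₜ[ℤ] (scalar k 𝓜 (a : k)) ∈ balancing 𝓜 𝓚 :=
      Ideal.subset_span ⟨_, a, a.2, rfl⟩
    exact Ideal.Quotient.eq.mpr h

theorem inl_inr_comm {i j : ZMod 2} {w z : SuperSym k 𝓜} (hw : w ∈ part 𝓜 𝓚 i)
    (hz : z ∈ part 𝓜 𝓚 j) :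
    inr 𝓜 𝓚 w * inl 𝓜 𝓚 z = ((-1 : ℤˣ) ^ (i * j)) • (inl 𝓜 𝓚 z * inr 𝓜 𝓚 w) := by
  have one0 : (1 : SuperSym k 𝓜) ∈ part 𝓜 𝓚 0 := SetLike.GradedOne.one_mem
  have h1 := congrArg (tmk 𝓜 𝓚) (tmul_mul_tmul (1 : SuperSym k 𝓜) 1 hw hz)
  have h2 := congrArg (tmk 𝓜 𝓚) (tmul_mul_tmul z w one0 one0)
  rw [map_mul, units_smul_map] at h1
  rw [map_mul] at h2
  simp only [one_mul, mul_one, mul_zero, uzpow_zero, one_smul] at h1 h2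
  exact h1.trans (congrArg _ h2.symm)

/-- The comultiplication `Δ : S(M) → S(M) ⊗ S(M)`: the ring morphism that is `k`-linear and sends
`x` in `M` to `x ⊗ 1 + 1 ⊗ x`. -/
def comul : SuperSym k 𝓜 →+* Square 𝓜 𝓚 :=
  lift ((inl 𝓜 𝓚).comp (scalar k 𝓜))
    ((inl 𝓜 𝓚).toAddMonoidHom.comp (vec k 𝓜) + (inr 𝓜 𝓚).toAddMonoidHom.comp (vec k 𝓜))
    (fun a x => by
      change inl 𝓜 𝓚 (vec k 𝓜 (a • x)) + inr 𝓜 𝓚 (vec k 𝓜 (a • x)) =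
        inl 𝓜 𝓚 (scalar k 𝓜 a) * (inl 𝓜 𝓚 (vec k 𝓜 x) + inr 𝓜 𝓚 (vec k 𝓜 x))
      rw [vec_left, map_mul, map_mul, mul_add, inl_scalar])
    (fun a x => by
      change inl 𝓜 𝓚 (vec k 𝓜 (MulOpposite.op a • x)) + inr 𝓜 𝓚 (vec k 𝓜 (MulOpposite.op a • x)) =
        (inl 𝓜 𝓚 (vec k 𝓜 x) + inr 𝓜 𝓚 (vec k 𝓜 x)) * inl 𝓜 𝓚 (scalar k 𝓜 a)
      rw [vec_right, map_mul, map_mul, add_mul, inl_scalar])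
    (fun i j x y hx hy => by
      change (inl 𝓜 𝓚 (vec k 𝓜 x) + inr 𝓜 𝓚 (vec k 𝓜 x)) *
          (inl 𝓜 𝓚 (vec k 𝓜 y) + inr 𝓜 𝓚 (vec k 𝓜 y)) =
        _ • ((inl 𝓜 𝓚 (vec k 𝓜 y) + inr 𝓜 𝓚 (vec k 𝓜 y)) *
          (inl 𝓜 𝓚 (vec k 𝓜 x) + inr 𝓜 𝓚 (vec k 𝓜 x)))
      have hx' := vec_mem_part 𝓜 𝓚 hx
      have hy' := vec_mem_part 𝓜 𝓚 hy
      simp only [add_mul, mul_add, ← map_mul]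
      rw [vec_comm hx hy, units_smul_map, units_smul_map, inl_inr_comm 𝓜 𝓚 hx' hy',
        inl_inr_comm 𝓜 𝓚 hy' hx', mul_comm j i]
      simp only [smul_add, smul_smul, Int.units_mul_self, one_smul]
      abel)
    (fun x hx => by
      change (inl 𝓜 𝓚 (vec k 𝓜 x) + inr 𝓜 𝓚 (vec k 𝓜 x)) *
          (inl 𝓜 𝓚 (vec k 𝓜 x) + inr 𝓜 𝓚 (vec k 𝓜 x)) = 0
      have hx' := vec_mem_part 𝓜 𝓚 hx
      simp only [add_mul, mul_add, ← map_mul]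
      rw [vec_sq hx, map_zero, map_zero, inl_inr_comm 𝓜 𝓚 hx' hx']
      simp [Units.smul_def])

/-- The map `w ↦ (-1)^(p p(w)) w`. -/
def twist (p : ZMod 2) : SuperSym k 𝓜 →+ SuperSym k 𝓜 :=
  AddMonoidHom.mk' (fun w => ∑ i : ZMod 2, ((-1 : ℤˣ) ^ (p * i)) • GradedRing.proj (part 𝓜 𝓚) i w)
    fun w z => by simp only [map_add, smul_add, Finset.sum_add_distrib]

theorem twist_of_mem (p : ZMod 2) {i : ZMod 2} {w : SuperSym k 𝓜} (hw : w ∈ part 𝓜 𝓚 i) :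
    twist 𝓜 𝓚 p w = ((-1 : ℤˣ) ^ (p * i)) • w := by
  have h : ∀ j : ZMod 2, GradedRing.proj (part 𝓜 𝓚) j w = if j = i then w else 0 := by
    intro j
    rw [GradedRing.proj_apply]
    split_ifs with hj
    · subst hj; exact DirectSum.decompose_of_mem_same _ hw
    · exact DirectSum.decompose_of_mem_ne _ hw (Ne.symm hj)
  change ∑ j : ZMod 2, ((-1 : ℤˣ) ^ (p * j)) • GradedRing.proj (part 𝓜 𝓚) j w = _
  rw [Finset.sum_eq_single i, h, if_pos rfl]
  · intro j _ hj
    rw [h, if_neg hj, smul_zero]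
  · simp

/-- A `k`-linear map `G : S(M) → N` of parity `p`. The linearity is expressed with the left
multiplication: `G(a w) = (-1)^(p p(a)) a G(w)`. -/
structure ParityHom (p : ZMod 2) (N : Type*) [AddCommGroup N] [Module k N] where
  toFun : SuperSym k 𝓜 →+ N
  map_left : ∀ {i : ZMod 2} {a : k} (w : SuperSym k 𝓜), a ∈ 𝓚 i →
    toFun (scalar k 𝓜 a * w) = ((-1 : ℤˣ) ^ (p * i)) • (a • toFun w)

section Pairing
variable {𝓜 𝓚} {N C : Type*} [AddCommGroup N] [Module k N] [AddCommGroup C]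

/-- Auxiliary: the map of `pairing` on the tensor product over `ℤ`. -/
def pairingInt {p : ZMod 2} (B : SuperSym k 𝓜 →+ N →+ C) (G : ParityHom 𝓜 𝓚 p N) :
    TensorInt 𝓜 𝓚 →+ C :=
  (TensorProduct.liftAddHom ((B.comp (twist 𝓜 𝓚 p)).compl₂ G.toFun)
    (fun r w z => by rw [map_zsmul, map_zsmul]; rfl)).comp
  (GradedTensorProduct.of ℤ (part 𝓜 𝓚) (part 𝓜 𝓚)).symm.toLinearMap.toAddMonoidHom

theorem pairingInt_tmul {p : ZMod 2} (B : SuperSym k 𝓜 →+ N →+ C) (G : ParityHom 𝓜 𝓚 p N)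
    (w z : SuperSym k 𝓜) : pairingInt B G (w ᵍ⊗ₜ[ℤ] z) = B (twist 𝓜 𝓚 p w) (G.toFun z) := rfl

/-- For `G` of parity `p` and `B` bilinear, the map `B ∘ (id ⊗ G) : S(M) ⊗ S(M) → C`, that is,
`w ⊗ z ↦ (-1)^(p p(w)) B(w, G(z))`. -/
def pairing {p : ZMod 2} (B : SuperSym k 𝓜 →+ N →+ C)
    (hB : ∀ w a y, B (w * scalar k 𝓜 a) y = B w (a • y)) (G : ParityHom 𝓜 𝓚 p N) :
    Square 𝓜 𝓚 →+ C :=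
  QuotientAddGroup.lift (balancing 𝓜 𝓚).toAddSubgroup (pairingInt B G) (by
    intro z hz
    rw [AddMonoidHom.mem_ker]
    have hB1 : ∀ (e : ℤˣ) w y, B (e • w) y = e • B w y :=
      fun e w y => units_smul_map (B.flip y) e w
    have hz' : z ∈ balancing 𝓜 𝓚 := hz
    clear hz
    induction hz' using Submodule.closure_induction with
    | zero => exact map_zero _
    | add x y _ _ h1 h2 => rw [map_add, h1, h2, add_zero]
    | smul_mem r x hx =>
      obtain ⟨i, a, ha, rfl⟩ := hx
      rw [smul_eq_mul]
      induction r using tensorInt_induction with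
      | zero => rw [zero_mul, map_zero]
      | add x y hx hy => rw [add_mul, map_add, hx, hy, add_zero]
      | tmul j l w z hw hz =>
        have one0 : (1 : SuperSym k 𝓜) ∈ part 𝓜 𝓚 0 := SetLike.GradedOne.one_mem
        have hs := scalar_mem_part 𝓜 𝓚 ha
        rw [mul_sub, tmul_mul_tmul _ _ hz hs, tmul_mul_tmul _ _ hz one0, map_sub,
          units_smul_map, units_smul_map, pairingInt_tmul, pairingInt_tmul, mul_one, mul_one,
          twist_of_mem 𝓜 𝓚 p hw, twist_of_mem 𝓜 𝓚 p (SetLike.GradedMul.mul_mem hw hs)]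
        have h : z * scalar k 𝓜 a = ((-1 : ℤˣ) ^ (i * l)) • (scalar k 𝓜 a * z) := by
          rw [scalar_comm 𝓜 𝓚 ha hz, smul_smul, Int.units_mul_self, one_smul]
        rw [h, hB1, hB1, units_smul_map G.toFun, G.map_left z ha, hB]
        simp only [units_smul_map, smul_smul, mul_zero, uzpow_zero, mul_add, uzpow_add, one_mul,
          mul_comm l i]
        rw [sub_eq_zero]
        congr 1
        simp only [mul_comm, mul_left_comm, mul_assoc])

theorem pairing_tmk {p : ZMod 2} (B : SuperSym k 𝓜 →+ N →+ C) (hB) (G : ParityHom 𝓜 𝓚 p N)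
    (z : TensorInt 𝓜 𝓚) : pairing B hB G (tmk 𝓜 𝓚 z) = pairingInt B G z := rfl

theorem pairing_left [Module k C] {p : ZMod 2} (B : SuperSym k 𝓜 →+ N →+ C) (hB)
    (hB' : ∀ a w y, B (scalar k 𝓜 a * w) y = a • B w y) (G : ParityHom 𝓜 𝓚 p N)
    {i : ZMod 2} {a : k} (ha : a ∈ 𝓚 i) (z : Square 𝓜 𝓚) :
    pairing B hB G (inl 𝓜 𝓚 (scalar k 𝓜 a) * z) =
      ((-1 : ℤˣ) ^ (p * i)) • (a • pairing B hB G z) := by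
  have hB1 : ∀ (e : ℤˣ) w y, B (e • w) y = e • B w y :=
    fun e w y => units_smul_map (B.flip y) e w
  obtain ⟨z, rfl⟩ := Ideal.Quotient.mk_surjective z
  change pairing B hB G (tmk 𝓜 𝓚 (_ ᵍ⊗ₜ[ℤ] _) * tmk 𝓜 𝓚 z) = _ • (_ • pairing B hB G (tmk 𝓜 𝓚 z))
  rw [← map_mul, pairing_tmk, pairing_tmk]
  induction z using tensorInt_induction with
  | zero => simp
  | add x y hx hy => rw [mul_add, map_add, hx, hy, map_add, smul_add, smul_add]
  | tmul j l w z hw hz =>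
    have one0 : (1 : SuperSym k 𝓜) ∈ part 𝓜 𝓚 0 := SetLike.GradedOne.one_mem
    have hs := scalar_mem_part 𝓜 𝓚 ha
    rw [tmul_mul_tmul _ _ one0 hw, units_smul_map, pairingInt_tmul, pairingInt_tmul, one_mul,
      twist_of_mem 𝓜 𝓚 p hw, twist_of_mem 𝓜 𝓚 p (SetLike.GradedMul.mul_mem hs hw)]
    rw [hB1, hB1, hB']
    simp only [smul_smul, zero_mul, uzpow_zero, one_mul, mul_add, uzpow_add]
    rw [smul_comm a, smul_smul]

end Pairing

/-- The ring morphism `S(M) → S(M)[X]` sending `w` to `∑ w_n X^n`, where `w_n` is the component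
of `w` in `S^n(M)`. -/
def homogeneousComponents : SuperSym k 𝓜 →+* Polynomial (SuperSym k 𝓜) :=
  lift (Polynomial.C.comp (scalar k 𝓜))
    ((Polynomial.monomial 1).toAddMonoidHom.comp (vec k 𝓜))
    (fun a x => by
      change Polynomial.monomial 1 (vec k 𝓜 (a • x)) =
        Polynomial.C (scalar k 𝓜 a) * Polynomial.monomial 1 (vec k 𝓜 x)
      rw [Polynomial.C_mul_monomial, vec_left])
    (fun a x => by
      change Polynomial.monomial 1 (vec k 𝓜 (MulOpposite.op a • x)) =
        Polynomial.monomial 1 (vec k 𝓜 x) * Polynomial.C (scalar k 𝓜 a)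
      rw [Polynomial.monomial_mul_C, vec_right])
    (fun i j x y hx hy => by
      change Polynomial.monomial 1 (vec k 𝓜 x) * Polynomial.monomial 1 (vec k 𝓜 y) =
        _ • (Polynomial.monomial 1 (vec k 𝓜 y) * Polynomial.monomial 1 (vec k 𝓜 x))
      rw [Polynomial.monomial_mul_monomial, Polynomial.monomial_mul_monomial, vec_comm hx hy,
        units_smul_map])
    (fun x hx => by
      change Polynomial.monomial 1 (vec k 𝓜 x) * Polynomial.monomial 1 (vec k 𝓜 x) = 0
      rw [Polynomial.monomial_mul_monomial, vec_sq hx, map_zero])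

section Point
variable [SMulCommClass k kᵐᵒᵖ M]

/-- The ring morphism `S(M) → k ⊕ M` (with `M · M = 0` in `k ⊕ M`) killing `S^n(M)` for `n ≥ 2`. -/
def linearPart : SuperSym k 𝓜 →+* TrivSqZeroExt k M :=
  lift (TrivSqZeroExt.inlHom k M) (TrivSqZeroExt.inrHom k M).toAddMonoidHom
    (fun a x => by simp [TrivSqZeroExt.ext_iff])
    (fun a x => by simp [TrivSqZeroExt.ext_iff])
    (fun i j x y hx hy => by simp)
    (fun x hx => by simp)

/-- The counit `ε : S(M) → k`. -/
def counit : SuperSym k 𝓜 →+ k where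
  toFun w := (linearPart 𝓜 w).fst
  map_zero' := by simp
  map_add' := by simp

/-- The generic point `x : S(M) → M`: the identity on `M = S^1(M)` and zero on `S^n(M)`, `n ≠ 1`. -/
def genericPoint : SuperSym k 𝓜 →+ M where
  toFun w := (linearPart 𝓜 w).snd
  map_zero' := by simp
  map_add' := by simp

variable {𝓜}

theorem counit_scalar_mul (a : k) (w : SuperSym k 𝓜) :
    counit 𝓜 (scalar k 𝓜 a * w) = a * counit 𝓜 w := by
  change (linearPart 𝓜 _).fst = a * (linearPart 𝓜 w).fst
  rw [map_mul, linearPart, lift_scalar]; simp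

theorem genericPoint_scalar_mul (a : k) (w : SuperSym k 𝓜) :
    genericPoint 𝓜 (scalar k 𝓜 a * w) = a • genericPoint 𝓜 w := by
  change (linearPart 𝓜 _).snd = a • (linearPart 𝓜 w).snd
  rw [map_mul, linearPart, lift_scalar]; simp

theorem genericPoint_mul_scalar (w : SuperSym k 𝓜) (a : k) :
    genericPoint 𝓜 (w * scalar k 𝓜 a) = MulOpposite.op a • genericPoint 𝓜 w := by
  change (linearPart 𝓜 _).snd = MulOpposite.op a • (linearPart 𝓜 w).snd
  rw [map_mul, linearPart, lift_scalar]; simp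

end Point

theorem comul_scalar (a : k) : comul 𝓜 𝓚 (scalar k 𝓜 a) = inl 𝓜 𝓚 (scalar k 𝓜 a) := by
  rw [comul, lift_scalar]; rfl

variable {𝓜} in
theorem homogeneousComponents_scalar (a : k) :
    homogeneousComponents 𝓜 (scalar k 𝓜 a) = Polynomial.C (scalar k 𝓜 a) := by
  rw [homogeneousComponents, lift_scalar]; rfl
end SuperSym
end Grading
end Sym

/-! ### Lie superalgebras and their coderivations -/

/-- The bracket makes the supermodule `𝔤` a Lie `k`-superalgebra. -/
class LieSuperalgebra {k 𝔤 : Type*} [Ring k] [AddCommGroup 𝔤] [Module k 𝔤] [Module kᵐᵒᵖ 𝔤]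
    [Bracket 𝔤 𝔤] (𝓚 : ZMod 2 → AddSubgroup k) (𝓖 : ZMod 2 → AddSubgroup 𝔤) : Prop where
  add_lie : ∀ X Y Z : 𝔤, ⁅X + Y, Z⁆ = ⁅X, Z⁆ + ⁅Y, Z⁆
  lie_add : ∀ X Y Z : 𝔤, ⁅X, Y + Z⁆ = ⁅X, Y⁆ + ⁅X, Z⁆
  lie_mem : ∀ {i j : ZMod 2} {X Y : 𝔤}, X ∈ 𝓖 i → Y ∈ 𝓖 j → ⁅X, Y⁆ ∈ 𝓖 (i + j)
  lie_smul : ∀ (X Y : 𝔤) (a : k), ⁅X, MulOpposite.op a • Y⁆ = MulOpposite.op a • ⁅X, Y⁆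
  smul_lie : ∀ {i j : ZMod 2} (X : 𝔤) {Y : 𝔤} {a : k}, a ∈ 𝓚 i → Y ∈ 𝓖 j →
    ⁅MulOpposite.op a • X, Y⁆ = ((-1 : ℤˣ) ^ (j * i)) • (MulOpposite.op a • ⁅X, Y⁆)
  lie_skew : ∀ {i j : ZMod 2} {X Y : 𝔤}, X ∈ 𝓖 i → Y ∈ 𝓖 j →
    ⁅X, Y⁆ = -(((-1 : ℤˣ) ^ (i * j)) • ⁅Y, X⁆)
  lie_self : ∀ {X : 𝔤}, X ∈ 𝓖 0 → ⁅X, X⁆ = 0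
  jacobi : ∀ {i j : ZMod 2} {X Y : 𝔤} (Z : 𝔤), X ∈ 𝓖 i → Y ∈ 𝓖 j →
    ⁅⁅X, Y⁆, Z⁆ = ⁅X, ⁅Y, Z⁆⁆ - ((-1 : ℤˣ) ^ (j * i)) • ⁅Y, ⁅X, Z⁆⁆
  lie_lie_self : ∀ {Y : 𝔤}, Y ∈ 𝓖 1 → ⁅Y, ⁅Y, Y⁆⁆ = 0

/-- `𝔤` is `N`-nilpotent: `ad X₁ ∘ ⋯ ∘ ad X_N = 0` for all `X₁, …, X_N`. -/
def IsLieNilpotent (𝔤 : Type*) [AddCommGroup 𝔤] [Bracket 𝔤 𝔤] (N : ℕ) : Prop :=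
  ∀ l : List 𝔤, l.length = N → ∀ Y : 𝔤, l.foldr (fun X Z => ⁅X, Z⁆) Y = 0

/-- The power series `t / (e^t - 1)`, the inverse of `(e^t - 1) / t = ∑ t^n / (n+1)!`. If only
`1/2, …, 1/N` exist in `A`, its coefficients of degree `< N` are those of `t / (e^t - 1)`. -/
def bernoulliSeries (A : Type*) [Ring A] : PowerSeries A :=
  PowerSeries.invOfUnit (PowerSeries.mk fun n => Ring.inverse ((Nat.factorial (n + 1) : ℕ) : A)) 1

section Lie
set_option linter.unusedSectionVars false
variable {k 𝔤 : Type*} [Ring k] [AddCommGroup 𝔤] [Module k 𝔤] [Module kᵐᵒᵖ 𝔤] [Bracket 𝔤 𝔤]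
  (𝓚 : ZMod 2 → AddSubgroup k) (𝓖 : ZMod 2 → AddSubgroup 𝔤) [LieSuperalgebra 𝓚 𝓖]

namespace LieSuperalgebra

/-- The bracket as a biadditive map. -/
def bracketHom : 𝔤 →+ 𝔤 →+ 𝔤 :=
  AddMonoidHom.mk' (fun X => AddMonoidHom.mk' (fun Y => ⁅X, Y⁆) (lie_add 𝓚 𝓖 X))
    fun X Y => by ext Z; exact add_lie 𝓚 𝓖 X Y Z

variable [GradedRing 𝓚] [DirectSum.Decomposition 𝓖] [SuperModule 𝓚 𝓖]

theorem bracketHom_op_smul (X Y : 𝔤) (a : k) :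
    bracketHom 𝓚 𝓖 (MulOpposite.op a • X) Y = bracketHom 𝓚 𝓖 X (a • Y) := by
  induction a using DirectSum.Decomposition.inductionOn 𝓚 with
  | zero => simp
  | add a b ha hb =>
    rw [MulOpposite.op_add, add_smul, add_smul, map_add, map_add, AddMonoidHom.add_apply, ha, hb]
  | @homogeneous i a =>
    induction Y using DirectSum.Decomposition.inductionOn 𝓖 with
    | zero => simp
    | add x y hx hy => rw [smul_add, map_add, map_add, hx, hy]
    | @homogeneous j Y =>
      rw [SuperModule.left_smul a.2 Y.2, units_smul_map]
      change ⁅_, _⁆ = _ • ⁅_, _⁆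
      rw [smul_lie X a.2 Y.2, lie_smul 𝓚 𝓖, mul_comm]

theorem bracketHom_left_smul (X Y : 𝔤) (a : k) :
    bracketHom 𝓚 𝓖 (a • X) Y = a • bracketHom 𝓚 𝓖 X Y := by
  induction a using DirectSum.Decomposition.inductionOn 𝓚 with
  | zero => simp
  | add a b ha hb => rw [add_smul, add_smul, map_add, AddMonoidHom.add_apply, ha, hb]
  | @homogeneous i a =>
    induction X using DirectSum.Decomposition.inductionOn 𝓖 with
    | zero => simp
    | add x y hx hy => rw [smul_add, map_add, map_add, AddMonoidHom.add_apply, hx, hy,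
        AddMonoidHom.add_apply, smul_add]
    | @homogeneous l X =>
      induction Y using DirectSum.Decomposition.inductionOn 𝓖 with
      | zero => simp
      | add x y hx hy => rw [map_add, map_add, smul_add, hx, hy]
      | @homogeneous j Y =>
        have h := units_smul_map ((bracketHom 𝓚 𝓖).flip (Y : 𝔤)) ((-1 : ℤˣ) ^ (i * l))
          (MulOpposite.op (a : k) • (X : 𝔤))
        rw [SuperModule.left_smul a.2 X.2]
        refine h.trans ?_
        change _ • ⁅_, _⁆ = (a : k) • ⁅(X : 𝔤), (Y : 𝔤)⁆
        rw [smul_lie (X : 𝔤) a.2 Y.2, SuperModule.left_smul a.2 (lie_mem 𝓚 X.2 Y.2), smul_smul,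
          mul_add, uzpow_add, mul_comm j i]

end LieSuperalgebra

open LieSuperalgebra

namespace SuperSym

variable [SMulCommClass k kᵐᵒᵖ 𝔤]
  [GradedRing 𝓚] [CommSuperring 𝓚] [DirectSum.Decomposition 𝓖] [SuperModule 𝓚 𝓖]

/-- The bilinear map `S(𝔤) × 𝔤 → S(𝔤)`, `(w, Y) ↦ w Y`. -/
def mulVec : SuperSym k 𝓖 →+ 𝔤 →+ SuperSym k 𝓖 :=
  AddMonoidHom.compl₂ AddMonoidHom.mul (vec k 𝓖)

theorem mulVec_mul_scalar (w : SuperSym k 𝓖) (a : k) (y : 𝔤) :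
    mulVec 𝓖 (w * scalar k 𝓖 a) y = mulVec 𝓖 w (a • y) := by
  change w * scalar k 𝓖 a * vec k 𝓖 y = w * vec k 𝓖 (a • y)
  rw [vec_left, mul_assoc]

variable {𝓖} in
/-- The constant function `S(𝔤) → 𝔤` with value `a`: `1 ↦ a` and `S^n(𝔤) ↦ 0` for `n ≠ 0`. -/
def const {p : ZMod 2} (a : 𝓖 p) : ParityHom 𝓖 𝓚 p 𝔤 where
  toFun := AddMonoidHom.mk' (fun w => MulOpposite.op (counit (k := k) 𝓖 w) • (a : 𝔤)) fun w z => by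
    rw [map_add, MulOpposite.op_add, add_smul]
  map_left {i c} w hc := by
    change MulOpposite.op (counit (k := k) 𝓖 _) • (a : 𝔤) =
      _ • (c • (MulOpposite.op (counit (k := k) 𝓖 _) • (a : 𝔤)))
    have h : MulOpposite.op c • (a : 𝔤) = ((-1 : ℤˣ) ^ (i * p)) • (c • (a : 𝔤)) := by
      rw [SuperModule.left_smul hc a.2, smul_smul, Int.units_mul_self, one_smul]
    rw [counit_scalar_mul, MulOpposite.op_mul, mul_smul, h, smul_comm c,
      ← DistribSMul.toAddMonoidHom_apply 𝔤, units_smul_map, DistribSMul.toAddMonoidHom_apply,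
      mul_comm]

/-- The bilinear map `(w, Y) ↦ [x(w), Y]`, with `x` the generic point. -/
def bracketPoint : SuperSym k 𝓖 →+ 𝔤 →+ 𝔤 := (bracketHom 𝓚 𝓖).comp (genericPoint 𝓖)

theorem bracketPoint_mul_scalar (w : SuperSym k 𝓖) (a : k) (y : 𝔤) :
    bracketPoint 𝓚 𝓖 (w * scalar k 𝓖 a) y = bracketPoint 𝓚 𝓖 w (a • y) := by
  change bracketHom 𝓚 𝓖 (genericPoint 𝓖 _) y = bracketHom 𝓚 𝓖 (genericPoint 𝓖 w) (a • y)
  rw [genericPoint_mul_scalar, bracketHom_op_smul]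

theorem bracketPoint_scalar_mul (a : k) (w : SuperSym k 𝓖) (y : 𝔤) :
    bracketPoint 𝓚 𝓖 (scalar k 𝓖 a * w) y = a • bracketPoint 𝓚 𝓖 w y := by
  change bracketHom 𝓚 𝓖 (genericPoint 𝓖 _) y = a • bracketHom 𝓚 𝓖 (genericPoint 𝓖 w) y
  rw [genericPoint_scalar_mul, bracketHom_left_smul]

variable {𝓚 𝓖} in
/-- `ad x` on `Hom(S(𝔤), 𝔤)`: `G ↦ [x, G] = [·,·] ∘ (x ⊗ G) ∘ Δ`. -/
def adGeneric {p : ZMod 2} (G : ParityHom 𝓖 𝓚 p 𝔤) : ParityHom 𝓖 𝓚 p 𝔤 where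
  toFun := (pairing (bracketPoint 𝓚 𝓖) (bracketPoint_mul_scalar 𝓚 𝓖) G).comp
    (comul 𝓖 𝓚).toAddMonoidHom
  map_left {i a} w ha := by
    change pairing (bracketPoint 𝓚 𝓖) (bracketPoint_mul_scalar 𝓚 𝓖) G
      (comul 𝓖 𝓚 (scalar k 𝓖 a * w)) = _
    rw [map_mul, comul_scalar]
    exact pairing_left _ _ (bracketPoint_scalar_mul 𝓚 𝓖) G ha _

variable {𝓖} in
/-- On a polynomial `∑ w_n X^n` with coefficients in `S(𝔤)`: `∑ c_n (ad x)^n(a)(w_n)`. -/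
def seriesAdPoly (φ : PowerSeries (𝓚 0)) {p : ZMod 2} (a : 𝓖 p) :
    Polynomial (SuperSym k 𝓖) →+ 𝔤 :=
  AddMonoidHom.mk' (fun q => q.sum fun n w =>
      ((PowerSeries.coeff n φ : 𝓚 0) : k) • ((adGeneric^[n] (const 𝓚 a)).toFun w))
    fun q r => Polynomial.sum_add_index _ _ _ (by simp) (by intros; rw [map_add, smul_add])

variable {𝓖} in
theorem seriesAdPoly_monomial (φ : PowerSeries (𝓚 0)) {p : ZMod 2} (a : 𝓖 p) (n : ℕ)
    (w : SuperSym k 𝓖) : seriesAdPoly 𝓚 φ a (Polynomial.monomial n w) =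
      ((PowerSeries.coeff n φ : 𝓚 0) : k) • ((adGeneric^[n] (const 𝓚 a)).toFun w) :=
  Polynomial.sum_monomial_index w (fun n w =>
    ((PowerSeries.coeff n φ : 𝓚 0) : k) • ((adGeneric^[n] (const 𝓚 a)).toFun w)) (by simp)

variable {𝓖} in
theorem seriesAdPoly_left (φ : PowerSeries (𝓚 0)) {p : ZMod 2} (a : 𝓖 p) {i : ZMod 2} {c : k}
    (hc : c ∈ 𝓚 i) (q : Polynomial (SuperSym k 𝓖)) :
    seriesAdPoly 𝓚 φ a (Polynomial.C (scalar k 𝓖 c) * q) =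
      ((-1 : ℤˣ) ^ (p * i)) • (c • seriesAdPoly 𝓚 φ a q) := by
  induction q using Polynomial.induction_on' with
  | add q r hq hr => rw [mul_add, map_add, hq, hr, map_add, smul_add, smul_add]
  | monomial n w =>
    rw [Polynomial.C_mul_monomial, seriesAdPoly_monomial, seriesAdPoly_monomial, ParityHom.map_left _ w hc,
      smul_comm _ ((-1 : ℤˣ) ^ (p * i)), smul_smul, smul_smul c,
      CommSuperring.mul_comm_sign (PowerSeries.coeff n φ : 𝓚 0).2 hc]
    simp

variable {𝓖} in
/-- The formal vector field `φ^a = φ(ad x)(a) = ∑ c_n (ad x)^n(a)`: the map `S(𝔤) → 𝔤` whose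
restriction to `S^n(𝔤)` is `c_n (ad x)^n(a)`. -/
def seriesAd (φ : PowerSeries (𝓚 0)) {p : ZMod 2} (a : 𝓖 p) : ParityHom 𝓖 𝓚 p 𝔤 where
  toFun := (seriesAdPoly 𝓚 φ a).comp (homogeneousComponents (k := k) 𝓖).toAddMonoidHom
  map_left {i c} w hc := by
    change seriesAdPoly 𝓚 φ a (homogeneousComponents (k := k) 𝓖 (scalar k 𝓖 c * w)) =
      _ • (c • seriesAdPoly 𝓚 φ a (homogeneousComponents (k := k) 𝓖 w))
    rw [map_mul, homogeneousComponents_scalar, seriesAdPoly_left 𝓚 φ a hc]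

/-- The coderivation `Φ^a = id * φ^a = Mult ∘ (id ⊗ φ^a) ∘ Δ` of `S(𝔤)`; for non-homogeneous `a`
it is the sum of the contributions of the even and odd components of `a`. -/
def coderivation (φ : PowerSeries (𝓚 0)) (a : 𝔤) : SuperSym k 𝓖 →+ SuperSym k 𝓖 :=
  ∑ p : ZMod 2, (pairing (mulVec 𝓖) (mulVec_mul_scalar 𝓖)
    (seriesAd 𝓚 φ (DirectSum.decompose 𝓖 a p))).comp (comul 𝓖 𝓚).toAddMonoidHom

end SuperSym

end Lie

/-! ### The enveloping algebra and its filtration -/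

section Env

variable (k : Type*) {𝔤 : Type*} [Ring k] [AddCommGroup 𝔤] [Module k 𝔤] [Module kᵐᵒᵖ 𝔤]
  [Bracket 𝔤 𝔤] (𝓖 : ZMod 2 → AddSubgroup 𝔤)

/-- The relation `X ⊗ Y = (-1)^(p(X)p(Y)) Y ⊗ X + [X, Y]` defining the enveloping algebra. -/
inductive SuperEnv.Rel : SuperTensor k 𝔤 → SuperTensor k 𝔤 → Prop
  | comm {i j : ZMod 2} {X Y : 𝔤} : X ∈ 𝓖 i → Y ∈ 𝓖 j →
      Rel (SuperTensor.vec k 𝔤 X * SuperTensor.vec k 𝔤 Y)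
        (((-1 : ℤˣ) ^ (i * j)) • (SuperTensor.vec k 𝔤 Y * SuperTensor.vec k 𝔤 X) +
          SuperTensor.vec k 𝔤 ⁅X, Y⁆)

/-- The enveloping algebra `U(𝔤)`. -/
def SuperEnv : Type _ := RingQuot (SuperEnv.Rel k 𝓖)

instance : Ring (SuperEnv k 𝓖) := inferInstanceAs (Ring (RingQuot _))

namespace SuperEnv

/-- The projection `T(𝔤) → U(𝔤)`. -/
def mk : SuperTensor k 𝔤 →+* SuperEnv k 𝓖 := RingQuot.mkRingHom (Rel k 𝓖)

/-- The structure map `k → U(𝔤)`. -/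
def scalar : k →+* SuperEnv k 𝓖 := (mk k 𝓖).comp (SuperTensor.scalar k 𝔤)

/-- The canonical map `j : 𝔤 → U(𝔤)`. -/
def vec : 𝔤 →+ SuperEnv k 𝓖 := (mk k 𝓖).toAddMonoidHom.comp (SuperTensor.vec k 𝔤)

/-- The `k`-submodule `U_n` generated by the products of at most `n` elements of `j(𝔤)`. -/
def filtration (n : ℕ) : AddSubgroup (SuperEnv k 𝓖) :=
  AddSubgroup.closure {u | ∃ (l : List 𝔤) (a : k), l.length ≤ n ∧
    u = (l.map (vec k 𝓖)).prod * scalar k 𝓖 a}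

/-- `U_{n-1}`, with the convention `U_{-1} = 0`. -/
def filtrationBelow : ℕ → AddSubgroup (SuperEnv k 𝓖)
  | 0 => ⊥
  | n + 1 => filtration k 𝓖 n

variable {k}

/-- The even (`i = 0`) and odd (`i = 1`) parts of `U(𝔤)`. -/
def part (𝓚 : ZMod 2 → AddSubgroup k) (i : ZMod 2) : Submodule ℤ (SuperEnv k 𝓖) :=
  parityPart 𝓚 𝓖 (scalar k 𝓖) (vec k 𝓖) i

end SuperEnv

/-- The `k`-submodule `S^n(𝔤)` of `S(𝔤)` generated by the products of `n` elements of `𝔤`. -/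
def SuperSym.power (n : ℕ) : AddSubgroup (SuperSym k 𝓖) :=
  AddSubgroup.closure {w | ∃ (l : List 𝔤) (a : k), l.length = n ∧
    w = (l.map (SuperSym.vec k 𝓖)).prod * SuperSym.scalar k 𝓖 a}

end Env

/-! ### Derivations, automorphisms and the strong Poincaré–Birkhoff–Witt theorem -/

section PBW

variable {k 𝔤 : Type*} [Ring k] [AddCommGroup 𝔤] [Module k 𝔤] [Module kᵐᵒᵖ 𝔤] [Bracket 𝔤 𝔤]
  (𝓚 : ZMod 2 → AddSubgroup k) (𝓖 : ZMod 2 → AddSubgroup 𝔤)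

/-- `D` is a (`k`-linear) derivation of parity `p` of the Lie superalgebra `𝔤`. -/
structure IsLieDerivation (k : Type*) {𝔤 : Type*} [Ring k] [AddCommGroup 𝔤] [Module kᵐᵒᵖ 𝔤]
    [Bracket 𝔤 𝔤] (𝓖 : ZMod 2 → AddSubgroup 𝔤) (p : ZMod 2) (D : 𝔤 →+ 𝔤) : Prop where
  map_mem : ∀ {i : ZMod 2} {X : 𝔤}, X ∈ 𝓖 i → D X ∈ 𝓖 (p + i)
  map_smul : ∀ (X : 𝔤) (a : k), D (MulOpposite.op a • X) = MulOpposite.op a • D X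
  leibniz : ∀ {i : ZMod 2} {X : 𝔤} (Y : 𝔤), X ∈ 𝓖 i →
    D ⁅X, Y⁆ = ⁅D X, Y⁆ + ((-1 : ℤˣ) ^ (p * i)) • ⁅X, D Y⁆

/-- `f` is an automorphism of the Lie `k`-superalgebra `𝔤`. -/
structure IsLieAutomorphism (k : Type*) {𝔤 : Type*} [Ring k] [AddCommGroup 𝔤] [Module kᵐᵒᵖ 𝔤]
    [Bracket 𝔤 𝔤] (𝓖 : ZMod 2 → AddSubgroup 𝔤) (f : 𝔤 ≃+ 𝔤) : Prop where
  map_mem : ∀ {i : ZMod 2} {X : 𝔤}, X ∈ 𝓖 i → f X ∈ 𝓖 i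
  map_smul : ∀ (X : 𝔤) (a : k), f (MulOpposite.op a • X) = MulOpposite.op a • f X
  map_lie : ∀ X Y : 𝔤, f ⁅X, Y⁆ = ⁅f X, f Y⁆

/-- For a superring `R` with parity `𝓡`, a structure map `s : k → R` and a map `v : 𝔤 → R`,
`E` is a `k`-linear superderivation of `R` of parity `p` extending `D : 𝔤 → 𝔤` along `v`. -/
structure IsDerivationExtension {k 𝔤 R : Type*} [Ring k] [AddCommGroup 𝔤] [Ring R]
    (𝓡 : ZMod 2 → Submodule ℤ R) (s : k →+* R) (v : 𝔤 →+ R) (p : ZMod 2) (D : 𝔤 →+ 𝔤)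
    (E : R →+ R) : Prop where
  map_vec : ∀ X : 𝔤, E (v X) = v (D X)
  map_smul : ∀ (w : R) (a : k), E (w * s a) = E w * s a
  map_mem : ∀ {i : ZMod 2} {w : R}, w ∈ 𝓡 i → E w ∈ 𝓡 (p + i)
  leibniz : ∀ {i : ZMod 2} {w : R} (z : R), w ∈ 𝓡 i →
    E (w * z) = E w * z + ((-1 : ℤˣ) ^ (p * i)) • (w * E z)

/-- `F` is a morphism of rings under `k` extending `f : 𝔤 → 𝔤` along `v : 𝔤 → R`. -/
structure IsMorphismExtension {k 𝔤 R : Type*} [Ring k] [AddCommGroup 𝔤] [Ring R]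
    (s : k →+* R) (v : 𝔤 →+ R) (f : 𝔤 →+ 𝔤) (F : R →+* R) : Prop where
  map_vec : ∀ X : 𝔤, F (v X) = v (f X)
  map_scalar : ∀ a : k, F (s a) = s a

/-- `ρ : S(𝔤) → U(𝔤)` is an isomorphism of `k`-modules as required by the strong
Poincaré–Birkhoff–Witt theorem. -/
structure IsStrongPBW (ρ : SuperSym k 𝓖 →+ SuperEnv k 𝓖) : Prop where
  bijective : Function.Bijective ρ
  map_smul : ∀ (w : SuperSym k 𝓖) (a : k),
    ρ (w * SuperSym.scalar k 𝓖 a) = ρ w * SuperEnv.scalar k 𝓖 a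
  /-- `ρ(S^n(𝔤)) ⊆ U_n(𝔤)`. -/
  map_power : ∀ (n : ℕ) (w : SuperSym k 𝓖), w ∈ SuperSym.power k 𝓖 n →
    ρ w ∈ SuperEnv.filtration k 𝓖 n
  /-- The associated graded map sends `X₁ ⋯ Xₙ` to the class of `j(X₁) ⋯ j(Xₙ)` in
  `U_n / U_{n-1}`, that is, it is the canonical map `S(𝔤) → gr U(𝔤)`. -/
  graded : ∀ l : List 𝔤, ρ (l.map (SuperSym.vec k 𝓖)).prod - (l.map (SuperEnv.vec k 𝓖)).prod ∈
    SuperEnv.filtrationBelow k 𝓖 l.length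
  /-- Every derivation of `𝔤` extends to derivations of `S(𝔤)` and of `U(𝔤)`, and `ρ` intertwines
  the extensions. -/
  derivation : ∀ (p : ZMod 2) (D : 𝔤 →+ 𝔤), IsLieDerivation k 𝓖 p D →
    (∃ E, IsDerivationExtension (SuperSym.part 𝓖 𝓚) (SuperSym.scalar k 𝓖) (SuperSym.vec k 𝓖)
      p D E) ∧
    (∃ E, IsDerivationExtension (SuperEnv.part 𝓖 𝓚) (SuperEnv.scalar k 𝓖) (SuperEnv.vec k 𝓖)
      p D E) ∧
    ∀ E₁ E₂,
      IsDerivationExtension (SuperEnv.part 𝓖 𝓚) (SuperEnv.scalar k 𝓖) (SuperEnv.vec k 𝓖) p D E₁ →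
      IsDerivationExtension (SuperSym.part 𝓖 𝓚) (SuperSym.scalar k 𝓖) (SuperSym.vec k 𝓖) p D E₂ →
      ∀ w, ρ (E₂ w) = E₁ (ρ w)
  /-- Every automorphism of `𝔤` extends to `S(𝔤)` and to `U(𝔤)`, and `ρ` intertwines the
  extensions. -/
  automorphism : ∀ f : 𝔤 ≃+ 𝔤, IsLieAutomorphism k 𝓖 f →
    (∃ F, IsMorphismExtension (SuperSym.scalar k 𝓖) (SuperSym.vec k 𝓖) f.toAddMonoidHom F) ∧
    (∃ F, IsMorphismExtension (SuperEnv.scalar k 𝓖) (SuperEnv.vec k 𝓖) f.toAddMonoidHom F) ∧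
    ∀ F₁ F₂,
      IsMorphismExtension (SuperEnv.scalar k 𝓖) (SuperEnv.vec k 𝓖) f.toAddMonoidHom F₁ →
      IsMorphismExtension (SuperSym.scalar k 𝓖) (SuperSym.vec k 𝓖) f.toAddMonoidHom F₂ →
      ∀ w, ρ (F₂ w) = F₁ (ρ w)

variable [LieSuperalgebra 𝓚 𝓖] [SMulCommClass k kᵐᵒᵖ 𝔤] [GradedRing 𝓚] [CommSuperring 𝓚]
  [DirectSum.Decomposition 𝓖] [SuperModule 𝓚 𝓖]

/-- `Φ` is the morphism of `k`-superalgebras `U(𝔤) → Hom(S(𝔤), S(𝔤))` with `Φ ∘ j = Φ₁`, where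
`Φ₁ : a ↦ Φ₁^a` is given by the coderivations attached to `φ₁ = t / (e^t - 1)`. A scalar `a : k`
acts on `Hom(S(𝔤), S(𝔤))` through left multiplication by `a` on `S(𝔤)`. -/
structure IsSymbolRepresentation
    (Φ : SuperEnv k 𝓖 →+* AddMonoid.End (SuperSym k 𝓖)) : Prop where
  apply_vec : ∀ (a : 𝔤) (w : SuperSym k 𝓖),
    Φ (SuperEnv.vec k 𝓖 a) w = SuperSym.coderivation 𝓚 𝓖 (bernoulliSeries (𝓚 0)) a w
  apply_scalar : ∀ (a : k) (w : SuperSym k 𝓖),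
    Φ (SuperEnv.scalar k 𝓖 a) w = SuperSym.scalar k 𝓖 a * w
  /-- Every `Φ(u)` is a morphism of (right) `k`-modules. -/
  map_smul : ∀ (u : SuperEnv k 𝓖) (w : SuperSym k 𝓖) (a : k),
    Φ u (w * SuperSym.scalar k 𝓖 a) = Φ u w * SuperSym.scalar k 𝓖 a
  /-- `Φ` preserves parities. -/
  map_mem : ∀ {i j : ZMod 2} {u : SuperEnv k 𝓖} {w : SuperSym k 𝓖},
    u ∈ SuperEnv.part 𝓖 𝓚 i → w ∈ SuperSym.part 𝓖 𝓚 j → Φ u w ∈ SuperSym.part 𝓖 𝓚 (i + j)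

end PBW

end

open scoped DirectSum TensorProduct

noncomputable section

open LieSuperalgebra

/-! A linear map `F : S(𝔤) → 𝔤` is a formal vector field, and the coderivation `V_F = id * F`
(`vectorField`) is the operator it defines on `S(𝔤)`. The heart of the matter is that `a ↦ V_{φ^a}`
is a representation of `𝔤`; the rest compares leading terms.

The supercommutator of `V_F` and `V_G` is `V_H` with `H = F ∘ V_G - (-1)^(pr) G ∘ V_F`
(`vectorField_commutator`), so for `F = φ^a` and `G = φ^b` one has to find `H = φ^[a,b]`
(`seriesAd_bracket`). Composition with `V_G` acts as a derivation that replaces the generic point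
`x` by `G` (`adPoint_comp_vectorField`) and kills constants. Hence `(ad x)^n(a) ∘ V_G` is, up to
sign, a sum over the places where an `x` becomes `G` (`adIter_comp_vectorField`). Since `ad x` is a
derivation of the convolution bracket (`adPoint_convBracket`), encoding `[(ad x)^i(b), (ad x)^j(a)]`
by the monomial `s^i t^j` turns `ad x` into multiplication by `s + t` (`adPoint_bracketPoly`). Up to
sign, `H` is then the image of `φ(s)(φ(s+t) - φ(t))/s + φ(t)(φ(s+t) - φ(s))/t`. This equals
`-φ(s+t)`, which is the rule `e^(s+t) = e^s e^t` rewritten for `φ`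
(`PowerSeries.bernoulli_functional_equation`), and `(s+t)^L` encodes `(ad x)^L([b,a])`.

On `S^L(𝔤)` this identity uses the inverse of `(L+2)!` and concerns elements with `L+1` nested
brackets. In the `N`-nilpotent case either `N ≥ L+2` and the factorial is invertible, or `N ≤ L+1`
and both sides vanish; `HasBernoulli` records this alternative.

The universal property of `U(𝔤)` now yields `Φ`. Because `c_0 = 1`, one has `Φ^X(w) = Xw` up to
terms of degree at most that of `w`, so the symbol of `j(X₁)⋯j(Xₙ)` is `X₁⋯Xₙ` plus lower terms
(`symbol_prod`). Surjectivity follows by triangularity. For injectivity, the canonical map `S(𝔤) →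
gr U(𝔤)`, which exists because `1/2` does, sends the leading term of the symbol of `u ∈ U_n` to the
class of `u` (`exists_leading_term`); so an element with zero symbol descends through the whole
filtration.

A derivation `D` acts on `S(𝔤)` by the coderivation of the linear vector field `D ∘ x`, whose
supercommutator with `Φ^X` is `Φ^(DX)`; an automorphism `f`, extended to `S(𝔤)`, conjugates `Φ^X`
into `Φ^(fX)`. Both therefore commute with the symbol map, hence with `β`.

Identities between convolutions are not derived from coassociativity. A convolution is determined by
its value at `1`, its right linearity and its behaviour under `w ↦ Xw`, where the product rule
`conv_vec_mul` holds; the identities follow by induction on words, for all maps at once, because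
each step replaces `F` by its derivative `w ↦ F(Xw)`. -/

/-- The sign `(-1)^(ij)` attached to two parities. -/
def koszulSign (i j : ZMod 2) : ℤˣ := (-1 : ℤˣ) ^ (i * j)

theorem koszulSign_def (i j : ZMod 2) : (-1 : ℤˣ) ^ (i * j) = koszulSign i j := rfl

theorem koszulSign_add_left (i j l : ZMod 2) :
    koszulSign (i + j) l = koszulSign i l * koszulSign j l := by
  simp only [koszulSign, add_mul, uzpow_add]

theorem koszulSign_add_right (i j l : ZMod 2) :
    koszulSign i (j + l) = koszulSign i j * koszulSign i l := by
  simp only [koszulSign, mul_add, uzpow_add]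

theorem koszulSign_comm (i j : ZMod 2) : koszulSign i j = koszulSign j i := by
  simp only [koszulSign, mul_comm]

@[simp] theorem koszulSign_zero_left (j : ZMod 2) : koszulSign 0 j = 1 := by simp [koszulSign]

@[simp] theorem koszulSign_zero_right (j : ZMod 2) : koszulSign j 0 = 1 := by simp [koszulSign]

theorem koszulSign_eq_one_or (i j : ZMod 2) : koszulSign i j = 1 ∨ koszulSign i j = -1 :=
  Int.units_eq_one_or _

@[simp] theorem koszulSign_mul_self (i j : ZMod 2) : koszulSign i j * koszulSign i j = 1 :=
  Int.units_mul_self _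

theorem AddSubgroup.units_smul_mem {A : Type*} [AddCommGroup A] (s : AddSubgroup A) (e : ℤˣ)
    {x : A} (hx : x ∈ s) : e • x ∈ s := by
  rw [Units.smul_def]; exact zsmul_mem hx _

theorem units_smul_smul {k A : Type*} [Ring k] [AddCommGroup A] [Module k A] (e : ℤˣ) (a : k)
    (x : A) : a • (e • x) = e • (a • x) := smul_comm _ _ _

theorem neg_one_units_smul {A : Type*} [AddCommGroup A] (x : A) : (-1 : ℤˣ) • x = -x := by
  rw [Units.smul_def]; simp

namespace SuperSym

/-! ### Induction on words in the symmetric superalgebra. -/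

section Induction

variable {k M : Type*} [Ring k] [AddCommGroup M] [Module k M] [Module kᵐᵒᵖ M]
  {𝓚 : ZMod 2 → AddSubgroup k} {𝓜 : ZMod 2 → AddSubgroup M}
  [GradedRing 𝓚] [DirectSum.Decomposition 𝓜] [SuperModule 𝓚 𝓜] [CommSuperring 𝓚]

/-- Induction on homogeneous elements of `S(M)`. -/
theorem part_induction {P : ZMod 2 → SuperSym k 𝓜 → Prop} (zero : ∀ i, P i 0)
    (add : ∀ i w z, P i w → P i z → P i (w + z)) (one : P 0 1)
    (vec_mul : ∀ (q j : ZMod 2) (X : M) (w : SuperSym k 𝓜), X ∈ 𝓜 q → w ∈ part 𝓜 𝓚 j →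
      P j w → P (q + j) (vec k 𝓜 X * w))
    (mul_scalar : ∀ (i j : ZMod 2) (a : k) (w : SuperSym k 𝓜), a ∈ 𝓚 i → w ∈ part 𝓜 𝓚 j →
      P j w → P (j + i) (w * scalar k 𝓜 a))
    {i : ZMod 2} {w : SuperSym k 𝓜} (hw : w ∈ part 𝓜 𝓚 i) : P i w := by
  -- The parity parts are spans over `ℤ`, and an integer multiple is a right multiplication by an
  -- even scalar.
  have zsmul : ∀ (n : ℤ) (i : ZMod 2) (w : SuperSym k 𝓜), w ∈ part 𝓜 𝓚 i → P i w →
      P i (n • w) := by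
    intro n i w hw h
    have hn : ((n : ℤ) : k) ∈ 𝓚 0 := SetLike.intCast_mem_graded 𝓚 n
    have := mul_scalar 0 i n w hn hw h
    rw [map_intCast, add_zero] at this
    rwa [zsmul_eq_mul, Int.cast_comm]
  -- Strengthened so that it is stable under products of words: every word, as a left factor,
  -- preserves `P`. Scalars inside a word are moved to the right end at the cost of a sign.
  have key : ∀ (i : ZMod 2) (z : SuperSym k 𝓜),
      ParityWord 𝓚 𝓜 (scalar k 𝓜) (vec k 𝓜) i z → z ∈ part 𝓜 𝓚 i ∧
      ∀ j y, y ∈ part 𝓜 𝓚 j → P j y → P (i + j) (z * y) := by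
    intro i z hz
    refine ⟨Submodule.subset_span hz, ?_⟩
    induction hz with
    | @scalar i a ha =>
      intro j y hy h
      rw [scalar_comm 𝓜 𝓚 ha hy, Units.smul_def, add_comm]
      exact zsmul _ _ _ (SetLike.GradedMul.mul_mem hy (scalar_mem_part 𝓜 𝓚 ha))
        (mul_scalar _ _ _ _ ha hy h)
    | vec hx => intro j y hy h; exact vec_mul _ _ _ _ hx hy h
    | @mul i j w z hw hz h1 h2 =>
      intro l y hy h
      rw [mul_assoc, add_assoc]
      exact h1 _ _ (SetLike.GradedMul.mul_mem (Submodule.subset_span hz) hy) (h2 _ _ hy h)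
  have one0 : (1 : SuperSym k 𝓜) ∈ part 𝓜 𝓚 0 := SetLike.GradedOne.one_mem
  induction hw using Submodule.span_induction with
  | mem w hw => simpa using (key _ w hw).2 0 1 one0 one
  | zero => exact zero _
  | add x y hx hy h1 h2 => exact add _ _ _ h1 h2
  | smul r x hx h => exact zsmul _ _ _ hx h

variable (𝓚) in
/-- Every element of `S(M)` is obtained from `1` by sums, left multiplications by homogeneous
elements of `M` and right multiplications by scalars. -/
theorem induction_vec_mul {P : SuperSym k 𝓜 → Prop}
    (add : ∀ w z, P w → P z → P (w + z)) (one : P 1)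
    (vec_mul : ∀ (q : ZMod 2) (X : M) (w : SuperSym k 𝓜), X ∈ 𝓜 q → P w → P (vec k 𝓜 X * w))
    (mul_scalar : ∀ (i : ZMod 2) (a : k) (w : SuperSym k 𝓜), a ∈ 𝓚 i → P w →
      P (w * scalar k 𝓜 a))
    (w : SuperSym k 𝓜) : P w := by
  have zero : P 0 := by simpa using mul_scalar 0 0 1 (zero_mem _) one
  induction w using DirectSum.Decomposition.inductionOn (part 𝓜 𝓚) with
  | zero => exact zero
  | add a b ha hb => exact add _ _ ha hb
  | homogeneous w =>
    exact part_induction (P := fun _ w => P w) (fun _ => zero) (fun _ => add) one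
      (fun q _ X w hX _ => vec_mul q X w hX) (fun i _ a w ha _ => mul_scalar i a w ha) w.2

end Induction

/-! ### Convolution products and directional derivatives. -/

section Conv
set_option linter.unusedSectionVars false

variable {k M C C' : Type*} [Ring k] [AddCommGroup M] [Module k M] [Module kᵐᵒᵖ M]
  [AddCommGroup C] [AddCommGroup C']
  {𝓚 : ZMod 2 → AddSubgroup k} {𝓜 : ZMod 2 → AddSubgroup M}
  [GradedRing 𝓚] [DirectSum.Decomposition 𝓜] [SuperModule 𝓚 𝓜] [CommSuperring 𝓚]

/-- `F : S(M) → M` is homogeneous of parity `p` and right `k`-linear. -/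
structure IsHom (𝓚 : ZMod 2 → AddSubgroup k) (p : ZMod 2) (F : SuperSym k 𝓜 →+ M) : Prop where
  map_mem : ∀ {i : ZMod 2} {w : SuperSym k 𝓜}, w ∈ part 𝓜 𝓚 i → F w ∈ 𝓜 (p + i)
  map_right : ∀ (w : SuperSym k 𝓜) (a : k), F (w * scalar k 𝓜 a) = MulOpposite.op a • F w

theorem op_smul_eq_smul {i j : ZMod 2} {a : k} {y : M} (ha : a ∈ 𝓚 i) (hy : y ∈ 𝓜 j) :
    MulOpposite.op a • y = koszulSign i j • (a • y) := by
  rw [SuperModule.left_smul ha hy, koszulSign_def, smul_smul]; simp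

theorem op_units_smul (e : ℤˣ) (a : k) (y : M) :
    MulOpposite.op a • (e • y) = e • (MulOpposite.op a • y) := smul_comm _ _ _

/-- Moving the scalar to the right of `w` and back to the left of `F w` costs the signs of `ij` and
`i(p+j)`; what remains is the sign of `pi`. This makes such an `F` a `ParityHom`, the input required
by `pairing`. -/
theorem IsHom.map_left {p : ZMod 2} {F : SuperSym k 𝓜 →+ M} (hF : IsHom 𝓚 p F) {i : ZMod 2}
    {a : k} (w : SuperSym k 𝓜) (ha : a ∈ 𝓚 i) :
    F (scalar k 𝓜 a * w) = koszulSign p i • (a • F w) := by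
  induction w using DirectSum.Decomposition.inductionOn (part 𝓜 𝓚) with
  | zero => simp
  | add w z hw hz => rw [mul_add, map_add, hw, hz, map_add, smul_add, smul_add]
  | @homogeneous j w =>
    rw [scalar_comm 𝓜 𝓚 ha w.2, units_smul_map, hF.map_right,
      op_smul_eq_smul ha (hF.map_mem w.2), koszulSign_def, smul_smul, koszulSign_add_right,
      koszulSign_comm p i, mul_left_comm, koszulSign_mul_self, mul_one]

/-- A homogeneous `k`-linear map as a `ParityHom`. -/
def IsHom.toParityHom {p : ZMod 2} {F : SuperSym k 𝓜 →+ M} (hF : IsHom 𝓚 p F) :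
    ParityHom 𝓜 𝓚 p M where
  toFun := F
  map_left w ha := hF.map_left w ha

/-- The bilinear map `B : S(M) × M → C` is `k`-balanced. -/
abbrev IsBalanced (B : SuperSym k 𝓜 →+ M →+ C) : Prop :=
  ∀ (w : SuperSym k 𝓜) (a : k) (y : M), B (w * scalar k 𝓜 a) y = B w (a • y)

open Classical in
/-- The map `B ∘ (id ⊗ G) ∘ Δ : S(M) → C` for `G` of parity `p` (and zero if `B`, `G` are not
linear over `k`). -/
def conv (𝓚 : ZMod 2 → AddSubgroup k) [GradedRing 𝓚] [SuperModule 𝓚 𝓜] [CommSuperring 𝓚]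
    (p : ZMod 2) (B : SuperSym k 𝓜 →+ M →+ C) (G : SuperSym k 𝓜 →+ M) : SuperSym k 𝓜 →+ C :=
  if h : IsBalanced B ∧ IsHom 𝓚 p G then
    (pairing B h.1 h.2.toParityHom).comp (comul 𝓜 𝓚).toAddMonoidHom
  else 0

/-- The map `w ↦ F(X w)`. -/
def partialDeriv (X : M) (F : SuperSym k 𝓜 →+ C) : SuperSym k 𝓜 →+ C :=
  F.comp (AddMonoidHom.mulLeft (vec k 𝓜 X))

theorem partialDeriv_apply (X : M) (F : SuperSym k 𝓜 →+ C) (w : SuperSym k 𝓜) :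
    partialDeriv X F w = F (vec k 𝓜 X * w) := rfl

theorem IsHom.partialDeriv {p q : ZMod 2} {F : SuperSym k 𝓜 →+ M} (hF : IsHom 𝓚 p F) {X : M}
    (hX : X ∈ 𝓜 q) : IsHom 𝓚 (p + q) (partialDeriv X F) where
  map_mem hw := by
    rw [add_assoc]; exact hF.map_mem (SetLike.GradedMul.mul_mem (vec_mem_part 𝓜 𝓚 hX) hw)
  map_right w a := by rw [partialDeriv_apply, ← mul_assoc, hF.map_right]; rfl

theorem IsBalanced.partialDeriv {B : SuperSym k 𝓜 →+ M →+ C} (hB : IsBalanced B) (X : M) :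
    IsBalanced (partialDeriv X B) := by
  intro w a y; rw [partialDeriv_apply, ← mul_assoc, hB]; rfl

theorem IsBalanced.compr₂ {B : SuperSym k 𝓜 →+ M →+ C} (hB : IsBalanced B) (ρ : C →+ C') :
    IsBalanced (B.compr₂ ρ) := by
  intro w a y; exact congrArg ρ (hB w a y)

theorem IsBalanced.add {B B' : SuperSym k 𝓜 →+ M →+ C} (hB : IsBalanced B)
    (hB' : IsBalanced B') : IsBalanced (B + B') := by
  intro w a y
  simp only [AddMonoidHom.add_apply, hB w a y, hB' w a y]

theorem IsHom.zero (p : ZMod 2) : IsHom 𝓚 p (0 : SuperSym k 𝓜 →+ M) where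
  map_mem _ := zero_mem _
  map_right _ _ := (smul_zero _).symm

theorem IsHom.add {p : ZMod 2} {F G : SuperSym k 𝓜 →+ M} (hF : IsHom 𝓚 p F)
    (hG : IsHom 𝓚 p G) : IsHom 𝓚 p (F + G) where
  map_mem hw := add_mem (hF.map_mem hw) (hG.map_mem hw)
  map_right w a := by simp [hF.map_right, hG.map_right]

theorem IsHom.neg {p : ZMod 2} {F : SuperSym k 𝓜 →+ M} (hF : IsHom 𝓚 p F) :
    IsHom 𝓚 p (-F) where
  map_mem hw := neg_mem (hF.map_mem hw)
  map_right w a := by simp [hF.map_right]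

theorem IsHom.sub {p : ZMod 2} {F G : SuperSym k 𝓜 →+ M} (hF : IsHom 𝓚 p F)
    (hG : IsHom 𝓚 p G) : IsHom 𝓚 p (F - G) := by
  rw [sub_eq_add_neg]; exact hF.add hG.neg

theorem IsHom.units_smul {p : ZMod 2} {F : SuperSym k 𝓜 →+ M} (hF : IsHom 𝓚 p F) (e : ℤˣ) :
    IsHom 𝓚 p (e • F) := by
  rcases Int.units_eq_one_or e with rfl | rfl
  · rwa [one_smul]
  · rw [neg_one_units_smul]; exact hF.neg

theorem IsHom.sum {ι : Type*} {p : ZMod 2} {s : Finset ι} {F : ι → SuperSym k 𝓜 →+ M}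
    (hF : ∀ i ∈ s, IsHom 𝓚 p (F i)) : IsHom 𝓚 p (∑ i ∈ s, F i) :=
  Finset.sum_induction _ (IsHom 𝓚 p) (fun _ _ h h' => h.add h') (IsHom.zero p) hF

section SMul
variable [SMulCommClass k kᵐᵒᵖ M]

theorem IsHom.smul {p i : ZMod 2} {F : SuperSym k 𝓜 →+ M} (hF : IsHom 𝓚 p F) {c : k}
    (hc : c ∈ 𝓚 i) : IsHom 𝓚 (i + p) (c • F) where
  map_mem {j w} hw := by
    rw [add_assoc]; exact left_smul_mem 𝓜 𝓚 hc (hF.map_mem hw)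
  map_right w a := by
    simp only [AddMonoidHom.smul_apply, hF.map_right]; exact smul_comm _ _ _

end SMul

theorem conv_eq {p : ZMod 2} {B : SuperSym k 𝓜 →+ M →+ C} (hB : IsBalanced B)
    {G : SuperSym k 𝓜 →+ M} (hG : IsHom 𝓚 p G) (w : SuperSym k 𝓜) :
    conv 𝓚 p B G w = pairing B hB hG.toParityHom (comul 𝓜 𝓚 w) := by
  rw [conv, dif_pos ⟨hB, hG⟩]; rfl

theorem square_induction {P : Square 𝓜 𝓚 → Prop} (zero : P 0)
    (add : ∀ x y, P x → P y → P (x + y))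
    (tmul : ∀ (i j : ZMod 2) (w z : SuperSym k 𝓜), w ∈ part 𝓜 𝓚 i → z ∈ part 𝓜 𝓚 j →
      P (tmk 𝓜 𝓚 (w ᵍ⊗ₜ[ℤ] z))) (x : Square 𝓜 𝓚) : P x := by
  obtain ⟨z, rfl⟩ := Ideal.Quotient.mk_surjective x
  change P (tmk 𝓜 𝓚 z)
  induction z using tensorInt_induction with
  | zero => rw [map_zero]; exact zero
  | add x y hx hy => rw [map_add]; exact add _ _ hx hy
  | tmul i j w z hw hz => exact tmul i j w z hw hz

theorem pairing_tmul {p : ZMod 2} {B : SuperSym k 𝓜 →+ M →+ C} (hB : IsBalanced B)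
    (G : ParityHom 𝓜 𝓚 p M) {i : ZMod 2} {w : SuperSym k 𝓜} (hw : w ∈ part 𝓜 𝓚 i)
    (z : SuperSym k 𝓜) :
    pairing B hB G (tmk 𝓜 𝓚 (w ᵍ⊗ₜ[ℤ] z)) = koszulSign p i • B w (G.toFun z) := by
  rw [pairing_tmk, pairingInt_tmul, twist_of_mem 𝓜 𝓚 p hw, koszulSign_def]
  exact units_smul_map (B.flip (G.toFun z)) _ _

theorem comul_vec (X : M) :
    comul 𝓜 𝓚 (vec k 𝓜 X) = inl 𝓜 𝓚 (vec k 𝓜 X) + inr 𝓜 𝓚 (vec k 𝓜 X) := by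
  rw [comul, lift_vec]; rfl

theorem one_mem_part : (1 : SuperSym k 𝓜) ∈ part 𝓜 𝓚 0 := SetLike.GradedOne.one_mem

theorem inl_mul_tmk {i j : ZMod 2} {u w : SuperSym k 𝓜} (_hu : u ∈ part 𝓜 𝓚 i)
    (hw : w ∈ part 𝓜 𝓚 j) (z : SuperSym k 𝓜) :
    inl 𝓜 𝓚 u * tmk 𝓜 𝓚 (w ᵍ⊗ₜ[ℤ] z) = tmk 𝓜 𝓚 ((u * w) ᵍ⊗ₜ[ℤ] z) := by
  change tmk 𝓜 𝓚 (u ᵍ⊗ₜ[ℤ] 1) * _ = _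
  rw [← map_mul, tmul_mul_tmul _ _ one_mem_part hw]; simp

theorem inr_mul_tmk {i j : ZMod 2} {u w : SuperSym k 𝓜} (hu : u ∈ part 𝓜 𝓚 i)
    (hw : w ∈ part 𝓜 𝓚 j) (z : SuperSym k 𝓜) :
    inr 𝓜 𝓚 u * tmk 𝓜 𝓚 (w ᵍ⊗ₜ[ℤ] z) = koszulSign i j • tmk 𝓜 𝓚 (w ᵍ⊗ₜ[ℤ] (u * z)) := by
  change tmk 𝓜 𝓚 (1 ᵍ⊗ₜ[ℤ] u) * _ = _
  rw [← map_mul, tmul_mul_tmul _ _ hu hw, units_smul_map, one_mul]; rfl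

theorem tmk_mul_inr {j : ZMod 2} (w : SuperSym k 𝓜) {z u : SuperSym k 𝓜}
    (hz : z ∈ part 𝓜 𝓚 j) :
    tmk 𝓜 𝓚 (w ᵍ⊗ₜ[ℤ] z) * inr 𝓜 𝓚 u = tmk 𝓜 𝓚 (w ᵍ⊗ₜ[ℤ] (z * u)) := by
  change _ * tmk 𝓜 𝓚 (1 ᵍ⊗ₜ[ℤ] u) = _
  rw [← map_mul, tmul_mul_tmul _ _ hz one_mem_part]; simp

section
variable {p : ZMod 2} {B : SuperSym k 𝓜 →+ M →+ C} {G : SuperSym k 𝓜 →+ M}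

theorem conv_one (hB : IsBalanced B) (hG : IsHom 𝓚 p G) : conv 𝓚 p B G 1 = B 1 (G 1) := by
  rw [conv_eq hB hG, map_one]
  change pairing B hB _ (tmk 𝓜 𝓚 (1 ᵍ⊗ₜ[ℤ] 1)) = _
  rw [pairing_tmul hB _ one_mem_part]; simp; rfl

/-- Product rule, from `Δ(Xw) = (X ⊗ 1 + 1 ⊗ X) Δ(w)`: the factor `X` goes either into `B`, past `G`
and with a sign, or into `G`. With the value at `1` and right linearity it determines the
convolution recursively. -/
theorem conv_vec_mul (hB : IsBalanced B) (hG : IsHom 𝓚 p G) {q : ZMod 2} {X : M} (hX : X ∈ 𝓜 q)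
    (w : SuperSym k 𝓜) :
    conv 𝓚 p B G (vec k 𝓜 X * w) = koszulSign p q • conv 𝓚 p (partialDeriv X B) G w +
      conv 𝓚 (p + q) B (partialDeriv X G) w := by
  rw [conv_eq hB hG, conv_eq (hB.partialDeriv X) hG, conv_eq hB (hG.partialDeriv hX), map_mul,
    comul_vec]
  have hX' := vec_mem_part 𝓜 𝓚 hX
  induction comul 𝓜 𝓚 w using square_induction with
  | zero => simp
  | add x y hx hy => simp only [mul_add, map_add, hx, hy, smul_add]; abel
  | tmul i j w z hw hz =>
    rw [add_mul, map_add, inl_mul_tmk hX' hw, inr_mul_tmk hX' hw, units_smul_map,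
      pairing_tmul hB _ (SetLike.GradedMul.mul_mem hX' hw), pairing_tmul hB _ hw,
      pairing_tmul _ _ hw, pairing_tmul _ _ hw, koszulSign_add_right, koszulSign_add_left,
      smul_smul, smul_smul, mul_comm (koszulSign q i)]
    rfl

theorem conv_mul_scalar (hB : IsBalanced B) (hG : IsHom 𝓚 p G) {a : k} {ρ : C →+ C}
    (hρ : ∀ w y, B w (MulOpposite.op a • y) = ρ (B w y)) (w : SuperSym k 𝓜) :
    conv 𝓚 p B G (w * scalar k 𝓜 a) = ρ (conv 𝓚 p B G w) := by
  rw [conv_eq hB hG, conv_eq hB hG, map_mul, comul_scalar, inl_scalar]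
  induction comul 𝓜 𝓚 w using square_induction with
  | zero => simp
  | add x y hx hy => rw [add_mul, map_add, hx, hy, map_add, map_add]
  | tmul i j w z hw hz =>
    rw [tmk_mul_inr _ hz, pairing_tmul hB _ hw, pairing_tmul hB _ hw, units_smul_map, ← hρ]
    exact congrArg (fun y => koszulSign p i • B w y) (hG.map_right z a)

theorem conv_compr₂ (hB : IsBalanced B) (hG : IsHom 𝓚 p G) (ρ : C →+ C') (w : SuperSym k 𝓜) :
    conv 𝓚 p (B.compr₂ ρ) G w = ρ (conv 𝓚 p B G w) := by
  rw [conv_eq hB hG, conv_eq (hB.compr₂ ρ) hG]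
  induction comul 𝓜 𝓚 w using square_induction with
  | zero => simp
  | add x y hx hy => rw [map_add, map_add, map_add, hx, hy]
  | tmul i j w z hw hz =>
    rw [pairing_tmul _ _ hw, pairing_tmul _ _ hw, units_smul_map]; rfl

theorem conv_smul [SMulCommClass k kᵐᵒᵖ M] (hB : IsBalanced B) (hG : IsHom 𝓚 p G) {i : ZMod 2}
    {c : k} (hc : c ∈ 𝓚 i) {ρ : C →+ C} (hρ : ∀ w y, B (scalar k 𝓜 c * w) y = ρ (B w y))
    (w : SuperSym k 𝓜) : conv 𝓚 (i + p) B (c • G) w = ρ (conv 𝓚 p B G w) := by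
  rw [conv_eq hB hG, conv_eq hB (hG.smul hc)]
  induction comul 𝓜 𝓚 w using square_induction with
  | zero => simp
  | add x y hx hy => rw [map_add, map_add, map_add, hx, hy]
  | tmul j l w z hw hz =>
    rw [pairing_tmul _ _ hw, pairing_tmul _ _ hw, units_smul_map, ← hρ, scalar_comm 𝓜 𝓚 hc hw,
      koszulSign_def, koszulSign_add_left, mul_comm, mul_smul]
    congr 1
    rw [show B (koszulSign i j • (w * scalar k 𝓜 c)) = koszulSign i j • B (w * scalar k 𝓜 c) from
      units_smul_map B _ _]
    exact congrArg (koszulSign i j • ·) (hB w c (G z)).symm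

theorem conv_add_left {B' : SuperSym k 𝓜 →+ M →+ C} (hB : IsBalanced B) (hB' : IsBalanced B')
    (hG : IsHom 𝓚 p G) (w : SuperSym k 𝓜) :
    conv 𝓚 p (B + B') G w = conv 𝓚 p B G w + conv 𝓚 p B' G w := by
  rw [conv_eq hB hG, conv_eq hB' hG, conv_eq (hB.add hB') hG]
  induction comul 𝓜 𝓚 w using square_induction with
  | zero => simp
  | add x y hx hy => simp only [map_add, hx, hy]; abel
  | tmul i j w z hw hz =>
    rw [pairing_tmul _ _ hw, pairing_tmul _ _ hw, pairing_tmul _ _ hw, ← smul_add]; rfl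

theorem conv_add_right {G' : SuperSym k 𝓜 →+ M} (hB : IsBalanced B) (hG : IsHom 𝓚 p G)
    (hG' : IsHom 𝓚 p G') (w : SuperSym k 𝓜) :
    conv 𝓚 p B (G + G') w = conv 𝓚 p B G w + conv 𝓚 p B G' w := by
  rw [conv_eq hB hG, conv_eq hB hG', conv_eq hB (hG.add hG')]
  induction comul 𝓜 𝓚 w using square_induction with
  | zero => simp
  | add x y hx hy => simp only [map_add, hx, hy]; abel
  | tmul i j w z hw hz =>
    rw [pairing_tmul _ _ hw, pairing_tmul _ _ hw, pairing_tmul _ _ hw, ← smul_add]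
    exact congrArg (koszulSign p i • ·) (map_add (B w) _ _)

theorem conv_zero_right (w : SuperSym k 𝓜) : conv 𝓚 p B 0 w = 0 := by
  by_cases hB : IsBalanced B
  · have := conv_add_right hB (IsHom.zero p) (IsHom.zero (𝓚 := 𝓚) p) w
    rwa [add_zero, left_eq_add] at this
  -- Without balancedness the convolution has its default value zero.
  · rw [conv, dif_neg (fun h => hB h.1)]; rfl

/-- If `B` has parity `r`, then `B ∘ (id ⊗ G) ∘ Δ` has parity `r + p`. -/
theorem conv_mem {r : ZMod 2} (𝓒 : ZMod 2 → AddSubgroup C) (hB : IsBalanced B)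
    (hB' : ∀ {i j : ZMod 2} {w : SuperSym k 𝓜} {y : M}, w ∈ part 𝓜 𝓚 i → y ∈ 𝓜 j →
      B w y ∈ 𝓒 (r + i + j)) (ρ : k → C →+ C)
    (hρ' : ∀ {i j : ZMod 2} {a : k} {x : C}, a ∈ 𝓚 i → x ∈ 𝓒 j → ρ a x ∈ 𝓒 (j + i))
    (hρ : ∀ a w y, B w (MulOpposite.op a • y) = ρ a (B w y)) (hG : IsHom 𝓚 p G)
    {i : ZMod 2} {w : SuperSym k 𝓜} (hw : w ∈ part 𝓜 𝓚 i) :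
    conv 𝓚 p B G w ∈ 𝓒 (r + p + i) := by
  -- The maps and their parities are quantified inside the induction, since the product rule
  -- replaces them by derivatives of other parities.
  refine part_induction (P := fun i w => ∀ (r p : ZMod 2) (B : SuperSym k 𝓜 →+ M →+ C)
    (G : SuperSym k 𝓜 →+ M), IsBalanced B → (∀ {i j : ZMod 2} {w : SuperSym k 𝓜} {y : M},
      w ∈ part 𝓜 𝓚 i → y ∈ 𝓜 j → B w y ∈ 𝓒 (r + i + j)) →
    (∀ a w y, B w (MulOpposite.op a • y) = ρ a (B w y)) → IsHom 𝓚 p G →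
    conv 𝓚 p B G w ∈ 𝓒 (r + p + i)) ?_ ?_ ?_ ?_ ?_ hw r p B G hB hB' hρ hG
  · intros; rw [map_zero]; exact zero_mem _
  · intro i w z h1 h2 r p B G hB hB' hρ hG
    rw [map_add]
    exact add_mem (h1 r p B G hB hB' hρ hG) (h2 r p B G hB hB' hρ hG)
  · intro r p B G hB hB' hρ hG
    rw [conv_one hB hG]
    simpa [add_assoc] using hB' one_mem_part (hG.map_mem one_mem_part)
  · intro q j X w hX hw h r p B G hB hB' hρ hG
    rw [conv_vec_mul hB hG hX]
    refine add_mem (AddSubgroup.units_smul_mem _ _ ?_) ?_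
    · rw [show r + p + (q + j) = r + q + p + j by ring]
      refine h _ p _ G (hB.partialDeriv X) ?_ (fun a w y => hρ a _ y) hG
      intro i j w y hw hy
      rw [add_assoc r]
      exact hB' (SetLike.GradedMul.mul_mem (vec_mem_part 𝓜 𝓚 hX) hw) hy
    · rw [show r + p + (q + j) = r + (p + q) + j by ring]
      exact h r _ B _ hB hB' hρ (hG.partialDeriv hX)
  · intro i j a w ha hw h r p B G hB hB' hρ hG
    rw [conv_mul_scalar hB hG (hρ a), ← add_assoc]
    exact hρ' ha (h r p B G hB hB' hρ hG)

end
end Conv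

/-! ### Coderivations, the generic point and the convolution bracket. -/

section Bracket
set_option linter.unusedSectionVars false

variable {k 𝔤 : Type*} [Ring k] [AddCommGroup 𝔤] [Module k 𝔤] [Module kᵐᵒᵖ 𝔤]
  [SMulCommClass k kᵐᵒᵖ 𝔤] [Bracket 𝔤 𝔤]
  {𝓚 : ZMod 2 → AddSubgroup k} {𝓖 : ZMod 2 → AddSubgroup 𝔤}
  [GradedRing 𝓚] [CommSuperring 𝓚] [DirectSum.Decomposition 𝓖] [SuperModule 𝓚 𝓖]
  [LieSuperalgebra 𝓚 𝓖]

theorem mulVec_isBalanced : IsBalanced (mulVec (k := k) 𝓖) := mulVec_mul_scalar 𝓖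

section VectorField

variable {p q r : ZMod 2} {F G : SuperSym k 𝓖 →+ 𝔤} {X : 𝔤}

/-- The coderivation `id * F = Mult ∘ (id ⊗ F) ∘ Δ` of `S(𝔤)` attached to `F : S(𝔤) → 𝔤` of
parity `p`. -/
def vectorField (𝓚 : ZMod 2 → AddSubgroup k) [GradedRing 𝓚] [CommSuperring 𝓚]
    [SuperModule 𝓚 𝓖] (p : ZMod 2) (F : SuperSym k 𝓖 →+ 𝔤) : SuperSym k 𝓖 →+ SuperSym k 𝓖 :=
  conv 𝓚 p (mulVec 𝓖) F

theorem vectorField_one (hF : IsHom 𝓚 p F) : vectorField 𝓚 p F 1 = vec k 𝓖 (F 1) := by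
  rw [vectorField, conv_one mulVec_isBalanced hF]; exact one_mul _

/-- Differentiating the multiplication `(w, Y) ↦ wY` along `X` only multiplies its result by `X` on
the left, so the first term of the product rule factors. -/
theorem vectorField_vec_mul (hF : IsHom 𝓚 p F) (hX : X ∈ 𝓖 q) (w : SuperSym k 𝓖) :
    vectorField 𝓚 p F (vec k 𝓖 X * w) =
      koszulSign p q • (vec k 𝓖 X * vectorField 𝓚 p F w) +
        vectorField 𝓚 (p + q) (partialDeriv X F) w := by
  rw [vectorField, conv_vec_mul mulVec_isBalanced hF hX]
  have h : partialDeriv X (mulVec (k := k) 𝓖) =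
      (mulVec 𝓖).compr₂ (AddMonoidHom.mulLeft (vec k 𝓖 X)) := by
    ext w y; exact mul_assoc _ _ _
  rw [h, conv_compr₂ mulVec_isBalanced hF]; rfl

theorem vectorField_mul_scalar (hF : IsHom 𝓚 p F) (w : SuperSym k 𝓖) (a : k) :
    vectorField 𝓚 p F (w * scalar k 𝓖 a) = vectorField 𝓚 p F w * scalar k 𝓖 a :=
  conv_mul_scalar (ρ := AddMonoidHom.mulRight (scalar k 𝓖 a)) mulVec_isBalanced hF
    (fun w y => by
      change w * vec k 𝓖 _ = w * vec k 𝓖 y * _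
      rw [vec_right, mul_assoc]) w

theorem vectorField_add (hF : IsHom 𝓚 p F) (hG : IsHom 𝓚 p G) (w : SuperSym k 𝓖) :
    vectorField 𝓚 p (F + G) w = vectorField 𝓚 p F w + vectorField 𝓚 p G w :=
  conv_add_right mulVec_isBalanced hF hG w

theorem vectorField_zero (w : SuperSym k 𝓖) :
    vectorField 𝓚 p (0 : SuperSym k 𝓖 →+ 𝔤) w = 0 := conv_zero_right w

theorem vectorField_smul (hF : IsHom 𝓚 p F) {c : k} (hc : c ∈ 𝓚 q) (w : SuperSym k 𝓖) :
    vectorField 𝓚 (q + p) (c • F) w = scalar k 𝓖 c * vectorField 𝓚 p F w :=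
  conv_smul (ρ := AddMonoidHom.mulLeft (scalar k 𝓖 c)) mulVec_isBalanced hF hc
    (fun _ _ => mul_assoc _ _ _) w

theorem vectorField_mem (hF : IsHom 𝓚 p F) {w : SuperSym k 𝓖} (hw : w ∈ part 𝓖 𝓚 q) :
    vectorField 𝓚 p F w ∈ part 𝓖 𝓚 (p + q) := by
  have := conv_mem (r := 0) (p := p) (fun i => (part 𝓖 𝓚 i).toAddSubgroup)
    (mulVec_isBalanced (k := k) (𝓖 := 𝓖))
    (fun {i j w y} hw hy => by
      rw [zero_add]; exact SetLike.GradedMul.mul_mem hw (vec_mem_part 𝓖 𝓚 hy))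
    (fun a => AddMonoidHom.mulRight (scalar k 𝓖 a))
    (fun {i j a x} ha hx => SetLike.GradedMul.mul_mem (A := part 𝓖 𝓚) hx
      (scalar_mem_part 𝓖 𝓚 ha))
    (fun a w y => by
      change w * vec k 𝓖 _ = w * vec k 𝓖 y * _
      rw [vec_right, mul_assoc]) hF hw
  rwa [zero_add] at this

end VectorField

section GenericPoint

/-- The map `S(𝔤) → 𝔤` with `1 ↦ X` and `S^n(𝔤) ↦ 0` for `n ≠ 0`. -/
def constHom (X : 𝔤) : SuperSym k 𝓖 →+ 𝔤 :=
  AddMonoidHom.mk' (fun w => MulOpposite.op (counit (k := k) 𝓖 w) • X) fun w z => by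
    rw [map_add, MulOpposite.op_add, add_smul]

theorem constHom_apply (X : 𝔤) (w : SuperSym k 𝓖) :
    constHom X w = MulOpposite.op (counit (k := k) 𝓖 w) • X := rfl

theorem linearPart_vec (X : 𝔤) :
    linearPart (k := k) 𝓖 (vec k 𝓖 X) = TrivSqZeroExt.inr X := by
  rw [linearPart, lift_vec]; rfl

theorem linearPart_scalar (a : k) :
    linearPart (k := k) 𝓖 (scalar k 𝓖 a) = TrivSqZeroExt.inl a := by
  rw [linearPart, lift_scalar]; rfl

theorem counit_one : counit (k := k) 𝓖 1 = 1 := by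
  change (linearPart 𝓖 1).fst = 1; simp

theorem genericPoint_one : genericPoint (k := k) 𝓖 1 = 0 := by
  change (linearPart 𝓖 1).snd = 0; simp

theorem counit_vec_mul (X : 𝔤) (w : SuperSym k 𝓖) : counit (k := k) 𝓖 (vec k 𝓖 X * w) = 0 := by
  change (linearPart 𝓖 _).fst = 0; rw [map_mul, linearPart_vec]; simp

theorem counit_mul_scalar (w : SuperSym k 𝓖) (a : k) :
    counit (k := k) 𝓖 (w * scalar k 𝓖 a) = counit 𝓖 w * a := by
  change (linearPart 𝓖 _).fst = _; rw [map_mul, linearPart_scalar]; simp; rfl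

theorem genericPoint_vec_mul (X : 𝔤) (w : SuperSym k 𝓖) :
    genericPoint (k := k) 𝓖 (vec k 𝓖 X * w) = constHom X w := by
  change (linearPart 𝓖 _).snd = _; rw [map_mul, linearPart_vec]; simp; rfl

theorem partialDeriv_genericPoint (X : 𝔤) :
    partialDeriv X (genericPoint (k := k) 𝓖) = constHom X :=
  AddMonoidHom.ext (genericPoint_vec_mul X)

theorem partialDeriv_constHom (X Y : 𝔤) :
    partialDeriv Y (constHom (k := k) (𝓖 := 𝓖) X) = 0 := by
  ext w
  rw [partialDeriv_apply, constHom_apply, counit_vec_mul]; simp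

theorem constHom_one (X : 𝔤) : constHom (k := k) (𝓖 := 𝓖) X 1 = X := by
  rw [constHom_apply, counit_one]; simp

theorem counit_mem {i : ZMod 2} {w : SuperSym k 𝓖} (hw : w ∈ part 𝓖 𝓚 i) :
    counit (k := k) 𝓖 w ∈ 𝓚 i := by
  refine part_induction (P := fun i w => counit (k := k) 𝓖 w ∈ 𝓚 i) ?_ ?_ ?_ ?_ ?_ hw
  · intro i; rw [map_zero]; exact zero_mem _
  · intro i w z h1 h2; rw [map_add]; exact add_mem h1 h2
  · rw [counit_one]; exact SetLike.GradedOne.one_mem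
  · intros; rw [counit_vec_mul]; exact zero_mem _
  · intro i j a w ha _ h; rw [counit_mul_scalar]; exact SetLike.GradedMul.mul_mem h ha

theorem constHom_isHom {p : ZMod 2} {X : 𝔤} (hX : X ∈ 𝓖 p) :
    IsHom 𝓚 p (constHom (k := k) (𝓖 := 𝓖) X) where
  map_mem hw := SuperModule.smul_mem (counit_mem hw) hX
  map_right w a := by
    rw [constHom_apply, counit_mul_scalar, MulOpposite.op_mul, mul_smul]; rfl

theorem genericPoint_mem {i : ZMod 2} {w : SuperSym k 𝓖} (hw : w ∈ part 𝓖 𝓚 i) :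
    genericPoint (k := k) 𝓖 w ∈ 𝓖 i := by
  refine part_induction (P := fun i w => genericPoint (k := k) 𝓖 w ∈ 𝓖 i) ?_ ?_ ?_ ?_ ?_ hw
  · intro i; rw [map_zero]; exact zero_mem _
  · intro i w z h1 h2; rw [map_add]; exact add_mem h1 h2
  · rw [genericPoint_one]; exact zero_mem _
  · intro q j X w hX hw _
    rw [genericPoint_vec_mul]; exact (constHom_isHom hX).map_mem hw
  · intro i j a w ha _ h; rw [genericPoint_mul_scalar]; exact SuperModule.smul_mem ha h

theorem genericPoint_isHom : IsHom 𝓚 0 (genericPoint (k := k) 𝓖) where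
  map_mem hw := by rw [zero_add]; exact genericPoint_mem hw
  map_right w a := genericPoint_mul_scalar w a

/-- The generic point composed with a coderivation recovers the vector field. -/
theorem genericPoint_vectorField {p : ZMod 2} {F : SuperSym k 𝓖 →+ 𝔤} (hF : IsHom 𝓚 p F)
    (w : SuperSym k 𝓖) : genericPoint (k := k) 𝓖 (vectorField 𝓚 p F w) = F w ∧
      counit (k := k) 𝓖 (vectorField 𝓚 p F w) = 0 := by
  induction w using induction_vec_mul (𝓚 := 𝓚) (𝓜 := 𝓖) generalizing p F with
  | add w z h1 h2 => simp [h1 hF, h2 hF]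
  | one =>
    rw [vectorField_one hF, ← mul_one (vec k 𝓖 _), genericPoint_vec_mul, constHom_one,
      counit_vec_mul]
    exact ⟨rfl, rfl⟩
  | vec_mul q X w hX h =>
    -- The summand `X · V_F(w)` contributes the counit of `V_F(w)` times `X` to the generic point;
    -- this is why the vanishing of the counit is part of the induction.
    rw [vectorField_vec_mul hF hX, map_add, map_add, units_smul_map, units_smul_map,
      genericPoint_vec_mul, counit_vec_mul, constHom_apply, (h hF).2,
      (h (hF.partialDeriv hX)).1, (h (hF.partialDeriv hX)).2]
    simp [partialDeriv_apply]
  | mul_scalar i a w ha h =>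
    rw [vectorField_mul_scalar hF, genericPoint_mul_scalar, counit_mul_scalar, (h hF).1,
      (h hF).2, hF.map_right]
    simp

end GenericPoint

section ConvBracket

variable {p q r : ZMod 2} {F F' G G' : SuperSym k 𝓖 →+ 𝔤} {X : 𝔤}

/-- The map `w ↦ [X, G(w)]`. -/
def lieComp (𝓚 : ZMod 2 → AddSubgroup k) [LieSuperalgebra 𝓚 𝓖] (X : 𝔤)
    (G : SuperSym k 𝓖 →+ 𝔤) : SuperSym k 𝓖 →+ 𝔤 := (bracketHom 𝓚 𝓖 X).comp G

theorem lieComp_apply (X : 𝔤) (G : SuperSym k 𝓖 →+ 𝔤) (w : SuperSym k 𝓖) :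
    lieComp 𝓚 X G w = bracketHom 𝓚 𝓖 X (G w) := rfl

theorem bracketHom_mem {i j : ZMod 2} {X Y : 𝔤} (hX : X ∈ 𝓖 i) (hY : Y ∈ 𝓖 j) :
    bracketHom 𝓚 𝓖 X Y ∈ 𝓖 (i + j) := lie_mem 𝓚 hX hY

theorem bracketHom_right_smul (X Y : 𝔤) (a : k) :
    bracketHom 𝓚 𝓖 X (MulOpposite.op a • Y) = MulOpposite.op a • bracketHom 𝓚 𝓖 X Y :=
  lie_smul 𝓚 𝓖 X Y a

theorem bracketHom_skew {i j : ZMod 2} {X Y : 𝔤} (hX : X ∈ 𝓖 i) (hY : Y ∈ 𝓖 j) :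
    bracketHom 𝓚 𝓖 X Y = -(koszulSign i j • bracketHom 𝓚 𝓖 Y X) := lie_skew 𝓚 hX hY

theorem bracketHom_jacobi {i j : ZMod 2} {X Y : 𝔤} (hX : X ∈ 𝓖 i) (hY : Y ∈ 𝓖 j) (Z : 𝔤) :
    bracketHom 𝓚 𝓖 X (bracketHom 𝓚 𝓖 Y Z) = bracketHom 𝓚 𝓖 (bracketHom 𝓚 𝓖 X Y) Z +
      koszulSign i j • bracketHom 𝓚 𝓖 Y (bracketHom 𝓚 𝓖 X Z) := by
  have h : bracketHom 𝓚 𝓖 (bracketHom 𝓚 𝓖 X Y) Z = _ := jacobi (𝓚 := 𝓚) Z hX hY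
  rw [h, koszulSign_comm]
  exact (sub_add_cancel _ _).symm

theorem IsHom.lieComp (hG : IsHom 𝓚 p G) (hX : X ∈ 𝓖 q) :
    IsHom 𝓚 (p + q) (lieComp 𝓚 X G) where
  map_mem hw := by
    rw [add_comm p q, add_assoc]; exact bracketHom_mem (𝓚 := 𝓚) hX (hG.map_mem hw)
  map_right w a := by
    rw [lieComp_apply, hG.map_right, bracketHom_right_smul]; rfl

/-- The convolution bracket `[F, G] = [·,·] ∘ (F ⊗ G) ∘ Δ` for `G` of parity `p`. -/
def convBracket (𝓚 : ZMod 2 → AddSubgroup k) [GradedRing 𝓚] [CommSuperring 𝓚]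
    [SuperModule 𝓚 𝓖] [LieSuperalgebra 𝓚 𝓖] (p : ZMod 2) (F G : SuperSym k 𝓖 →+ 𝔤) :
    SuperSym k 𝓖 →+ 𝔤 := conv 𝓚 p ((bracketHom 𝓚 𝓖).comp F) G

theorem IsHom.isBalanced (hF : IsHom 𝓚 p F) : IsBalanced ((bracketHom 𝓚 𝓖).comp F) := by
  intro w a y
  change bracketHom 𝓚 𝓖 (F _) y = _
  rw [hF.map_right, bracketHom_op_smul]; rfl

theorem convBracket_one (hF : IsHom 𝓚 p F) (hG : IsHom 𝓚 r G) :
    convBracket 𝓚 r F G 1 = bracketHom 𝓚 𝓖 (F 1) (G 1) := conv_one hF.isBalanced hG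

theorem convBracket_vec_mul (hF : IsHom 𝓚 p F) (hG : IsHom 𝓚 r G) (hX : X ∈ 𝓖 q)
    (w : SuperSym k 𝓖) :
    convBracket 𝓚 r F G (vec k 𝓖 X * w) = koszulSign r q • convBracket 𝓚 r (partialDeriv X F) G w +
      convBracket 𝓚 (r + q) F (partialDeriv X G) w :=
  conv_vec_mul hF.isBalanced hG hX w

theorem convBracket_mul_scalar (hF : IsHom 𝓚 p F) (hG : IsHom 𝓚 r G) (w : SuperSym k 𝓖) (a : k) :
    convBracket 𝓚 r F G (w * scalar k 𝓖 a) = MulOpposite.op a • convBracket 𝓚 r F G w :=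
  conv_mul_scalar (ρ := DistribSMul.toAddMonoidHom 𝔤 (MulOpposite.op a)) hF.isBalanced hG
    (fun _ _ => bracketHom_right_smul (𝓚 := 𝓚) (𝓖 := 𝓖) _ _ _) w

theorem convBracket_isHom (hF : IsHom 𝓚 p F) (hG : IsHom 𝓚 r G) :
    IsHom 𝓚 (p + r) (convBracket 𝓚 r F G) where
  map_mem hw := conv_mem 𝓖 hF.isBalanced
    (fun hw hy => bracketHom_mem (𝓚 := 𝓚) (hF.map_mem hw) hy)
    (fun a => DistribSMul.toAddMonoidHom 𝔤 (MulOpposite.op a))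
    (fun ha hx => SuperModule.smul_mem ha hx)
    (fun _ _ _ => bracketHom_right_smul (𝓚 := 𝓚) (𝓖 := 𝓖) _ _ _) hG hw
  map_right := convBracket_mul_scalar hF hG

theorem convBracket_add_left (hF : IsHom 𝓚 p F) (hF' : IsHom 𝓚 p F') (hG : IsHom 𝓚 r G) :
    convBracket 𝓚 r (F + F') G = convBracket 𝓚 r F G + convBracket 𝓚 r F' G := by
  ext w
  have h : (bracketHom 𝓚 𝓖).comp (F + F') =
    (bracketHom 𝓚 𝓖).comp F + (bracketHom 𝓚 𝓖).comp F' := by ext; simp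
  rw [convBracket, h]
  exact conv_add_left hF.isBalanced hF'.isBalanced hG w

theorem convBracket_add_right (hF : IsHom 𝓚 p F) (hG : IsHom 𝓚 r G) (hG' : IsHom 𝓚 r G') :
    convBracket 𝓚 r F (G + G') = convBracket 𝓚 r F G + convBracket 𝓚 r F G' :=
  AddMonoidHom.ext (conv_add_right hF.isBalanced hG hG')

theorem convBracket_zero_left (hG : IsHom 𝓚 r G) : convBracket 𝓚 r 0 G = 0 := by
  have := convBracket_add_left (IsHom.zero (𝓚 := 𝓚) 0) (IsHom.zero 0) hG
  rwa [add_zero, left_eq_add] at this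

theorem convBracket_zero_right (F : SuperSym k 𝓖 →+ 𝔤) : convBracket 𝓚 r F 0 = 0 :=
  AddMonoidHom.ext conv_zero_right

theorem convBracket_smul_left (hF : IsHom 𝓚 p F) (hG : IsHom 𝓚 r G) (c : k) :
    convBracket 𝓚 r (c • F) G = c • convBracket 𝓚 r F G := by
  ext w
  have h : (bracketHom 𝓚 𝓖).comp (c • F) =
      ((bracketHom 𝓚 𝓖).comp F).compr₂ (DistribSMul.toAddMonoidHom 𝔤 c) := by
    ext w y; exact bracketHom_left_smul 𝓚 𝓖 _ _ _
  rw [convBracket, h, conv_compr₂ hF.isBalanced hG]; rfl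

theorem convBracket_smul_right (hF : IsHom 𝓚 p F) (hG : IsHom 𝓚 r G) {c : k} (hc : c ∈ 𝓚 0) :
    convBracket 𝓚 r F (c • G) = c • convBracket 𝓚 r F G := by
  ext w
  have := conv_smul (ρ := DistribSMul.toAddMonoidHom 𝔤 c) hF.isBalanced hG hc
    (fun w y => by
      change bracketHom 𝓚 𝓖 (F _) y = c • bracketHom 𝓚 𝓖 (F w) y
      rw [hF.map_left w hc, koszulSign_zero_right, one_smul, bracketHom_left_smul]) w
  rwa [zero_add] at this

theorem convBracket_units_smul_left (hF : IsHom 𝓚 p F) (hG : IsHom 𝓚 r G) (e : ℤˣ) :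
    convBracket 𝓚 r (e • F) G = e • convBracket 𝓚 r F G := by
  have := convBracket_smul_left hF hG (((e : ℤ) : k))
  rwa [Int.cast_smul_eq_zsmul, Int.cast_smul_eq_zsmul, ← Units.smul_def, ← Units.smul_def] at this

theorem convBracket_units_smul_right (hF : IsHom 𝓚 p F) (hG : IsHom 𝓚 r G) (e : ℤˣ) :
    convBracket 𝓚 r F (e • G) = e • convBracket 𝓚 r F G := by
  have := convBracket_smul_right hF hG (c := ((e : ℤ) : k)) (SetLike.intCast_mem_graded 𝓚 _)
  rwa [Int.cast_smul_eq_zsmul, Int.cast_smul_eq_zsmul, ← Units.smul_def, ← Units.smul_def] at this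

/-- A constant has zero derivative, so in the product rule only `G` is ever differentiated. -/
theorem convBracket_constHom (hX : X ∈ 𝓖 q) (hG : IsHom 𝓚 r G) :
    convBracket 𝓚 r (constHom X) G = lieComp 𝓚 X G := by
  ext w
  have hc := constHom_isHom (k := k) (𝓚 := 𝓚) hX
  induction w using induction_vec_mul (𝓚 := 𝓚) (𝓜 := 𝓖) generalizing r G with
  | add w z h1 h2 => rw [map_add, map_add, h1 hG, h2 hG]
  | one => rw [convBracket_one hc hG, constHom_one]; rfl
  | vec_mul s Y w hY h =>
    rw [convBracket_vec_mul hc hG hY, partialDeriv_constHom, convBracket_zero_left hG,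
      h (hG.partialDeriv hY)]
    simp; rfl
  | mul_scalar i a w ha h =>
    rw [convBracket_mul_scalar hc hG, h hG, (hG.lieComp hX).map_right]

/-- The operator `ad x` on maps of parity `p`. -/
def adPoint (𝓚 : ZMod 2 → AddSubgroup k) [GradedRing 𝓚] [CommSuperring 𝓚]
    [SuperModule 𝓚 𝓖] [LieSuperalgebra 𝓚 𝓖] (p : ZMod 2) (G : SuperSym k 𝓖 →+ 𝔤) :
    SuperSym k 𝓖 →+ 𝔤 := convBracket 𝓚 p (genericPoint 𝓖) G

theorem adPoint_isHom (hG : IsHom 𝓚 p G) : IsHom 𝓚 p (adPoint 𝓚 p G) := by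
  have := convBracket_isHom genericPoint_isHom hG
  rwa [zero_add] at this

theorem adPoint_one (hG : IsHom 𝓚 p G) : adPoint 𝓚 p G 1 = 0 := by
  rw [adPoint, convBracket_one genericPoint_isHom hG, genericPoint_one]; simp

/-- The derivative of the generic point along `X` is the constant `X`, so one term of the product
rule collapses to a pointwise bracket with `X`. -/
theorem adPoint_vec_mul (hG : IsHom 𝓚 p G) (hX : X ∈ 𝓖 q) (w : SuperSym k 𝓖) :
    adPoint 𝓚 p G (vec k 𝓖 X * w) = koszulSign p q • bracketHom 𝓚 𝓖 X (G w) +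
      adPoint 𝓚 (p + q) (partialDeriv X G) w := by
  rw [adPoint, convBracket_vec_mul genericPoint_isHom hG hX, partialDeriv_genericPoint,
    convBracket_constHom hX hG]
  rfl

theorem partialDeriv_adPoint (hG : IsHom 𝓚 p G) (hX : X ∈ 𝓖 q) :
    partialDeriv X (adPoint 𝓚 p G) = koszulSign p q • lieComp 𝓚 X G +
      adPoint 𝓚 (p + q) (partialDeriv X G) :=
  AddMonoidHom.ext (adPoint_vec_mul hG hX)

theorem partialDeriv_convBracket (hF : IsHom 𝓚 p F) (hG : IsHom 𝓚 r G) (hX : X ∈ 𝓖 q) :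
    partialDeriv X (convBracket 𝓚 r F G) = koszulSign r q • convBracket 𝓚 r (partialDeriv X F) G +
      convBracket 𝓚 (r + q) F (partialDeriv X G) :=
  AddMonoidHom.ext (convBracket_vec_mul hF hG hX)

theorem partialDeriv_lieComp (X Y : 𝔤) (G : SuperSym k 𝓖 →+ 𝔤) :
    partialDeriv Y (lieComp 𝓚 X G) = lieComp 𝓚 X (partialDeriv Y G) := rfl

/-- Product rule for a composite with a coderivation; it drives the inductions for the chain rule
and for the commutator formula. -/
theorem partialDeriv_comp_vectorField (hG : IsHom 𝓚 r G) (hX : X ∈ 𝓖 q)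
    (F : SuperSym k 𝓖 →+ 𝔤) :
    partialDeriv X (F.comp (vectorField 𝓚 r G)) =
      koszulSign r q • (partialDeriv X F).comp (vectorField 𝓚 r G) +
        F.comp (vectorField 𝓚 (r + q) (partialDeriv X G)) := by
  ext w
  rw [partialDeriv_apply, AddMonoidHom.comp_apply, vectorField_vec_mul hG hX, map_add,
    units_smul_map]
  rfl

theorem comp_vectorField_isHom (hF : IsHom 𝓚 p F) (hG : IsHom 𝓚 r G) :
    IsHom 𝓚 (p + r) (F.comp (vectorField 𝓚 r G)) where
  map_mem hw := by rw [add_assoc]; exact hF.map_mem (vectorField_mem hG hw)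
  map_right w a := by
    rw [AddMonoidHom.comp_apply, vectorField_mul_scalar hG, hF.map_right]; rfl

theorem adPoint_add (hF : IsHom 𝓚 p F) (hG : IsHom 𝓚 p G) :
    adPoint 𝓚 p (F + G) = adPoint 𝓚 p F + adPoint 𝓚 p G :=
  convBracket_add_right genericPoint_isHom hF hG

theorem adPoint_zero : adPoint 𝓚 p (0 : SuperSym k 𝓖 →+ 𝔤) = 0 := convBracket_zero_right _

theorem adPoint_units_smul (hF : IsHom 𝓚 p F) (e : ℤˣ) :
    adPoint 𝓚 p (e • F) = e • adPoint 𝓚 p F :=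
  convBracket_units_smul_right genericPoint_isHom hF e

theorem adPoint_smul (hF : IsHom 𝓚 p F) {c : k} (hc : c ∈ 𝓚 q) :
    adPoint 𝓚 (q + p) (c • F) = c • adPoint 𝓚 p F :=
  AddMonoidHom.ext (conv_smul (ρ := DistribSMul.toAddMonoidHom 𝔤 c) genericPoint_isHom.isBalanced
    hF hc (fun w y => by
      change bracketHom 𝓚 𝓖 (genericPoint 𝓖 _) y = c • bracketHom 𝓚 𝓖 (genericPoint 𝓖 w) y
      rw [genericPoint_scalar_mul, bracketHom_left_smul]))

end ConvBracket

end Bracket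

/-! ### Jacobi, skew-symmetry, the chain rule and commutators of coderivations. -/

section Identities
set_option linter.unusedSimpArgs false
set_option linter.unusedSectionVars false

variable {k 𝔤 : Type*} [Ring k] [AddCommGroup 𝔤] [Module k 𝔤] [Module kᵐᵒᵖ 𝔤]
  [SMulCommClass k kᵐᵒᵖ 𝔤] [Bracket 𝔤 𝔤]
  {𝓚 : ZMod 2 → AddSubgroup k} {𝓖 : ZMod 2 → AddSubgroup 𝔤}
  [GradedRing 𝓚] [CommSuperring 𝓚] [DirectSum.Decomposition 𝓖] [SuperModule 𝓚 𝓖]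
  [LieSuperalgebra 𝓚 𝓖]

variable {p q r : ZMod 2} {F G : SuperSym k 𝓖 →+ 𝔤} {X : 𝔤}

/-- At `w = 1` this is the Jacobi identity of `𝔤`, and both sides obey the same product rule. -/
theorem lieComp_convBracket (hF : IsHom 𝓚 p F) (hG : IsHom 𝓚 r G) (hX : X ∈ 𝓖 q) :
    lieComp 𝓚 X (convBracket 𝓚 r F G) = convBracket 𝓚 r (lieComp 𝓚 X F) G +
      koszulSign p q • convBracket 𝓚 (r + q) F (lieComp 𝓚 X G) := by
  ext w
  rw [AddMonoidHom.add_apply, AddMonoidHom.smul_apply]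
  induction w using induction_vec_mul (𝓚 := 𝓚) (𝓜 := 𝓖) generalizing p r F G with
  | add w z h1 h2 => simp only [map_add, h1 hF hG, h2 hF hG, smul_add]; abel
  | one =>
    rw [lieComp_apply, convBracket_one hF hG, convBracket_one (hF.lieComp hX) hG,
      convBracket_one hF (hG.lieComp hX), lieComp_apply, lieComp_apply,
      bracketHom_jacobi hX (by simpa using hF.map_mem one_mem_part), koszulSign_comm]
  | vec_mul s Y w hY h =>
    have hXF := hF.lieComp (q := q) hX
    have hXG := hG.lieComp (q := q) hX
    have h1 := h (hF.partialDeriv hY) hG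
    have h2 := h hF (hG.partialDeriv hY)
    rw [lieComp_apply] at h1 h2 ⊢
    rw [convBracket_vec_mul hF hG hY, convBracket_vec_mul hXF hG hY,
      convBracket_vec_mul hF hXG hY, map_add, units_smul_map, h1, h2, partialDeriv_lieComp,
      partialDeriv_lieComp, add_right_comm r s q]
    simp only [koszulSign_add_left, smul_add, smul_smul]
    rw [koszulSign_comm s q]
    -- All signs are products of three independent values `±1`; each case is an identity in an
    -- abelian group. The same device closes the later sign computations.
    rcases koszulSign_eq_one_or p q with h1 | h1 <;> rcases koszulSign_eq_one_or r s with h2 | h2 <;>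
    rcases koszulSign_eq_one_or q s with h3 | h3 <;>
    simp only [h1, h2, h3, one_smul, neg_one_units_smul, one_mul, mul_one, mul_neg, neg_neg] <;> abel
  | mul_scalar i a w ha h =>
    rw [lieComp_apply, convBracket_mul_scalar hF hG, convBracket_mul_scalar (hF.lieComp hX) hG,
      convBracket_mul_scalar hF (hG.lieComp hX), bracketHom_right_smul, ← lieComp_apply, h hF hG,
      smul_add, op_units_smul]

/-- The Jacobi identity with the even generic point in the first slot: `ad x` is an even derivation
of the convolution bracket. In the induction the bracket with `X` that splits off is treated by
`lieComp_convBracket`. -/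
theorem adPoint_convBracket (hF : IsHom 𝓚 p F) (hG : IsHom 𝓚 r G) :
    adPoint 𝓚 (p + r) (convBracket 𝓚 r F G) = convBracket 𝓚 r (adPoint 𝓚 p F) G +
      convBracket 𝓚 r F (adPoint 𝓚 r G) := by
  ext w
  rw [AddMonoidHom.add_apply]
  have hFG := convBracket_isHom hF hG
  have hA := adPoint_isHom hF
  have hB := adPoint_isHom hG
  induction w using induction_vec_mul (𝓚 := 𝓚) (𝓜 := 𝓖) generalizing p r F G with
  | add w z h1 h2 => simp only [map_add, h1 hF hG hFG hA hB, h2 hF hG hFG hA hB]; abel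
  | one =>
    rw [adPoint_one hFG, convBracket_one hA hG, convBracket_one hF hB, adPoint_one hF,
      adPoint_one hG]
    simp
  | vec_mul s Y w hY h =>
    have hF' := hF.partialDeriv hY
    have hG' := hG.partialDeriv hY
    have hFG1 := convBracket_isHom hF' hG
    have hFG2 := convBracket_isHom hF hG'
    have h1 := h hF' hG hFG1 (adPoint_isHom hF') hB
    have h2 := h hF hG' hFG2 hA (adPoint_isHom hG')
    have h3 := DFunLike.congr_fun (lieComp_convBracket hF hG hY) w
    rw [lieComp_apply, AddMonoidHom.add_apply, AddMonoidHom.smul_apply] at h3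
    -- The parity is an argument of the convolution, so equal parities written differently have to
    -- be identified before the induction hypotheses apply.
    have e : p + s + r = p + r + s := by ring
    have e' : p + (r + s) = p + r + s := by ring
    rw [e] at h1 hFG1
    rw [e'] at h2 hFG2
    rw [adPoint_vec_mul hFG hY, partialDeriv_convBracket hF hG hY, adPoint_add (hFG1.units_smul _)
      hFG2, adPoint_units_smul hFG1, convBracket_vec_mul hA hG hY, convBracket_vec_mul hF hB hY,
      partialDeriv_adPoint hF hY, partialDeriv_adPoint hG hY,
      convBracket_add_left ((hF.lieComp hY).units_smul _) (adPoint_isHom hF') hG,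
      convBracket_add_right hF ((hG.lieComp hY).units_smul _) (adPoint_isHom hG'),
      convBracket_units_smul_left (hF.lieComp hY) hG,
      convBracket_units_smul_right hF (hG.lieComp hY), h3]
    simp only [AddMonoidHom.add_apply, AddMonoidHom.smul_apply, h1, h2, koszulSign_add_left,
      smul_add, smul_smul]
    rcases koszulSign_eq_one_or p s with h1 | h1 <;> rcases koszulSign_eq_one_or r s with h2 | h2 <;>
    simp only [h1, h2, one_smul, neg_one_units_smul, one_mul, mul_one, mul_neg, neg_neg] <;> abel
  | mul_scalar i a w ha h =>
    rw [(adPoint_isHom hFG).map_right, convBracket_mul_scalar hA hG, convBracket_mul_scalar hF hB,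
      h hF hG hFG hA hB, smul_add]

/-- The skew-symmetry of `𝔤` is the value at `1`; the supercocommutativity of `Δ` is hidden in the
induction, where the two terms of the product rule change places. -/
theorem convBracket_skew (hF : IsHom 𝓚 p F) (hG : IsHom 𝓚 r G) :
    convBracket 𝓚 r F G = -(koszulSign p r • convBracket 𝓚 p G F) := by
  ext w
  rw [AddMonoidHom.neg_apply, AddMonoidHom.smul_apply]
  induction w using induction_vec_mul (𝓚 := 𝓚) (𝓜 := 𝓖) generalizing p r F G with
  | add w z h1 h2 => simp only [map_add, h1 hF hG, h2 hF hG, smul_add]; abel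
  | one =>
    rw [convBracket_one hF hG, convBracket_one hG hF,
      bracketHom_skew (by simpa using hF.map_mem one_mem_part)
        (by simpa using hG.map_mem one_mem_part)]
  | vec_mul s Y w hY h =>
    rw [convBracket_vec_mul hF hG hY, convBracket_vec_mul hG hF hY, h (hF.partialDeriv hY) hG,
      h hF (hG.partialDeriv hY)]
    simp only [koszulSign_add_left, koszulSign_add_right, smul_add, smul_smul]
    rw [koszulSign_comm s r]
    rcases koszulSign_eq_one_or p s with h1 | h1 <;> rcases koszulSign_eq_one_or r s with h2 | h2 <;>
    simp only [h1, h2, smul_neg, smul_smul, one_smul, neg_one_units_smul, one_mul, mul_one, mul_neg,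
      neg_mul, neg_neg] <;> abel
  | mul_scalar i a w ha h =>
    rw [convBracket_mul_scalar hF hG, convBracket_mul_scalar hG hF, h hF hG, smul_neg,
      op_units_smul]

/-- Chain rule: composing with `V_G` differentiates `[x, F]` factor by factor. It turns `x` into
`G`, since `x ∘ V_G = G`, and `F` into `F ∘ V_G`; the sign comes from moving `G` past `F`. -/
theorem adPoint_comp_vectorField (hF : IsHom 𝓚 p F) (hG : IsHom 𝓚 r G) :
    (adPoint 𝓚 p F).comp (vectorField 𝓚 r G) = koszulSign p r • convBracket 𝓚 p G F +
      adPoint 𝓚 (p + r) (F.comp (vectorField 𝓚 r G)) := by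
  ext w
  rw [AddMonoidHom.add_apply, AddMonoidHom.smul_apply, AddMonoidHom.comp_apply]
  have hA := adPoint_isHom hF
  have hFG := comp_vectorField_isHom hF hG
  induction w using induction_vec_mul (𝓚 := 𝓚) (𝓜 := 𝓖) generalizing p r F G with
  | add w z h1 h2 => simp only [map_add, h1 hF hG hA hFG, h2 hF hG hA hFG, smul_add]; abel
  | one =>
    have hG1 : G 1 ∈ 𝓖 r := by simpa using hG.map_mem one_mem_part
    rw [vectorField_one hG, ← mul_one (vec k 𝓖 _), adPoint_vec_mul hF hG1,
      adPoint_one (hF.partialDeriv hG1), convBracket_one hG hF, adPoint_one hFG]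
  | vec_mul s Y w hY h =>
    have hF' := hF.partialDeriv hY
    have hG' := hG.partialDeriv hY
    have hFG1 := comp_vectorField_isHom hF' hG
    have hFG2 := comp_vectorField_isHom hF hG'
    have h1 := h hF' hG (adPoint_isHom hF') hFG1
    have h2 := h hF hG' hA hFG2
    have e : p + s + r = p + r + s := by ring
    have e' : p + (r + s) = p + r + s := by ring
    rw [e] at h1 hFG1
    rw [e'] at h2 hFG2
    rw [vectorField_vec_mul hG hY, map_add, units_smul_map, adPoint_vec_mul hF hY, h1, h2,
      convBracket_vec_mul hG hF hY, adPoint_vec_mul hFG hY,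
      partialDeriv_comp_vectorField hG hY, adPoint_add (hFG1.units_smul _) hFG2,
      adPoint_units_smul hFG1]
    simp only [AddMonoidHom.add_apply, AddMonoidHom.smul_apply, AddMonoidHom.comp_apply,
      koszulSign_add_left, koszulSign_add_right, smul_add, smul_smul]
    rw [koszulSign_comm s r]
    rcases koszulSign_eq_one_or p s with h1 | h1 <;>
    rcases koszulSign_eq_one_or r s with h2 | h2 <;>
    simp only [h1, h2, smul_smul, one_smul, neg_one_units_smul, one_mul, mul_one, mul_neg,
      neg_mul, neg_neg] <;> abel
  | mul_scalar i a w ha h =>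
    rw [vectorField_mul_scalar hG, hA.map_right, h hF hG hA hFG, convBracket_mul_scalar hG hF,
      (adPoint_isHom hFG).map_right, smul_add, op_units_smul]

/-- Every value of a coderivation has zero counit. -/
theorem constHom_comp_vectorField (X : 𝔤) (hG : IsHom 𝓚 r G) :
    (constHom X).comp (vectorField 𝓚 r G) = 0 := by
  ext w
  rw [AddMonoidHom.comp_apply, constHom_apply, (genericPoint_vectorField hG w).2]
  simp

/-- The supercommutator of two coderivations is a coderivation. -/
theorem vectorField_commutator (hF : IsHom 𝓚 p F) (hG : IsHom 𝓚 r G) (w : SuperSym k 𝓖) :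
    vectorField 𝓚 p F (vectorField 𝓚 r G w) -
      koszulSign p r • vectorField 𝓚 r G (vectorField 𝓚 p F w) =
    vectorField 𝓚 (p + r) (F.comp (vectorField 𝓚 r G)) w -
      koszulSign p r • vectorField 𝓚 (p + r) (G.comp (vectorField 𝓚 p F)) w := by
  have hFG := comp_vectorField_isHom hF hG
  have hGF := comp_vectorField_isHom hG hF
  rw [add_comm r p] at hGF
  induction w using induction_vec_mul (𝓚 := 𝓚) (𝓜 := 𝓖) generalizing p r F G with
  | add w z h1 h2 =>
    have h1 := h1 hF hG hFG hGF
    have h2 := h2 hF hG hFG hGF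
    rw [sub_eq_sub_iff_add_eq_add] at h1 h2 ⊢
    simp only [map_add, smul_add] at h1 h2 ⊢
    rw [add_add_add_comm, h1, h2, add_add_add_comm]
  | one =>
    have hF1 : F 1 ∈ 𝓖 p := by simpa using hF.map_mem one_mem_part
    have hG1 : G 1 ∈ 𝓖 r := by simpa using hG.map_mem one_mem_part
    -- The products `F(1)G(1)` and `G(1)F(1)` cancel by supercommutativity; the surviving linear
    -- terms are `F` at `G(1)` and `G` at `F(1)`.
    rw [vectorField_one hF, vectorField_one hG, vectorField_one hFG, vectorField_one hGF,
      ← mul_one (vec k 𝓖 (G 1)), ← mul_one (vec k 𝓖 (F 1)), vectorField_vec_mul hF hG1,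
      vectorField_vec_mul hG hF1, vectorField_one hF, vectorField_one hG,
      vectorField_one (hF.partialDeriv hG1), vectorField_one (hG.partialDeriv hF1),
      partialDeriv_apply, partialDeriv_apply, AddMonoidHom.comp_apply, AddMonoidHom.comp_apply,
      vectorField_one hF, vectorField_one hG, vec_comm hF1 hG1, koszulSign_def, smul_add, smul_smul,
      smul_smul, koszulSign_comm r p, koszulSign_mul_self, one_mul, mul_one, mul_one]
    abel
  | vec_mul s Y w hY h =>
    have hF' := hF.partialDeriv hY
    have hG' := hG.partialDeriv hY
    have hFG1 := comp_vectorField_isHom hF' hG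
    have hFG2 := comp_vectorField_isHom hF hG'
    have hGF1 := comp_vectorField_isHom hG hF'
    have hGF2 := comp_vectorField_isHom hG' hF
    have e : p + s + r = p + r + s := by ring
    have e' : p + (r + s) = p + r + s := by ring
    have e1 : r + (p + s) = p + r + s := by ring
    have e2 : r + s + p = p + r + s := by ring
    rw [e] at hFG1
    rw [e'] at hFG2
    rw [e1] at hGF1
    rw [e2] at hGF2
    -- Three instances of the induction hypothesis: the given pair, multiplied by `Y`, and the pairs
    -- in which `F` or `G` is replaced by its derivative along `Y`.
    have h0 := congrArg (vec k 𝓖 Y * ·) (h hF hG hFG hGF)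
    have h1 := h hF' hG (by rwa [e]) (by rwa [e])
    have h2 := h hF hG' (by rwa [e']) (by rwa [e'])
    rw [e] at h1
    rw [e'] at h2
    simp only [mul_sub, mul_smul_comm] at h0
    rw [vectorField_vec_mul hG hY, vectorField_vec_mul hF hY, vectorField_vec_mul hFG hY,
      vectorField_vec_mul hGF hY, partialDeriv_comp_vectorField hG hY,
      partialDeriv_comp_vectorField hF hY, vectorField_add (hFG1.units_smul _) hFG2,
      vectorField_add (hGF2.units_smul _) hGF1]
    have hu : ∀ (e : ℤˣ) (H : SuperSym k 𝓖 →+ 𝔤), IsHom 𝓚 (p + r + s) H →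
        vectorField 𝓚 (p + r + s) (e • H) w = e • vectorField 𝓚 (p + r + s) H w := by
      intro e H hH
      rcases Int.units_eq_one_or e with rfl | rfl
      · simp
      · have := vectorField_add hH hH.neg w
        rw [add_neg_cancel, vectorField_zero] at this
        rw [neg_one_units_smul, neg_one_units_smul]
        exact (neg_eq_of_add_eq_zero_right this.symm).symm
    rw [hu _ _ hFG1, hu _ _ hGF2, map_add, map_add, units_smul_map, units_smul_map,
      vectorField_vec_mul hF hY, vectorField_vec_mul hG hY]
    simp only [koszulSign_add_left, koszulSign_add_right, koszulSign_comm s r] at h1 h2 ⊢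
    rw [sub_eq_iff_eq_add] at h0 h1 h2 ⊢
    simp only [smul_add, h0, h1, h2]
    rcases koszulSign_eq_one_or p s with h1 | h1 <;>
    rcases koszulSign_eq_one_or r s with h2 | h2 <;>
    rcases koszulSign_eq_one_or p r with h3 | h3 <;>
    simp only [h1, h2, h3, smul_add, smul_sub, smul_smul, one_smul, neg_one_units_smul, one_mul,
      mul_one, mul_neg, neg_mul, neg_neg] <;> abel
  | mul_scalar i a w ha h =>
    simp only [vectorField_mul_scalar hF, vectorField_mul_scalar hG, vectorField_mul_scalar hFG,
      vectorField_mul_scalar hGF, ← smul_mul_assoc, ← sub_mul, h hF hG hFG hGF]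

end Identities
end SuperSym

/-! ### The functional equation of `t / (e^t - 1)`, degree by degree. -/

namespace PowerSeries

variable {A : Type*} [CommRing A]

/-- The addition formula for `g(t) = (e^t - 1)/t` in degrees up to `d + 1`, if `(d + 2)!` is
invertible. -/
theorem coeff_expDiv_add {g : PowerSeries A} {d : ℕ}
    (hg : ∀ n ≤ d, coeff n g * ((n + 1).factorial : A) = 1) (s t : A) (n : ℕ) (hn : n ≤ d) :
    coeff n (C (s + t) * rescale (s + t) g) = coeff n (C s * rescale s g + C t * rescale t g +
      C (s * t) * (X * (rescale s g * rescale t g))) := by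
  have hunit : IsUnit (((n + 1).factorial : A)) := IsUnit.of_mul_eq_one_right _ (hg n hn)
  simp only [map_add (coeff n), coeff_C_mul, coeff_rescale]
  obtain _ | m := n
  · simp; ring
  rw [coeff_succ_X_mul, coeff_mul]
  simp only [coeff_rescale]
  have h1 : (s + t) * ((s + t) ^ (m + 1) * coeff (m + 1) g) = coeff (m + 1) g * (s + t) ^ (m + 2) := by
    ring
  -- The two extreme terms of the binomial expansion, in `s^(m+2)` and `t^(m+2)`, match the linear
  -- terms; the inner ones are shifted by one in each exponent and match the product.
  rw [h1, (Commute.all s t).add_pow', Finset.Nat.antidiagonal_succ_succ']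
  simp only [Finset.sum_cons, Finset.sum_map, mul_add, Finset.mul_sum]
  have h2 : ∀ x ∈ Finset.HasAntidiagonal.antidiagonal m,
      coeff (m + 1) g * ((m + 2).choose (x.1 + 1) • (s ^ (x.1 + 1) * t ^ (x.2 + 1))) =
        s * t * (s ^ x.1 * coeff x.1 g * (t ^ x.2 * coeff x.2 g)) := by
    rintro ⟨i, j⟩ hx
    rw [Finset.HasAntidiagonal.mem_antidiagonal] at hx
    simp only at hx ⊢
    have hi := hg i (by omega)
    have hj := hg j (by omega)
    have hm := hg (m + 1) hn
    have hch : ((m + 2).choose (i + 1) : A) * ((i + 1).factorial : A) * ((j + 1).factorial : A) =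
        ((m + 1 + 1).factorial : A) := by
      have := Nat.add_choose_mul_factorial_mul_factorial (j + 1) (i + 1)
      rw [show j + 1 + (i + 1) = m + 2 by omega, mul_right_comm] at this
      rw [← Nat.cast_mul, ← Nat.cast_mul, this]
    -- This is `C(m+2, i+1)/(m+2)! = 1/((i+1)! (j+1)!)` with `i + j = m`, obtained by inserting
    -- factors equal to `1`, so nothing is cancelled in `A`.
    have key : coeff (m + 1) g * ((m + 2).choose (i + 1) : A) = coeff i g * coeff j g := by
      calc _ = coeff (m + 1) g * ((m + 2).choose (i + 1) : A) *
            ((coeff i g * ((i + 1).factorial : A)) * (coeff j g * ((j + 1).factorial : A))) := by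
              rw [hi, hj]; ring
        _ = coeff (m + 1) g * (((m + 2).choose (i + 1) : A) * ((i + 1).factorial : A) *
            ((j + 1).factorial : A)) * (coeff i g * coeff j g) := by ring
        _ = _ := by rw [hch, hm, one_mul]
    rw [nsmul_eq_mul]
    linear_combination (s ^ (i + 1) * t ^ (j + 1)) * key
  simp only [Function.Embedding.prodMap, Function.Embedding.coeFn_mk, Prod.map, Nat.succ_eq_add_one]
  rw [Finset.sum_congr rfl h2]
  simp
  ring

/-- The homogeneous component of degree `d` of the functional equation of `t/(e^t - 1)`. -/
theorem bernoulli_functional_equation {f g : PowerSeries A} (hfg : g * f = 1) {d : ℕ}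
    (hg : ∀ n ≤ d + 1, coeff n g * ((n + 1).factorial : A) = 1) {s t : A}
    (hst : IsLeftRegular (s * t)) :
    ∑ x ∈ Finset.HasAntidiagonal.antidiagonal (d + 1), coeff x.1 f * coeff x.2 f *
      (s ^ x.1 * ∑ i ∈ Finset.range x.2, (s + t) ^ i * t ^ (x.2 - 1 - i) +
       t ^ x.2 * ∑ i ∈ Finset.range x.1, (s + t) ^ i * s ^ (x.1 - 1 - i)) =
      - (coeff d f * (s + t) ^ d) := by
  -- Only finitely many coefficients of `g` are known to be inverse factorials, so the addition
  -- formula holds modulo `X^(d+2)`. This survives multiplication by `f(sX) f(tX) f((s+t)X)`, which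
  -- removes every `g`; the coefficient of degree `d + 1` is then read off.
  have hdvd : (X : PowerSeries A) ^ (d + 2) ∣ C (s + t) * rescale (s + t) g -
      (C s * rescale s g + C t * rescale t g +
        C (s * t) * (X * (rescale s g * rescale t g))) := by
    rw [X_pow_dvd_iff]
    intro m hm
    rw [map_sub, coeff_expDiv_add hg s t m (by omega), sub_self]
  have hr : ∀ a : A, rescale a g * rescale a f = 1 := fun a => by rw [← map_mul, hfg, map_one]
  have hdvd' := hdvd.mul_right (rescale s f * rescale t f * rescale (s + t) f)
  have he : (C (s + t) * rescale (s + t) g - (C s * rescale s g + C t * rescale t g +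
        C (s * t) * (X * (rescale s g * rescale t g)))) *
        (rescale s f * rescale t f * rescale (s + t) f) =
      C (s + t) * (rescale s f * rescale t f) - C s * (rescale t f * rescale (s + t) f) -
        C t * (rescale s f * rescale (s + t) f) - C (s * t) * (X * rescale (s + t) f) := by
    linear_combination (C (s + t) * rescale s f * rescale t f) * hr (s + t) -
      (C s * rescale t f * rescale (s + t) f + C (s * t) * X * rescale (s + t) f * rescale t g *
        rescale t f) * hr s - (C t * rescale s f * rescale (s + t) f +
        C (s * t) * X * rescale (s + t) f) * hr t
  rw [he, X_pow_dvd_iff] at hdvd'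
  have h := hdvd' (d + 1) (by omega)
  simp only [map_sub, coeff_C_mul, coeff_succ_X_mul] at h
  simp only [coeff_mul, coeff_rescale] at h
  -- After multiplication by `st` the divided differences become differences of powers, by the
  -- geometric sums `hg1` and `hg2`.
  apply hst
  have hg1 : ∀ n, s * ∑ i ∈ Finset.range n, (s + t) ^ i * t ^ (n - 1 - i) =
      (s + t) ^ n - t ^ n := fun n => by
    rw [← geom_sum₂_mul (s + t) t n]; ring
  have hg2 : ∀ n, t * ∑ i ∈ Finset.range n, (s + t) ^ i * s ^ (n - 1 - i) =
      (s + t) ^ n - s ^ n := fun n => by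
    rw [← geom_sum₂_mul (s + t) s n]; ring
  have hsw : ∑ x ∈ Finset.HasAntidiagonal.antidiagonal (d + 1),
      coeff x.1 f * coeff x.2 f * (t ^ x.2 * (s + t) ^ x.1) =
      ∑ x ∈ Finset.HasAntidiagonal.antidiagonal (d + 1),
        t ^ x.1 * coeff x.1 f * ((s + t) ^ x.2 * coeff x.2 f) := by
    rw [← Finset.Nat.sum_antidiagonal_swap]
    exact Finset.sum_congr rfl fun x _ => by simp only [Prod.fst_swap, Prod.snd_swap]; ring
  have hterm : ∀ x ∈ Finset.HasAntidiagonal.antidiagonal (d + 1), s * t * (coeff x.1 f * coeff x.2 f *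
      (s ^ x.1 * ∑ i ∈ Finset.range x.2, (s + t) ^ i * t ^ (x.2 - 1 - i) +
       t ^ x.2 * ∑ i ∈ Finset.range x.1, (s + t) ^ i * s ^ (x.1 - 1 - i))) =
      t * (s ^ x.1 * coeff x.1 f * ((s + t) ^ x.2 * coeff x.2 f)) -
      t * (s ^ x.1 * coeff x.1 f * (t ^ x.2 * coeff x.2 f)) +
      s * (coeff x.1 f * coeff x.2 f * (t ^ x.2 * (s + t) ^ x.1)) -
      s * (s ^ x.1 * coeff x.1 f * (t ^ x.2 * coeff x.2 f)) := fun x _ => by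
    linear_combination (coeff x.1 f * coeff x.2 f * s ^ x.1 * t) * hg1 x.2 +
      (coeff x.1 f * coeff x.2 f * t ^ x.2 * s) * hg2 x.1
  simp only
  rw [Finset.mul_sum, Finset.sum_congr rfl hterm]
  simp only [Finset.sum_sub_distrib, Finset.sum_add_distrib, ← Finset.mul_sum]
  rw [hsw]
  linear_combination -h

end PowerSeries

/-- Only the constant coefficient `1` has to be invertible: wherever a factorial is not a unit,
`Ring.inverse` contributes zero and the identity is unaffected. -/
theorem bernoulliSeries_mul (A : Type*) [Ring A] :
    (PowerSeries.mk fun n => Ring.inverse ((Nat.factorial (n + 1) : ℕ) : A)) *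
      bernoulliSeries A = 1 :=
  PowerSeries.mul_invOfUnit _ _ (by simp)

namespace SuperSym

/-! ### The grading of the symmetric superalgebra by degree. -/

section Power
set_option linter.unusedSectionVars false

variable {k 𝔤 : Type*} [Ring k] [AddCommGroup 𝔤] [Module k 𝔤] [Module kᵐᵒᵖ 𝔤]
  [SMulCommClass k kᵐᵒᵖ 𝔤] [Bracket 𝔤 𝔤]
  {𝓚 : ZMod 2 → AddSubgroup k} {𝓖 : ZMod 2 → AddSubgroup 𝔤}
  [GradedRing 𝓚] [CommSuperring 𝓚] [DirectSum.Decomposition 𝓖] [SuperModule 𝓚 𝓖]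
  [LieSuperalgebra 𝓚 𝓖]

theorem prod_mem_power (l : List 𝔤) : (l.map (vec k 𝓖)).prod ∈ power k 𝓖 l.length :=
  AddSubgroup.subset_closure ⟨l, 1, rfl, by simp⟩

theorem one_mem_power : (1 : SuperSym k 𝓖) ∈ power k 𝓖 0 := prod_mem_power (k := k) []

theorem vec_mul_mem_power (X : 𝔤) {n : ℕ} {w : SuperSym k 𝓖} (hw : w ∈ power k 𝓖 n) :
    vec k 𝓖 X * w ∈ power k 𝓖 (n + 1) := by
  induction hw using AddSubgroup.closure_induction with
  | mem w hw =>
    obtain ⟨l, a, hl, rfl⟩ := hw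
    exact AddSubgroup.subset_closure ⟨X :: l, a, by simp [hl], by simp [mul_assoc]⟩
  | zero => simp
  | add w z _ _ h1 h2 => rw [mul_add]; exact add_mem h1 h2
  | neg w _ h => rw [mul_neg]; exact neg_mem h

theorem mul_scalar_mem_power (a : k) {n : ℕ} {w : SuperSym k 𝓖} (hw : w ∈ power k 𝓖 n) :
    w * scalar k 𝓖 a ∈ power k 𝓖 n := by
  induction hw using AddSubgroup.closure_induction with
  | mem w hw =>
    obtain ⟨l, b, hl, rfl⟩ := hw
    exact AddSubgroup.subset_closure ⟨l, b * a, hl, by simp [mul_assoc]⟩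
  | zero => simp
  | add w z _ _ h1 h2 => rw [add_mul]; exact add_mem h1 h2
  | neg w _ h => rw [neg_mul]; exact neg_mem h

theorem power_induction {P : ℕ → SuperSym k 𝓖 → Prop}
    (add : ∀ n w z, P n w → P n z → P n (w + z)) (one : P 0 1)
    (vec_mul : ∀ (q : ZMod 2) (n : ℕ) (X : 𝔤) (w : SuperSym k 𝓖), X ∈ 𝓖 q → w ∈ power k 𝓖 n →
      P n w → P (n + 1) (vec k 𝓖 X * w))
    (mul_scalar : ∀ (n : ℕ) (a : k) (w : SuperSym k 𝓖), P n w → P n (w * scalar k 𝓖 a))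
    {n : ℕ} {w : SuperSym k 𝓖} (hw : w ∈ power k 𝓖 n) : P n w := by
  have key : ∀ l : List 𝔤, P l.length (l.map (vec k 𝓖)).prod := by
    intro l
    induction l with
    | nil => exact one
    | cons X l ih =>
      rw [List.map_cons, List.prod_cons]
      induction X using DirectSum.Decomposition.inductionOn 𝓖 with
      | zero => simpa using mul_scalar _ 0 _ (vec_mul 0 _ 0 _ (zero_mem _) (prod_mem_power l) ih)
      | homogeneous X => exact vec_mul _ _ _ _ X.2 (prod_mem_power l) ih
      | add X Y hX hY => rw [map_add, add_mul]; exact add _ _ _ hX hY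
  induction hw using AddSubgroup.closure_induction with
  | mem w hw =>
    obtain ⟨l, a, rfl, rfl⟩ := hw
    exact mul_scalar _ _ _ (key l)
  -- Any word of length `n` will do: it is multiplied by the scalar `0`.
  | zero => simpa using mul_scalar _ 0 _ (key (List.replicate n 0))
  | add w z _ _ h1 h2 => exact add _ _ _ h1 h2
  | neg w _ h => simpa using mul_scalar _ (-1) _ h

/-- The sum of the `S^m(𝔤)` with `m ≤ n`. -/
def powerLE (k : Type*) {𝔤 : Type*} [Ring k] [AddCommGroup 𝔤] [Module k 𝔤] [Module kᵐᵒᵖ 𝔤]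
    (𝓖 : ZMod 2 → AddSubgroup 𝔤) (n : ℕ) : AddSubgroup (SuperSym k 𝓖) :=
  AddSubgroup.closure {w | ∃ m ≤ n, w ∈ power k 𝓖 m}

theorem power_le_powerLE {m n : ℕ} (h : m ≤ n) : power k 𝓖 m ≤ powerLE k 𝓖 n :=
  fun _ hw => AddSubgroup.subset_closure ⟨m, h, hw⟩

theorem powerLE_mono {m n : ℕ} (h : m ≤ n) : powerLE k 𝓖 m ≤ powerLE k 𝓖 n := by
  refine (AddSubgroup.closure_le _).2 ?_
  rintro _ ⟨l, hl, hw⟩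
  exact power_le_powerLE (hl.trans h) hw

theorem vec_mul_mem_powerLE (X : 𝔤) {n : ℕ} {w : SuperSym k 𝓖} (hw : w ∈ powerLE k 𝓖 n) :
    vec k 𝓖 X * w ∈ powerLE k 𝓖 (n + 1) := by
  induction hw using AddSubgroup.closure_induction with
  | mem w hw =>
    obtain ⟨m, hm, hw⟩ := hw
    exact power_le_powerLE (Nat.succ_le_succ hm) (vec_mul_mem_power X hw)
  | zero => simp
  | add w z _ _ h1 h2 => rw [mul_add]; exact add_mem h1 h2
  | neg w _ h => rw [mul_neg]; exact neg_mem h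

theorem mul_scalar_mem_powerLE (a : k) {n : ℕ} {w : SuperSym k 𝓖} (hw : w ∈ powerLE k 𝓖 n) :
    w * scalar k 𝓖 a ∈ powerLE k 𝓖 n := by
  induction hw using AddSubgroup.closure_induction with
  | mem w hw =>
    obtain ⟨m, hm, hw⟩ := hw
    exact power_le_powerLE hm (mul_scalar_mem_power a hw)
  | zero => simp
  | add w z _ _ h1 h2 => rw [add_mul]; exact add_mem h1 h2
  | neg w _ h => rw [neg_mul]; exact neg_mem h

theorem exists_mem_powerLE (𝓚 : ZMod 2 → AddSubgroup k) [GradedRing 𝓚] [CommSuperring 𝓚]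
    [SuperModule 𝓚 𝓖] (w : SuperSym k 𝓖) : ∃ n, w ∈ powerLE k 𝓖 n := by
  induction w using induction_vec_mul (𝓚 := 𝓚) (𝓜 := 𝓖) with
  | add w z h1 h2 =>
    obtain ⟨m, h1⟩ := h1
    obtain ⟨n, h2⟩ := h2
    exact ⟨max m n, add_mem (powerLE_mono (le_max_left _ _) h1)
      (powerLE_mono (le_max_right _ _) h2)⟩
  | one => exact ⟨0, power_le_powerLE le_rfl one_mem_power⟩
  | vec_mul q X w hX h => obtain ⟨n, h⟩ := h; exact ⟨n + 1, vec_mul_mem_powerLE X h⟩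
  | mul_scalar i a w ha h => obtain ⟨n, h⟩ := h; exact ⟨n, mul_scalar_mem_powerLE a h⟩

theorem hom_ext_power (𝓚 : ZMod 2 → AddSubgroup k) [GradedRing 𝓚] [CommSuperring 𝓚]
    [SuperModule 𝓚 𝓖] {C : Type*} [AddCommGroup C] {F G : SuperSym k 𝓖 →+ C}
    (h : ∀ n, ∀ w ∈ power k 𝓖 n, F w = G w) : F = G := by
  ext w
  obtain ⟨n, hw⟩ := exists_mem_powerLE 𝓚 w
  induction hw using AddSubgroup.closure_induction with
  | mem w hw => obtain ⟨m, _, hw⟩ := hw; exact h m w hw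
  | zero => simp
  | add w z _ _ h1 h2 => rw [map_add, map_add, h1, h2]
  | neg w _ h => rw [map_neg, map_neg, h]

theorem homogeneousComponents_of_mem {n : ℕ} {w : SuperSym k 𝓖} (hw : w ∈ power k 𝓖 n) :
    homogeneousComponents 𝓖 w = Polynomial.monomial n w := by
  induction hw using AddSubgroup.closure_induction with
  | mem w hw =>
    obtain ⟨l, a, rfl, rfl⟩ := hw
    rw [map_mul, homogeneousComponents_scalar, ← Polynomial.monomial_mul_C]
    congr 1
    induction l with
    | nil => rw [List.map_nil, List.prod_nil, map_one]; exact Polynomial.monomial_zero_one.symm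
    | cons X l ih =>
      have h : homogeneousComponents 𝓖 (vec k 𝓖 X) = Polynomial.monomial 1 (vec k 𝓖 X) := by
        rw [homogeneousComponents, lift_vec]; rfl
      rw [List.map_cons, List.prod_cons, map_mul, ih, h, Polynomial.monomial_mul_monomial,
        List.length_cons, add_comm]
  | zero => simp
  | add w z _ _ h1 h2 => rw [map_add, map_add, h1, h2]
  | neg w _ h => rw [map_neg, map_neg, h]

theorem coeff_homogeneousComponents_of_mem_powerLE {m n : ℕ} (h : n < m) {w : SuperSym k 𝓖}
    (hw : w ∈ powerLE k 𝓖 n) : (homogeneousComponents 𝓖 w).coeff m = 0 := by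
  induction hw using AddSubgroup.closure_induction with
  | mem w hw =>
    obtain ⟨l, hl, hw⟩ := hw
    rw [homogeneousComponents_of_mem hw, Polynomial.coeff_monomial, if_neg (by omega)]
  | zero => simp
  | add w z _ _ h1 h2 => rw [map_add, Polynomial.coeff_add, h1, h2, add_zero]
  | neg w _ h => rw [map_neg, Polynomial.coeff_neg, h, neg_zero]

/-- The coefficient of `X^m` in the polynomial of homogeneous components is `w` for one reason and
zero for the other. This independence of degrees is what injectivity of the symbol needs. -/
theorem power_inf_powerLE {m n : ℕ} (h : n < m) {w : SuperSym k 𝓖} (hw : w ∈ power k 𝓖 m)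
    (hw' : w ∈ powerLE k 𝓖 n) : w = 0 := by
  have := coeff_homogeneousComponents_of_mem_powerLE h hw'
  rwa [homogeneousComponents_of_mem hw, Polynomial.coeff_monomial, if_pos rfl] at this

theorem coeff_homogeneousComponents_mem {i : ZMod 2} {w : SuperSym k 𝓖} (hw : w ∈ part 𝓖 𝓚 i)
    (n : ℕ) : (homogeneousComponents 𝓖 w).coeff n ∈ part 𝓖 𝓚 i := by
  refine part_induction (P := fun i w => ∀ n, (homogeneousComponents 𝓖 w).coeff n ∈ part 𝓖 𝓚 i)
    ?_ ?_ ?_ ?_ ?_ hw n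
  · intro i n; simp
  · intro i w z h1 h2 n; rw [map_add, Polynomial.coeff_add]; exact add_mem (h1 n) (h2 n)
  · intro n; rw [map_one, Polynomial.coeff_one]
    split_ifs
    exacts [one_mem_part, zero_mem _]
  · intro q j X w hX hw h n
    have h' : homogeneousComponents 𝓖 (vec k 𝓖 X) = Polynomial.monomial 1 (vec k 𝓖 X) := by
      rw [homogeneousComponents, lift_vec]; rfl
    rw [map_mul, h']
    cases n with
    | zero => rw [Polynomial.mul_coeff_zero]; simp
    | succ n =>
      rw [Polynomial.coeff_monomial_mul]
      exact SetLike.GradedMul.mul_mem (vec_mem_part 𝓖 𝓚 hX) (h n)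
  · intro i j a w ha hw h n
    rw [map_mul, homogeneousComponents_scalar, Polynomial.coeff_mul_C]
    exact SetLike.GradedMul.mul_mem (h n) (scalar_mem_part 𝓖 𝓚 ha)

section Degree

variable {p q r : ZMod 2} {F G : SuperSym k 𝓖 →+ 𝔤}

theorem partialDeriv_eq_zero_of_power {n : ℕ} (hF : ∀ w ∈ power k 𝓖 (n + 1), F w = 0) (X : 𝔤) :
    ∀ w ∈ power k 𝓖 n, partialDeriv X F w = 0 :=
  fun _ hw => hF _ (vec_mul_mem_power X hw)

/-- The generic point lives in degree one, so `ad x` shifts degrees by one. Writing `j + 1 = m`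
makes the hypothesis empty for `m = 0`, where `[x, F]` always vanishes. -/
theorem adPoint_eq_zero_of_power (hF : IsHom 𝓚 p F) {m : ℕ}
    (h : ∀ j, j + 1 = m → ∀ w ∈ power k 𝓖 j, F w = 0) {w : SuperSym k 𝓖}
    (hw : w ∈ power k 𝓖 m) : adPoint 𝓚 p F w = 0 := by
  refine power_induction (P := fun m w => ∀ p (F : SuperSym k 𝓖 →+ 𝔤), IsHom 𝓚 p F →
    (∀ j, j + 1 = m → ∀ w ∈ power k 𝓖 j, F w = 0) → adPoint 𝓚 p F w = 0) ?_ ?_ ?_ ?_ hw p F hF h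
  · intro n w z h1 h2 p F hF h; rw [map_add, h1 p F hF h, h2 p F hF h, add_zero]
  · intro p F hF _; exact adPoint_one hF
  · intro q n X w hX hw ih p F hF h
    rw [adPoint_vec_mul hF hX, h n rfl w hw, ih _ _ (hF.partialDeriv hX), map_zero, smul_zero,
      add_zero]
    rintro j rfl
    exact partialDeriv_eq_zero_of_power (h _ rfl) X
  · intro n a w ih p F hF h
    rw [(adPoint_isHom hF).map_right, ih p F hF h, smul_zero]

/-- `Δ` distributes the `m` factors over `F` and `G`, hence the condition on all splittings `i + j =
m`. -/
theorem convBracket_eq_zero_of_power (hF : IsHom 𝓚 p F) (hG : IsHom 𝓚 r G) {m : ℕ}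
    (h : ∀ i j, i + j = m → (∀ w ∈ power k 𝓖 i, F w = 0) ∨ (∀ w ∈ power k 𝓖 j, G w = 0))
    {w : SuperSym k 𝓖} (hw : w ∈ power k 𝓖 m) : convBracket 𝓚 r F G w = 0 := by
  refine power_induction (P := fun m w => ∀ p r (F G : SuperSym k 𝓖 →+ 𝔤), IsHom 𝓚 p F →
    IsHom 𝓚 r G → (∀ i j, i + j = m →
      (∀ w ∈ power k 𝓖 i, F w = 0) ∨ (∀ w ∈ power k 𝓖 j, G w = 0)) →
    convBracket 𝓚 r F G w = 0) ?_ ?_ ?_ ?_ hw p r F G hF hG h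
  · intro n w z h1 h2 p r F G hF hG h
    rw [map_add, h1 p r F G hF hG h, h2 p r F G hF hG h, add_zero]
  · intro p r F G hF hG h
    rw [convBracket_one hF hG]
    rcases h 0 0 rfl with h | h
    · rw [h 1 one_mem_power]; simp
    · rw [h 1 one_mem_power]; simp
  · intro q n X w hX hw ih p r F G hF hG h
    rw [convBracket_vec_mul hF hG hX, ih _ _ _ _ (hF.partialDeriv hX) hG,
      ih _ _ _ _ hF (hG.partialDeriv hX), smul_zero, add_zero]
    · intro i j hij
      exact (h i (j + 1) (by omega)).imp_right fun h => partialDeriv_eq_zero_of_power h X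
    · intro i j hij
      exact (h (i + 1) j (by omega)).imp_left fun h => partialDeriv_eq_zero_of_power h X
  · intro n a w ih p r F G hF hG h
    rw [convBracket_mul_scalar hF hG, ih p r F G hF hG h, smul_zero]

/-- On `S^m` a coderivation sees only the components of its vector field of degree at most `m`. This
allows an infinite series to be replaced by a partial sum. -/
theorem vectorField_eq_zero_of_power (hF : IsHom 𝓚 p F) {m : ℕ}
    (h : ∀ j ≤ m, ∀ w ∈ power k 𝓖 j, F w = 0) {w : SuperSym k 𝓖} (hw : w ∈ power k 𝓖 m) :
    vectorField 𝓚 p F w = 0 := by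
  refine power_induction (P := fun m w => ∀ p (F : SuperSym k 𝓖 →+ 𝔤), IsHom 𝓚 p F →
    (∀ j ≤ m, ∀ w ∈ power k 𝓖 j, F w = 0) → vectorField 𝓚 p F w = 0) ?_ ?_ ?_ ?_ hw p F hF h
  · intro n w z h1 h2 p F hF h; rw [map_add, h1 p F hF h, h2 p F hF h, add_zero]
  · intro p F hF h; rw [vectorField_one hF, h 0 le_rfl 1 one_mem_power, map_zero]
  · intro q n X w hX hw ih p F hF h
    rw [vectorField_vec_mul hF hX, ih p F hF fun j hj => h j (by omega),
      ih _ _ (hF.partialDeriv hX) fun j hj => partialDeriv_eq_zero_of_power (h _ (by omega)) X]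
    simp
  · intro n a w ih p F hF h
    rw [vectorField_mul_scalar hF, ih p F hF h, zero_mul]

theorem vectorField_sub (hF : IsHom 𝓚 p F) (hG : IsHom 𝓚 p G) (w : SuperSym k 𝓖) :
    vectorField 𝓚 p (F - G) w = vectorField 𝓚 p F w - vectorField 𝓚 p G w := by
  rw [eq_sub_iff_add_eq, ← vectorField_add (hF.sub hG) hG, sub_add_cancel]

theorem vectorField_congr_of_power (hF : IsHom 𝓚 p F) (hG : IsHom 𝓚 p G) {m : ℕ}
    (h : ∀ j ≤ m, ∀ w ∈ power k 𝓖 j, F w = G w) {w : SuperSym k 𝓖} (hw : w ∈ power k 𝓖 m) :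
    vectorField 𝓚 p F w = vectorField 𝓚 p G w := by
  rw [← sub_eq_zero, ← vectorField_sub hF hG]
  refine vectorField_eq_zero_of_power (hF.sub hG) (fun j hj w hw => ?_) hw
  rw [AddMonoidHom.sub_apply, h j hj w hw, sub_self]

/-- The coderivation attached to `F` is the multiplication by `F(1)` up to terms of lower degree. -/
theorem vec_mul_sub_vectorField_mem (hF : IsHom 𝓚 p F) {n : ℕ} {w : SuperSym k 𝓖}
    (hw : w ∈ power k 𝓖 n) :
    vectorField 𝓚 p F w - vec k 𝓖 (F 1) * w ∈ powerLE k 𝓖 n ∧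
      vectorField 𝓚 p F w ∈ powerLE k 𝓖 (n + 1) := by
  suffices h : vectorField 𝓚 p F w - vec k 𝓖 (F 1) * w ∈ powerLE k 𝓖 n by
    refine ⟨h, ?_⟩
    have := add_mem (powerLE_mono n.le_succ h)
      (vec_mul_mem_powerLE (F 1) (power_le_powerLE le_rfl hw))
    rwa [sub_add_cancel] at this
  refine power_induction (P := fun n w => ∀ p (F : SuperSym k 𝓖 →+ 𝔤), IsHom 𝓚 p F →
    vectorField 𝓚 p F w - vec k 𝓖 (F 1) * w ∈ powerLE k 𝓖 n) ?_ ?_ ?_ ?_ hw p F hF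
  · intro n w z h1 h2 p F hF
    rw [map_add, mul_add, add_sub_add_comm]
    exact add_mem (h1 p F hF) (h2 p F hF)
  · intro p F hF; rw [vectorField_one hF, mul_one, sub_self]; exact zero_mem _
  · intro q n X w hX hw ih p F hF
    have hF1 : F 1 ∈ 𝓖 p := by simpa using hF.map_mem one_mem_part
    have h1 := vec_mul_mem_powerLE X (ih p F hF)
    have h2 := powerLE_mono n.le_succ (ih _ _ (hF.partialDeriv hX))
    have h3 := vec_mul_mem_powerLE (partialDeriv X F 1) (power_le_powerLE le_rfl hw)
    have h4 := add_mem (AddSubgroup.units_smul_mem _ (koszulSign p q) h1) (add_mem h2 h3)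
    rw [sub_add_cancel] at h4
    rw [vectorField_vec_mul hF hX, ← mul_assoc, vec_comm hF1 hX, koszulSign_def, smul_mul_assoc,
      mul_assoc, add_sub_right_comm, ← smul_sub, ← mul_sub]
    exact h4
  · intro n a w ih p F hF
    rw [vectorField_mul_scalar hF, ← mul_assoc, ← sub_mul]
    exact mul_scalar_mem_powerLE a (ih p F hF)

end Degree

end Power

end SuperSym

/-! ### The lower central series and nilpotency. -/

section LowerCentral
set_option linter.unusedSectionVars false

variable {k 𝔤 : Type*} [Ring k] [AddCommGroup 𝔤] [Module k 𝔤] [Module kᵐᵒᵖ 𝔤]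
  [SMulCommClass k kᵐᵒᵖ 𝔤] [Bracket 𝔤 𝔤]
  {𝓚 : ZMod 2 → AddSubgroup k} {𝓖 : ZMod 2 → AddSubgroup 𝔤}
  [GradedRing 𝓚] [CommSuperring 𝓚] [DirectSum.Decomposition 𝓖] [SuperModule 𝓚 𝓖]
  [LieSuperalgebra 𝓚 𝓖]

/-- Iterated brackets `[X₁, [X₂, …, [X_n, X]…]]` of homogeneous elements. -/
inductive LieWord (𝓖 : ZMod 2 → AddSubgroup 𝔤) : ℕ → ZMod 2 → 𝔤 → Prop
  | base {i : ZMod 2} {X : 𝔤} : X ∈ 𝓖 i → LieWord 𝓖 0 i X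
  | lie {q i : ZMod 2} {n : ℕ} {X Y : 𝔤} : X ∈ 𝓖 q → LieWord 𝓖 n i Y →
      LieWord 𝓖 (n + 1) (q + i) ⁅X, Y⁆

/-- The lower central series of `𝔤`. -/
def lowerCentral (𝓖 : ZMod 2 → AddSubgroup 𝔤) (n : ℕ) : AddSubgroup 𝔤 :=
  AddSubgroup.closure {Y | ∃ i, LieWord 𝓖 n i Y}

theorem LieWord.mem (𝓚 : ZMod 2 → AddSubgroup k) [LieSuperalgebra 𝓚 𝓖] {n : ℕ} {i : ZMod 2}
    {Y : 𝔤} (h : LieWord 𝓖 n i Y) : Y ∈ 𝓖 i := by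
  induction h with
  | base h => exact h
  | lie hX _ ih => exact LieSuperalgebra.lie_mem 𝓚 hX ih

theorem mem_lowerCentral_zero (X : 𝔤) : X ∈ lowerCentral 𝓖 0 := by
  induction X using DirectSum.Decomposition.inductionOn 𝓖 with
  | zero => exact zero_mem _
  | homogeneous X => exact AddSubgroup.subset_closure ⟨_, .base X.2⟩
  | add X Y hX hY => exact add_mem hX hY

theorem bracketHom_mem_lowerCentral_succ (X : 𝔤) {n : ℕ} {Y : 𝔤} (hY : Y ∈ lowerCentral 𝓖 n) :
    bracketHom 𝓚 𝓖 X Y ∈ lowerCentral 𝓖 (n + 1) := by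
  induction X using DirectSum.Decomposition.inductionOn 𝓖 with
  | zero => simp
  | add X Y hX hY => rw [map_add]; exact add_mem hX hY
  | homogeneous X =>
    induction hY using AddSubgroup.closure_induction with
    | mem Y hY =>
      obtain ⟨i, hY⟩ := hY
      exact AddSubgroup.subset_closure ⟨_, .lie X.2 hY⟩
    | zero => simp
    | add w z _ _ h1 h2 => rw [map_add]; exact add_mem h1 h2
    | neg w _ h => rw [map_neg]; exact neg_mem h

/-- The Jacobi identity rewrites `[[X, Z], Y]` through `[X, [Z, Y]]` and `[Z, [X, Y]]`, so the depth
of the left argument decreases. The index counts brackets, and the outer bracket adds one. -/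
theorem bracketHom_mem_lowerCentral {i j : ℕ} {X Y : 𝔤} (hX : X ∈ lowerCentral 𝓖 i)
    (hY : Y ∈ lowerCentral 𝓖 j) : bracketHom 𝓚 𝓖 X Y ∈ lowerCentral 𝓖 (i + j + 1) := by
  induction hX using AddSubgroup.closure_induction with
  | mem X hX =>
    obtain ⟨p, hX⟩ := hX
    induction hX generalizing j Y with
    | base _ => rw [zero_add]; exact bracketHom_mem_lowerCentral_succ _ hY
    | @lie q p n X Z hX hZ ih =>
      have h := SuperSym.bracketHom_jacobi (𝓚 := 𝓚) hX (hZ.mem 𝓚) Y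
      rw [← sub_eq_iff_eq_add] at h
      change bracketHom 𝓚 𝓖 (bracketHom 𝓚 𝓖 X Z) Y ∈ _
      rw [← h]
      have e : n + 1 + j + 1 = n + j + 1 + 1 := by ring
      have e' : n + 1 + j + 1 = n + (j + 1) + 1 := by ring
      refine sub_mem ?_ (AddSubgroup.units_smul_mem _ _ ?_)
      · rw [e]; exact bracketHom_mem_lowerCentral_succ _ (ih hY)
      · rw [e']; exact ih (bracketHom_mem_lowerCentral_succ _ hY)
  | zero => simp
  | add w z _ _ h1 h2 => rw [map_add]; exact add_mem h1 h2
  | neg w _ h => rw [map_neg]; exact neg_mem h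

theorem lowerCentral_eq_bot (𝓚 : ZMod 2 → AddSubgroup k) [LieSuperalgebra 𝓚 𝓖] {N n : ℕ}
    (h : IsLieNilpotent 𝔤 N) (hn : N ≤ n) : lowerCentral 𝓖 n = ⊥ := by
  have key : ∀ (n : ℕ) (i : ZMod 2) (Y : 𝔤), LieWord 𝓖 n i Y →
      ∃ (l : List 𝔤) (Z : 𝔤), l.length = n ∧ Y = l.foldr (fun X Z => ⁅X, Z⁆) Z := by
    intro n i Y hY
    induction hY with
    | base _ => exact ⟨[], _, rfl, rfl⟩
    | @lie _ _ _ X _ _ _ ih =>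
      obtain ⟨l, Z, hl, rfl⟩ := ih
      exact ⟨X :: l, Z, by simp [hl], rfl⟩
  rw [lowerCentral, AddSubgroup.closure_eq_bot_iff]
  rintro Y ⟨i, hY⟩
  obtain ⟨l, Z, hl, rfl⟩ := key n i Y hY
  -- The outermost `N` of the operators `ad X` already annihilate everything.
  rw [← List.take_append_drop N l, List.foldr_append]
  exact h _ (by rw [List.length_take]; omega) _

namespace SuperSym

variable {p r : ZMod 2} {F G : SuperSym k 𝓖 →+ 𝔤}

theorem op_smul_mem_lowerCentral (𝓚 : ZMod 2 → AddSubgroup k) [GradedRing 𝓚]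
    [CommSuperring 𝓚] [SuperModule 𝓚 𝓖] [LieSuperalgebra 𝓚 𝓖] (a : k)
    {n : ℕ} {Y : 𝔤} (hY : Y ∈ lowerCentral 𝓖 n) : MulOpposite.op a • Y ∈ lowerCentral 𝓖 n := by
  cases n with
  | zero => exact mem_lowerCentral_zero _
  | succ n =>
    induction hY using AddSubgroup.closure_induction with
    | mem Y hY =>
      obtain ⟨i, hY⟩ := hY
      obtain _ | @⟨q, i, _, X, Y, hX, hY⟩ := hY
      rw [← LieSuperalgebra.lie_smul 𝓚 𝓖]
      refine bracketHom_mem_lowerCentral_succ (𝓚 := 𝓚) X ?_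
      exact op_smul_mem_lowerCentral 𝓚 a (AddSubgroup.subset_closure ⟨_, hY⟩)
    | zero => simp
    | add w z _ _ h1 h2 => rw [smul_add]; exact add_mem h1 h2
    | neg w _ h => rw [smul_neg]; exact neg_mem h

theorem convBracket_mem_lowerCentral (hF : IsHom 𝓚 p F) (hG : IsHom 𝓚 r G) {i j : ℕ}
    (hF' : ∀ w, F w ∈ lowerCentral 𝓖 i) (hG' : ∀ w, G w ∈ lowerCentral 𝓖 j)
    (w : SuperSym k 𝓖) : convBracket 𝓚 r F G w ∈ lowerCentral 𝓖 (i + j + 1) := by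
  induction w using induction_vec_mul (𝓚 := 𝓚) (𝓜 := 𝓖) generalizing p r F G with
  | add w z h1 h2 => rw [map_add]; exact add_mem (h1 hF hG hF' hG') (h2 hF hG hF' hG')
  | one => rw [convBracket_one hF hG]; exact bracketHom_mem_lowerCentral (hF' 1) (hG' 1)
  | vec_mul q X w hX h =>
    rw [convBracket_vec_mul hF hG hX]
    exact add_mem (AddSubgroup.units_smul_mem _ _
      (h (hF.partialDeriv hX) hG (fun w => hF' _) hG'))
      (h hF (hG.partialDeriv hX) hF' fun w => hG' _)
  | mul_scalar i a w ha h =>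
    rw [convBracket_mul_scalar hF hG]
    exact op_smul_mem_lowerCentral 𝓚 a (h hF hG hF' hG')

theorem adPoint_mem_lowerCentral (hG : IsHom 𝓚 r G) {j : ℕ}
    (hG' : ∀ w, G w ∈ lowerCentral 𝓖 j) (w : SuperSym k 𝓖) :
    adPoint 𝓚 r G w ∈ lowerCentral 𝓖 (j + 1) := by
  have := convBracket_mem_lowerCentral genericPoint_isHom hG (fun w => mem_lowerCentral_zero _)
    hG' w
  rwa [zero_add] at this

end SuperSym

end LowerCentral

namespace SuperSym

/-! ### Iterates of `ad x` and polynomials in two variables. -/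

section Series
set_option linter.unusedSectionVars false

variable {k 𝔤 : Type*} [Ring k] [AddCommGroup 𝔤] [Module k 𝔤] [Module kᵐᵒᵖ 𝔤]
  [SMulCommClass k kᵐᵒᵖ 𝔤] [Bracket 𝔤 𝔤]
  {𝓚 : ZMod 2 → AddSubgroup k} {𝓖 : ZMod 2 → AddSubgroup 𝔤}
  [GradedRing 𝓚] [CommSuperring 𝓚] [DirectSum.Decomposition 𝓖] [SuperModule 𝓚 𝓖]
  [LieSuperalgebra 𝓚 𝓖]

/-- The even part of a commutative superring is a commutative ring. -/
instance evenCommRing (𝓚 : ZMod 2 → AddSubgroup k) [GradedRing 𝓚] [CommSuperring 𝓚] :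
    CommRing (𝓚 0) :=
  { (inferInstance : Ring (𝓚 0)) with
    mul_comm := fun a b => Subtype.ext (by
      have := CommSuperring.mul_comm_sign a.2 b.2
      rw [koszulSign_def, koszulSign_zero_left, one_smul] at this
      exact this) }

/-- The inclusion of the even part of a superring. -/
def evenSubtype (𝓚 : ZMod 2 → AddSubgroup k) [GradedRing 𝓚] : 𝓚 0 →+* k where
  toFun a := a
  map_one' := rfl
  map_mul' _ _ := rfl
  map_zero' := rfl
  map_add' _ _ := rfl

/-- Coefficients of power series and polynomials are taken in the commutative ring `𝓚 0`; with this
structure polynomial identities can be pushed through the linear map `bracketPoly`. -/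
instance evenModule (𝓚 : ZMod 2 → AddSubgroup k) [GradedRing 𝓚] [CommSuperring 𝓚] :
    Module (𝓚 0) (SuperSym k 𝓖 →+ 𝔤) :=
  Module.compHom _ (evenSubtype 𝓚)

theorem even_smul_def (c : 𝓚 0) (F : SuperSym k 𝓖 →+ 𝔤) : c • F = (c : k) • F := rfl

variable {p r : ZMod 2}

/-- The map `(ad x)^n(a)`. -/
def adIter (𝓚 : ZMod 2 → AddSubgroup k) [GradedRing 𝓚] [CommSuperring 𝓚]
    [SuperModule 𝓚 𝓖] [LieSuperalgebra 𝓚 𝓖] (p : ZMod 2) (n : ℕ) (a : 𝔤) :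
    SuperSym k 𝓖 →+ 𝔤 := (adPoint 𝓚 p)^[n] (constHom a)

theorem adIter_zero (a : 𝔤) : adIter (k := k) (𝓖 := 𝓖) 𝓚 p 0 a = constHom a := rfl

theorem adIter_succ (n : ℕ) (a : 𝔤) :
    adIter (k := k) (𝓖 := 𝓖) 𝓚 p (n + 1) a = adPoint 𝓚 p (adIter 𝓚 p n a) :=
  Function.iterate_succ_apply' _ _ _

theorem adIter_isHom {a : 𝔤} (ha : a ∈ 𝓖 p) (n : ℕ) :
    IsHom 𝓚 p (adIter (k := k) (𝓖 := 𝓖) 𝓚 p n a) := by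
  induction n with
  | zero => exact constHom_isHom ha
  | succ n ih => rw [adIter_succ]; exact adPoint_isHom ih

/-- The constant `a` is concentrated in degree zero, and each `ad x` raises the degree by one. -/
theorem adIter_eq_zero_of_power {a : 𝔤} (ha : a ∈ 𝓖 p) {m n : ℕ} (h : m ≠ n)
    {w : SuperSym k 𝓖} (hw : w ∈ power k 𝓖 m) : adIter 𝓚 p n a w = 0 := by
  induction n generalizing m w with
  | zero =>
    rw [adIter_zero, constHom_apply]
    obtain ⟨m, rfl⟩ := Nat.exists_eq_succ_of_ne_zero h
    suffices h : counit (k := k) 𝓖 w = 0 by rw [h]; simp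
    have := power_induction (P := fun m w => m ≠ 0 → counit (k := k) 𝓖 w = 0) ?_ ?_ ?_ ?_ hw
    · exact this (Nat.succ_ne_zero _)
    · intro n w z h1 h2 hn; rw [map_add, h1 hn, h2 hn, add_zero]
    · intro h; exact absurd rfl h
    · intro q n X w _ _ _ _; exact counit_vec_mul X w
    · intro n a w h hn; rw [counit_mul_scalar, h hn, zero_mul]
  | succ n ih =>
    rw [adIter_succ]
    exact adPoint_eq_zero_of_power (adIter_isHom ha n)
      (fun j hj w hw => ih (by omega) hw) hw

theorem adIter_mem_lowerCentral {a : 𝔤} (ha : a ∈ 𝓖 p) (n : ℕ) (w : SuperSym k 𝓖) :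
    adIter 𝓚 p n a w ∈ lowerCentral 𝓖 n := by
  induction n generalizing w with
  | zero => exact mem_lowerCentral_zero _
  | succ n ih => rw [adIter_succ]; exact adPoint_mem_lowerCentral (adIter_isHom ha n) ih w

/-- Iterated chain rule: one summand for each of the `n` occurrences of `x` replaced by `G`, with
`i` operators `ad x` outside it. No term comes from the constant `a`, which a coderivation kills. -/
theorem adIter_comp_vectorField {a : 𝔤} (ha : a ∈ 𝓖 p) {G : SuperSym k 𝓖 →+ 𝔤}
    (hG : IsHom 𝓚 r G) (n : ℕ) :
    (adIter 𝓚 p n a).comp (vectorField 𝓚 r G) = koszulSign p r •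
      ∑ i ∈ Finset.range n,
        (adPoint 𝓚 (p + r))^[i] (convBracket 𝓚 p G (adIter 𝓚 p (n - 1 - i) a)) := by
  have hi : ∀ i j, IsHom 𝓚 (p + r) ((adPoint 𝓚 (p + r))^[i]
      (convBracket 𝓚 p G (adIter 𝓚 p j a))) := by
    intro i j
    induction i with
    | zero =>
      rw [add_comm p r]; exact convBracket_isHom hG (adIter_isHom ha j)
    | succ i ih => rw [Function.iterate_succ_apply']; exact adPoint_isHom ih
  have hsum : ∀ (s : Finset ℕ) (F : ℕ → SuperSym k 𝓖 →+ 𝔤), (∀ i, IsHom 𝓚 (p + r) (F i)) →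
      adPoint 𝓚 (p + r) (∑ i ∈ s, F i) = ∑ i ∈ s, adPoint 𝓚 (p + r) (F i) := by
    intro s F hF
    induction s using Finset.cons_induction with
    | empty => exact adPoint_zero
    | cons i s hs ih =>
      rw [Finset.sum_cons, Finset.sum_cons, adPoint_add (hF i) (IsHom.sum fun i _ => hF i), ih]
  induction n with
  | zero => rw [adIter_zero, constHom_comp_vectorField a hG]; simp
  | succ n ih =>
    -- The new occurrence is the outermost one, hence the term `i = 0`; the earlier terms acquire
    -- one more `ad x` and move to `i + 1`.
    rw [adIter_succ, adPoint_comp_vectorField (adIter_isHom ha n) hG, ih,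
      adPoint_units_smul (IsHom.sum fun i _ => hi i _), hsum _ _ fun i => hi i _, ← smul_add,
      Finset.sum_range_succ', add_comm]
    simp only [← Function.iterate_succ_apply' (adPoint 𝓚 (p + r)), Function.iterate_zero, id,
      Nat.add_sub_cancel, Nat.sub_zero]
    congr 2
    refine Finset.sum_congr rfl fun i _ => ?_
    rw [Nat.sub_sub, add_comm 1 i]

/-- The linear map from polynomials in two variables to maps `S(𝔤) → 𝔤` with
`s^i t^j ↦ [(ad x)^i(b), (ad x)^j(a)]`. -/
def bracketPoly (𝓚 : ZMod 2 → AddSubgroup k) [GradedRing 𝓚] [CommSuperring 𝓚]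
    [SuperModule 𝓚 𝓖] [LieSuperalgebra 𝓚 𝓖] (p r : ZMod 2) (a b : 𝔤) :
    MvPolynomial (Fin 2) (𝓚 0) →ₗ[𝓚 0] (SuperSym k 𝓖 →+ 𝔤) :=
  (MvPolynomial.basisMonomials (Fin 2) (𝓚 0)).constr (𝓚 0) fun m =>
    convBracket 𝓚 p (adIter 𝓚 r (m 0) b) (adIter 𝓚 p (m 1) a)

theorem bracketPoly_monomial (a b : 𝔤) (m : Fin 2 →₀ ℕ) :
    bracketPoly (𝓖 := 𝓖) 𝓚 p r a b (MvPolynomial.monomial m 1) =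
      convBracket 𝓚 p (adIter 𝓚 r (m 0) b) (adIter 𝓚 p (m 1) a) := by
  have h := congrFun (MvPolynomial.coe_basisMonomials (Fin 2) (𝓚 0)) m
  rw [← h]
  exact Module.Basis.constr_basis _ _ _ _

theorem monomial_eq_smul (m : Fin 2 →₀ ℕ) (c : 𝓚 0) :
    MvPolynomial.monomial m c = c • MvPolynomial.monomial m 1 := by
  rw [MvPolynomial.smul_monomial, smul_eq_mul, mul_one]

theorem bracketPoly_isHom {a b : 𝔤} (ha : a ∈ 𝓖 p) (hb : b ∈ 𝓖 r)
    (f : MvPolynomial (Fin 2) (𝓚 0)) : IsHom 𝓚 (p + r) (bracketPoly (𝓖 := 𝓖) 𝓚 p r a b f) := by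
  induction f using MvPolynomial.induction_on' with
  | monomial m c =>
    rw [monomial_eq_smul, map_smul, bracketPoly_monomial, even_smul_def]
    have := (convBracket_isHom (adIter_isHom (𝓚 := 𝓚) hb (m 0)) (adIter_isHom ha (m 1))).smul c.2
    rwa [zero_add, add_comm] at this
  | add f g hf hg => rw [map_add]; exact hf.add hg

/-- The derivation property of `ad x` in terms of monomials: it raises either the exponent of `b` or
that of `a`, that is, it multiplies by `s + t`. -/
theorem adPoint_bracketPoly {a b : 𝔤} (ha : a ∈ 𝓖 p) (hb : b ∈ 𝓖 r)
    (f : MvPolynomial (Fin 2) (𝓚 0)) :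
    adPoint 𝓚 (p + r) (bracketPoly (𝓖 := 𝓖) 𝓚 p r a b f) =
      bracketPoly 𝓚 p r a b ((MvPolynomial.X 0 + MvPolynomial.X 1) * f) := by
  induction f using MvPolynomial.induction_on' with
  | monomial m c =>
    have h := convBracket_isHom (adIter_isHom (𝓚 := 𝓚) hb (m 0)) (adIter_isHom ha (m 1))
    have h1 := adPoint_convBracket (adIter_isHom (𝓚 := 𝓚) hb (m 0)) (adIter_isHom ha (m 1))
    have h2 := adPoint_smul h c.2
    rw [zero_add] at h2
    rw [monomial_eq_smul, mul_smul_comm, map_smul, map_smul, bracketPoly_monomial, even_smul_def,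
      even_smul_def, add_comm p r, h2, h1, add_mul, map_add, MvPolynomial.X, MvPolynomial.X,
      MvPolynomial.monomial_mul, MvPolynomial.monomial_mul, one_mul, bracketPoly_monomial,
      bracketPoly_monomial]
    simp [← adIter_succ, add_comm 1]
  | add f g hf hg =>
    rw [map_add, adPoint_add (bracketPoly_isHom ha hb f) (bracketPoly_isHom ha hb g), hf, hg,
      mul_add, map_add]

theorem adPoint_iterate_bracketPoly {a b : 𝔤} (ha : a ∈ 𝓖 p) (hb : b ∈ 𝓖 r) (n : ℕ)
    (f : MvPolynomial (Fin 2) (𝓚 0)) :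
    (adPoint 𝓚 (p + r))^[n] (bracketPoly (𝓖 := 𝓖) 𝓚 p r a b f) =
      bracketPoly 𝓚 p r a b ((MvPolynomial.X 0 + MvPolynomial.X 1) ^ n * f) := by
  induction n with
  | zero => simp
  | succ n ih =>
    rw [Function.iterate_succ_apply', ih, adPoint_bracketPoly ha hb, ← mul_assoc, ← pow_succ']

theorem bracketPoly_X_pow (a b : 𝔤) (i j : ℕ) :
    bracketPoly (𝓖 := 𝓖) 𝓚 p r a b (MvPolynomial.X 0 ^ i * MvPolynomial.X 1 ^ j) =
      convBracket 𝓚 p (adIter 𝓚 r i b) (adIter 𝓚 p j a) := by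
  rw [MvPolynomial.X_pow_eq_monomial, MvPolynomial.X_pow_eq_monomial, MvPolynomial.monomial_mul,
    one_mul, bracketPoly_monomial]
  simp

/-- The polynomial `s^l ((s+t)^n - t^n)/s + t^n ((s+t)^l - s^l)/t`. -/
def commPoly {A : Type*} [CommRing A] (s t : A) (l n : ℕ) : A :=
  s ^ l * ∑ i ∈ Finset.range n, (s + t) ^ i * t ^ (n - 1 - i) +
    t ^ n * ∑ i ∈ Finset.range l, (s + t) ^ i * s ^ (l - 1 - i)

/-- The two composites expand by the iterated chain rule into the two halves of `commPoly`. In the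
second one `a` stands on the left of the bracket, and skew-symmetry restores the order, absorbing
the minus sign. -/
theorem adIter_comp_adIter {a b : 𝔤} (ha : a ∈ 𝓖 p) (hb : b ∈ 𝓖 r) (l n : ℕ) :
    (adIter 𝓚 p n a).comp (vectorField 𝓚 r (adIter 𝓚 r l b)) -
      koszulSign p r • (adIter 𝓚 r l b).comp (vectorField 𝓚 p (adIter 𝓚 p n a)) =
    koszulSign p r • bracketPoly (𝓖 := 𝓖) 𝓚 p r a b
      (commPoly (MvPolynomial.X 0) (MvPolynomial.X 1) l n) := by
  have hA := adIter_isHom (k := k) (𝓚 := 𝓚) ha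
  have hB := adIter_isHom (k := k) (𝓚 := 𝓚) hb
  rw [adIter_comp_vectorField ha (hB l), adIter_comp_vectorField hb (hA n), sub_eq_add_neg,
    ← smul_neg, ← smul_add, commPoly, map_add]
  congr 2
  · rw [Finset.mul_sum, map_sum]
    refine Finset.sum_congr rfl fun i _ => ?_
    rw [← bracketPoly_X_pow, adPoint_iterate_bracketPoly ha hb]
    congr 1; ring
  · rw [Finset.mul_sum, map_sum, Finset.smul_sum, ← Finset.sum_neg_distrib]
    refine Finset.sum_congr rfl fun i _ => ?_
    have hu : ∀ (e : ℤˣ) (F : SuperSym k 𝓖 →+ 𝔤), IsHom 𝓚 (p + r) F →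
        (adPoint 𝓚 (p + r))^[i] (e • F) = e • (adPoint 𝓚 (p + r))^[i] F := by
      intro e F hF
      suffices h : ∀ n, IsHom 𝓚 (p + r) ((adPoint 𝓚 (p + r))^[n] F) ∧
          (adPoint 𝓚 (p + r))^[n] (e • F) = e • (adPoint 𝓚 (p + r))^[n] F from (h i).2
      intro n
      induction n with
      | zero => exact ⟨hF, rfl⟩
      | succ n ih =>
        rw [Function.iterate_succ_apply', Function.iterate_succ_apply', ih.2,
          adPoint_units_smul ih.1]
        exact ⟨adPoint_isHom ih.1, rfl⟩
    have hBA := convBracket_isHom (hB (l - 1 - i)) (hA n)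
    rw [add_comm r p] at hBA
    have hskew : convBracket 𝓚 r (adIter (𝓖 := 𝓖) 𝓚 p n a) (adIter 𝓚 r (l - 1 - i) b) =
        (-1 * koszulSign p r) • convBracket 𝓚 p (adIter 𝓚 r (l - 1 - i) b) (adIter 𝓚 p n a) := by
      rw [convBracket_skew (hA n) (hB _), mul_smul, neg_one_units_smul]
    rw [hskew, add_comm r p, hu _ _ hBA, smul_smul, koszulSign_comm r p, mul_left_comm,
      koszulSign_mul_self, mul_one, neg_one_units_smul, neg_neg, ← bracketPoly_X_pow,
      adPoint_iterate_bracketPoly ha hb]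
    congr 1; ring

/-- A form of degree `d` in `s` and `t` stands for `d` copies of `ad x` and one further bracket,
that of `b` with `a`: it has degree `d` on `S(𝔤)` and depth `d + 1` in the lower central series. -/
theorem bracketPoly_term {a b : 𝔤} (ha : a ∈ 𝓖 p) (hb : b ∈ 𝓖 r) (i u v : ℕ) :
    (∀ m ≠ i + u + v, ∀ w ∈ power k 𝓖 m, bracketPoly (𝓖 := 𝓖) 𝓚 p r a b
      ((MvPolynomial.X 0 + MvPolynomial.X 1) ^ i *
        (MvPolynomial.X 0 ^ u * MvPolynomial.X 1 ^ v)) w = 0) ∧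
    ∀ w, bracketPoly (𝓖 := 𝓖) 𝓚 p r a b ((MvPolynomial.X 0 + MvPolynomial.X 1) ^ i *
        (MvPolynomial.X 0 ^ u * MvPolynomial.X 1 ^ v)) w ∈ lowerCentral 𝓖 (i + u + v + 1) := by
  have hA := adIter_isHom (k := k) (𝓚 := 𝓚) ha
  have hB := adIter_isHom (k := k) (𝓚 := 𝓚) hb
  induction i with
  | zero =>
    rw [pow_zero, one_mul, bracketPoly_X_pow, zero_add]
    refine ⟨fun m hm w hw => convBracket_eq_zero_of_power (hB u) (hA v) (fun i j hij => ?_) hw,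
      convBracket_mem_lowerCentral (hB u) (hA v) (adIter_mem_lowerCentral hb u)
        (adIter_mem_lowerCentral ha v)⟩
    by_cases hi : i = u
    · right; intro w hw; exact adIter_eq_zero_of_power ha (by omega) hw
    · left; intro w hw; exact adIter_eq_zero_of_power hb hi hw
  | succ i ih =>
    have hE := bracketPoly_isHom (𝓚 := 𝓚) ha hb ((MvPolynomial.X 0 + MvPolynomial.X 1) ^ i *
        (MvPolynomial.X 0 ^ u * MvPolynomial.X 1 ^ v))
    rw [pow_succ', mul_assoc, ← adPoint_bracketPoly ha hb]
    refine ⟨fun m hm w hw => adPoint_eq_zero_of_power hE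
      (fun j hj w hw => ih.1 j (by omega) w hw) hw, fun w => ?_⟩
    rw [show i + 1 + u + v + 1 = i + u + v + 1 + 1 by ring]
    exact adPoint_mem_lowerCentral hE ih.2 w

/-- `commPoly` is homogeneous of degree `l + n - 1`; the condition on `l + n` and `m + 1` avoids the
subtraction and covers `l = n = 0`, where the polynomial is zero. -/
theorem bracketPoly_commPoly {a b : 𝔤} (ha : a ∈ 𝓖 p) (hb : b ∈ 𝓖 r) (l n : ℕ) :
    (∀ m, l + n ≠ m + 1 → ∀ w ∈ power k 𝓖 m, bracketPoly (𝓖 := 𝓖) 𝓚 p r a b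
      (commPoly (MvPolynomial.X 0) (MvPolynomial.X 1) l n) w = 0) ∧
    ∀ w, bracketPoly (𝓖 := 𝓖) 𝓚 p r a b
      (commPoly (MvPolynomial.X 0) (MvPolynomial.X 1) l n) w ∈ lowerCentral 𝓖 (l + n) := by
  have h1 : ∀ i, (MvPolynomial.X 0 ^ l * ((MvPolynomial.X 0 + MvPolynomial.X 1) ^ i *
      MvPolynomial.X 1 ^ (n - 1 - i)) : MvPolynomial (Fin 2) (𝓚 0)) =
      (MvPolynomial.X 0 + MvPolynomial.X 1) ^ i *
        (MvPolynomial.X 0 ^ l * MvPolynomial.X 1 ^ (n - 1 - i)) := fun i => by ring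
  have h2 : ∀ i, (MvPolynomial.X 1 ^ n * ((MvPolynomial.X 0 + MvPolynomial.X 1) ^ i *
      MvPolynomial.X 0 ^ (l - 1 - i)) : MvPolynomial (Fin 2) (𝓚 0)) =
      (MvPolynomial.X 0 + MvPolynomial.X 1) ^ i *
        (MvPolynomial.X 0 ^ (l - 1 - i) * MvPolynomial.X 1 ^ n) := fun i => by ring
  simp only [commPoly, map_add, Finset.mul_sum, map_sum, AddMonoidHom.add_apply,
    AddMonoidHom.finsetSum_apply, h1, h2]
  refine ⟨fun m hm w hw => ?_, fun w => add_mem (sum_mem fun i hi => ?_) (sum_mem fun i hi => ?_)⟩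
  · rw [Finset.sum_eq_zero, Finset.sum_eq_zero, add_zero]
    · intro i hi
      rw [Finset.mem_range] at hi
      exact (bracketPoly_term ha hb _ _ _).1 m (by omega) w hw
    · intro i hi
      rw [Finset.mem_range] at hi
      exact (bracketPoly_term ha hb _ _ _).1 m (by omega) w hw
  · rw [Finset.mem_range] at hi
    convert (bracketPoly_term ha hb i l (n - 1 - i)).2 w using 2
    omega
  · rw [Finset.mem_range] at hi
    convert (bracketPoly_term ha hb i (l - 1 - i) n).2 w using 2
    omega

end Series

/-! ### The vector fields `φ^a` and their brackets. -/

section Commutator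
set_option linter.unusedSectionVars false

variable {k 𝔤 : Type*} [Ring k] [AddCommGroup 𝔤] [Module k 𝔤] [Module kᵐᵒᵖ 𝔤]
  [SMulCommClass k kᵐᵒᵖ 𝔤] [Bracket 𝔤 𝔤]
  {𝓚 : ZMod 2 → AddSubgroup k} {𝓖 : ZMod 2 → AddSubgroup 𝔤}
  [GradedRing 𝓚] [CommSuperring 𝓚] [DirectSum.Decomposition 𝓖] [SuperModule 𝓚 𝓖]
  [LieSuperalgebra 𝓚 𝓖]

variable {p r : ZMod 2}

/-- Bridge from the definitions of `adGeneric` and `coderivation` to the calculus of `conv`. -/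
theorem pairing_comul_eq_conv {C : Type*} [AddCommGroup C] {B : SuperSym k 𝓖 →+ 𝔤 →+ C}
    (hB : IsBalanced B) {G : ParityHom 𝓖 𝓚 p 𝔤} (hG : IsHom 𝓚 p G.toFun) :
    (pairing B hB G).comp (comul 𝓖 𝓚).toAddMonoidHom = conv 𝓚 p B G.toFun :=
  AddMonoidHom.ext fun w => (conv_eq hB hG w).symm

theorem adGeneric_iterate_const (a : 𝓖 p) (n : ℕ) :
    (adGeneric^[n] (const 𝓚 a)).toFun = adIter 𝓚 p n (a : 𝔤) := by
  induction n with
  | zero => rfl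
  | succ n ih =>
    have hG : IsHom 𝓚 p (adGeneric^[n] (const 𝓚 a)).toFun := by rw [ih]; exact adIter_isHom a.2 n
    rw [Function.iterate_succ_apply', adIter_succ, ← ih]
    exact pairing_comul_eq_conv _ hG

variable (φ : PowerSeries (𝓚 0))

theorem seriesAd_apply (a : 𝓖 p) (w : SuperSym k 𝓖) :
    (seriesAd 𝓚 φ a).toFun w = (homogeneousComponents (k := k) 𝓖 w).sum fun n w =>
      ((PowerSeries.coeff n φ : 𝓚 0) : k) • adIter 𝓚 p n (a : 𝔤) w := by
  simp only [← adGeneric_iterate_const]; rfl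

theorem seriesAd_apply_of_mem (a : 𝓖 p) {n : ℕ} {w : SuperSym k 𝓖} (hw : w ∈ power k 𝓖 n) :
    (seriesAd 𝓚 φ a).toFun w =
      ((PowerSeries.coeff n φ : 𝓚 0) : k) • adIter 𝓚 p n (a : 𝔤) w := by
  rw [seriesAd_apply, homogeneousComponents_of_mem hw]
  exact Polynomial.sum_monomial_index w
    (fun n w => ((PowerSeries.coeff n φ : 𝓚 0) : k) • adIter 𝓚 p n (a : 𝔤) w) (by simp)

theorem seriesAd_isHom (a : 𝓖 p) : IsHom 𝓚 p (seriesAd 𝓚 φ a).toFun where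
  map_mem {i w} hw := by
    rw [seriesAd_apply, Polynomial.sum_def]
    refine sum_mem fun n _ => ?_
    rw [← zero_add (p + i)]
    exact left_smul_mem 𝓖 𝓚 (PowerSeries.coeff n φ : 𝓚 0).2
      ((adIter_isHom a.2 n).map_mem (coeff_homogeneousComponents_mem hw n))
  map_right w c := by
    change seriesAdPoly 𝓚 φ a (homogeneousComponents (k := k) 𝓖 (w * scalar k 𝓖 c)) =
      MulOpposite.op c • seriesAdPoly 𝓚 φ a (homogeneousComponents (k := k) 𝓖 w)
    rw [map_mul, homogeneousComponents_scalar]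
    induction homogeneousComponents (k := k) 𝓖 w using Polynomial.induction_on' with
    | add f g hf hg => rw [add_mul, map_add, hf, hg, map_add, smul_add]
    | monomial n w =>
      rw [Polynomial.monomial_mul_C, seriesAdPoly_monomial, seriesAdPoly_monomial,
        adGeneric_iterate_const, (adIter_isHom a.2 n).map_right, smul_comm]

/-- For homogeneous `a` the other parity component is zero and its whole series vanishes. -/
theorem coderivation_of_mem {a : 𝔤} (ha : a ∈ 𝓖 p) :
    coderivation 𝓚 𝓖 φ a = vectorField 𝓚 p (seriesAd 𝓚 φ (⟨a, ha⟩ : 𝓖 p)).toFun := by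
  rw [coderivation, Finset.sum_eq_single p]
  · rw [pairing_comul_eq_conv _ (seriesAd_isHom φ _), vectorField]
    congr 3
    exact Subtype.ext (DirectSum.decompose_of_mem_same 𝓖 ha)
  · intro q _ hq
    rw [pairing_comul_eq_conv _ (seriesAd_isHom φ _)]
    have h : (seriesAd 𝓚 φ (DirectSum.decompose 𝓖 a q)).toFun = 0 := by
      refine hom_ext_power 𝓚 fun n w hw => ?_
      rw [seriesAd_apply_of_mem φ _ hw, DirectSum.decompose_of_mem_ne 𝓖 ha hq.symm]
      have h0 : ∀ n, adIter (k := k) (𝓖 := 𝓖) 𝓚 q n 0 = 0 := by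
        intro n
        induction n with
        | zero => ext w; simp [adIter_zero, constHom_apply]
        | succ n ih => rw [adIter_succ, ih, adPoint_zero]
      simp [h0]
    rw [h]
    exact AddMonoidHom.ext conv_zero_right
  · simp

theorem adIter_add {a b : 𝔤} (ha : a ∈ 𝓖 p) (hb : b ∈ 𝓖 p) (n : ℕ) :
    adIter (k := k) (𝓖 := 𝓖) 𝓚 p n (a + b) = adIter 𝓚 p n a + adIter 𝓚 p n b := by
  induction n with
  | zero => ext w; simp [adIter_zero, constHom_apply]
  | succ n ih =>
    rw [adIter_succ, ih, adPoint_add (adIter_isHom ha n) (adIter_isHom hb n), adIter_succ,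
      adIter_succ]

theorem adIter_smul {i : ZMod 2} {c : k} (hc : c ∈ 𝓚 i) {a : 𝔤} (ha : a ∈ 𝓖 p) (n : ℕ) :
    adIter (k := k) (𝓖 := 𝓖) 𝓚 (i + p) n (c • a) = c • adIter 𝓚 p n a := by
  induction n with
  | zero =>
    ext w
    simp only [adIter_zero, constHom_apply, AddMonoidHom.smul_apply]
    exact (smul_comm _ _ _).symm
  | succ n ih => rw [adIter_succ, ih, adPoint_smul (adIter_isHom ha n) hc, adIter_succ]

/-- `a ↦ Φ^a` as an additive map. -/
theorem coderivation_add (a b : 𝔤) :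
    coderivation 𝓚 𝓖 φ (a + b) = coderivation 𝓚 𝓖 φ a + coderivation 𝓚 𝓖 φ b := by
  simp only [coderivation, ← Finset.sum_add_distrib]
  refine Finset.sum_congr rfl fun p _ => ?_
  rw [pairing_comul_eq_conv _ (seriesAd_isHom φ _), pairing_comul_eq_conv _ (seriesAd_isHom φ _),
    pairing_comul_eq_conv _ (seriesAd_isHom φ _)]
  have h : (seriesAd 𝓚 φ (DirectSum.decompose 𝓖 (a + b) p)).toFun =
      (seriesAd 𝓚 φ (DirectSum.decompose 𝓖 a p)).toFun +
        (seriesAd 𝓚 φ (DirectSum.decompose 𝓖 b p)).toFun := by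
    refine hom_ext_power 𝓚 fun n w hw => ?_
    rw [AddMonoidHom.add_apply, seriesAd_apply_of_mem φ _ hw, seriesAd_apply_of_mem φ _ hw,
      seriesAd_apply_of_mem φ _ hw, DirectSum.decompose_add, DirectSum.add_apply,
      AddSubgroup.coe_add, adIter_add (SetLike.coe_mem _) (SetLike.coe_mem _),
      AddMonoidHom.add_apply, smul_add]
  rw [h]
  exact AddMonoidHom.ext fun w => conv_add_right mulVec_isBalanced (seriesAd_isHom φ _)
    (seriesAd_isHom φ _) w

theorem coderivation_smul_of_mem {i : ZMod 2} {c : k} (hc : c ∈ 𝓚 i) {a : 𝔤} (ha : a ∈ 𝓖 p)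
    (w : SuperSym k 𝓖) :
    coderivation 𝓚 𝓖 φ (c • a) w = scalar k 𝓖 c * coderivation 𝓚 𝓖 φ a w := by
  have hca := left_smul_mem 𝓖 𝓚 hc ha
  rw [coderivation_of_mem φ hca, coderivation_of_mem φ ha,
    ← vectorField_smul (seriesAd_isHom φ _) hc]
  congr 2
  refine hom_ext_power 𝓚 fun n w hw => ?_
  rw [AddMonoidHom.smul_apply, seriesAd_apply_of_mem φ _ hw, seriesAd_apply_of_mem φ _ hw,
    adIter_smul hc ha, AddMonoidHom.smul_apply, smul_smul, smul_smul,
    CommSuperring.mul_comm_sign (PowerSeries.coeff n φ : 𝓚 0).2 hc, koszulSign_def,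
    koszulSign_zero_left, one_smul]

theorem vectorField_sum {ι : Type*} (s : Finset ι) {F : ι → SuperSym k 𝓖 →+ 𝔤}
    (hF : ∀ i, IsHom 𝓚 p (F i)) (w : SuperSym k 𝓖) :
    vectorField 𝓚 p (∑ i ∈ s, F i) w = ∑ i ∈ s, vectorField 𝓚 p (F i) w := by
  induction s using Finset.cons_induction with
  | empty => exact vectorField_zero w
  | cons i s hi ih =>
    rw [Finset.sum_cons, Finset.sum_cons, vectorField_add (hF i) (IsHom.sum fun i _ => hF i), ih]

/-- Since `(ad x)^n(a)` lives in degree `n` only, the series may be cut off anywhere above the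
degree of its argument. -/
theorem seriesAd_eq_sum (a : 𝓖 p) {m M : ℕ} (h : m < M) {w : SuperSym k 𝓖}
    (hw : w ∈ powerLE k 𝓖 m) : (seriesAd 𝓚 φ a).toFun w = ∑ n ∈ Finset.range M,
      ((PowerSeries.coeff n φ : 𝓚 0) : k) • adIter 𝓚 p n (a : 𝔤) w := by
  induction hw using AddSubgroup.closure_induction with
  | mem w hw =>
    obtain ⟨l, hl, hw⟩ := hw
    rw [seriesAd_apply_of_mem φ a hw, Finset.sum_eq_single l]
    · intro n _ hn; rw [adIter_eq_zero_of_power a.2 hn.symm hw, smul_zero]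
    · intro hl'; exact absurd (Finset.mem_range.2 (by omega)) hl'
  | zero => simp
  | add w z _ _ h1 h2 => simp only [map_add, smul_add, Finset.sum_add_distrib, h1, h2]
  | neg w _ h => simp only [map_neg, smul_neg, Finset.sum_neg_distrib, h]

theorem coeff_smul_isHom (a : 𝓖 p) (c : 𝓚 0) (n : ℕ) :
    IsHom 𝓚 p ((c : k) • adIter (k := k) (𝓖 := 𝓖) 𝓚 p n (a : 𝔤)) := by
  have := (adIter_isHom (k := k) (𝓚 := 𝓚) a.2 n).smul c.2
  rwa [zero_add] at this

theorem vectorField_seriesAd_eq_sum (a : 𝓖 p) {m M : ℕ} (h : m < M) {w : SuperSym k 𝓖}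
    (hw : w ∈ power k 𝓖 m) : vectorField 𝓚 p (seriesAd 𝓚 φ a).toFun w = ∑ n ∈ Finset.range M,
      scalar k 𝓖 ((PowerSeries.coeff n φ : 𝓚 0) : k) *
        vectorField 𝓚 p (adIter 𝓚 p n (a : 𝔤)) w := by
  have h1 : ∀ n, IsHom 𝓚 p (((PowerSeries.coeff n φ : 𝓚 0) : k) •
      adIter (k := k) (𝓖 := 𝓖) 𝓚 p n (a : 𝔤)) := fun n => coeff_smul_isHom a _ n
  rw [vectorField_congr_of_power (seriesAd_isHom φ a) (G := ∑ n ∈ Finset.range M,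
    ((PowerSeries.coeff n φ : 𝓚 0) : k) • adIter 𝓚 p n (a : 𝔤)) (IsHom.sum fun n _ => h1 n)
    (fun j hj w hw => ?_) hw, vectorField_sum _ h1]
  · refine Finset.sum_congr rfl fun n _ => ?_
    have := vectorField_smul (adIter_isHom (k := k) (𝓚 := 𝓚) a.2 n)
      (PowerSeries.coeff n φ : 𝓚 0).2 w
    rwa [zero_add] at this
  · rw [seriesAd_eq_sum φ a (by omega) (power_le_powerLE hj hw), AddMonoidHom.finsetSum_apply]
    rfl

theorem seriesAd_vectorField_seriesAd (a : 𝓖 p) (b : 𝓖 r) {L : ℕ} {w : SuperSym k 𝓖}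
    (hw : w ∈ power k 𝓖 L) :
    (seriesAd 𝓚 φ a).toFun (vectorField 𝓚 r (seriesAd 𝓚 φ b).toFun w) =
      ∑ l ∈ Finset.range (L + 2), ∑ n ∈ Finset.range (L + 2),
        ((PowerSeries.coeff l φ * PowerSeries.coeff n φ : 𝓚 0) : k) •
          adIter 𝓚 p n (a : 𝔤) (vectorField 𝓚 r (adIter 𝓚 r l (b : 𝔤)) w) := by
  -- A coderivation raises the degree by at most one, so the outer series is evaluated in degrees up
  -- to `L + 1`. The cut-off `L + 2` serves both sums.
  rw [seriesAd_eq_sum φ a (Nat.lt_succ_self (L + 1))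
    (vec_mul_sub_vectorField_mem (seriesAd_isHom φ b) hw).2,
    vectorField_seriesAd_eq_sum φ b (by omega : L < L + 2) hw, Finset.sum_comm]
  refine Finset.sum_congr rfl fun n _ => ?_
  rw [map_sum, Finset.smul_sum]
  refine Finset.sum_congr rfl fun l _ => ?_
  rw [(adIter_isHom a.2 n).map_left _ (PowerSeries.coeff l φ : 𝓚 0).2, koszulSign_zero_right,
    one_smul, smul_smul, mul_comm (PowerSeries.coeff l φ : 𝓚 0)]
  rfl

/-- The condition under which the functional equation of `t/(e^t - 1)` may be used. -/
def HasBernoulli (𝓚 : ZMod 2 → AddSubgroup k) [GradedRing 𝓚] (𝓖 : ZMod 2 → AddSubgroup 𝔤) : Prop :=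
  ∀ L : ℕ, (∀ n ≤ L + 1, IsUnit (((n + 1).factorial : ℕ) : 𝓚 0)) ∨ lowerCentral 𝓖 (L + 1) = ⊥

/-- If the factorials are invertible, this is the degree `L` component of the functional equation,
carried over by the linear map `bracketPoly`. Otherwise both sides take values in `lowerCentral 𝓖 (L
+ 1)`, which is zero. -/
theorem bernoulli_bracketPoly (h : HasBernoulli 𝓚 𝓖) {a b : 𝔤} (ha : a ∈ 𝓖 p) (hb : b ∈ 𝓖 r)
    (L : ℕ) (w : SuperSym k 𝓖) :
    ∑ x ∈ Finset.HasAntidiagonal.antidiagonal (L + 1),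
      ((PowerSeries.coeff x.1 (bernoulliSeries (𝓚 0)) *
        PowerSeries.coeff x.2 (bernoulliSeries (𝓚 0)) : 𝓚 0) : k) •
        bracketPoly (𝓖 := 𝓖) 𝓚 p r a b
          (commPoly (MvPolynomial.X 0) (MvPolynomial.X 1) x.1 x.2) w =
      -(((PowerSeries.coeff L (bernoulliSeries (𝓚 0)) : 𝓚 0) : k) • bracketPoly (𝓖 := 𝓖) 𝓚 p r a b
        ((MvPolynomial.X 0 + MvPolynomial.X 1) ^ L) w) := by
  rcases h L with h | h
  · set c : ℕ → 𝓚 0 := fun n => PowerSeries.coeff n (bernoulliSeries (𝓚 0)) with hc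
    -- The variables are regular over any coefficient ring, so the division by `st` in the
    -- functional equation is harmless; this is the point of working with indeterminates.
    have hreg : IsLeftRegular (MvPolynomial.X 0 * MvPolynomial.X 1 : MvPolynomial (Fin 2) (𝓚 0)) :=
      (MvPolynomial.isRegular_X.mul MvPolynomial.isRegular_X).left
    have key := PowerSeries.bernoulli_functional_equation (d := L)
      (f := PowerSeries.map (MvPolynomial.C (σ := Fin 2)) (bernoulliSeries (𝓚 0)))
      (g := PowerSeries.map (MvPolynomial.C (σ := Fin 2))
        (PowerSeries.mk fun n => Ring.inverse ((Nat.factorial (n + 1) : ℕ) : 𝓚 0)))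
      (by rw [← map_mul, bernoulliSeries_mul, map_one])
      (fun n hn => by
        rw [PowerSeries.coeff_map, PowerSeries.coeff_mk, ← map_natCast MvPolynomial.C, ← map_mul,
          Ring.inverse_mul_cancel _ (h n hn), map_one]) hreg
    have key' : ∑ x ∈ Finset.HasAntidiagonal.antidiagonal (L + 1), (c x.1 * c x.2) •
        commPoly (MvPolynomial.X 0 : MvPolynomial (Fin 2) (𝓚 0)) (MvPolynomial.X 1) x.1 x.2 =
        -(c L • (MvPolynomial.X 0 + MvPolynomial.X 1) ^ L) := by
      rw [PowerSeries.coeff_map, ← MvPolynomial.smul_eq_C_mul] at key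
      rw [← key]
      refine Finset.sum_congr rfl fun x _ => ?_
      rw [PowerSeries.coeff_map, PowerSeries.coeff_map, ← map_mul, ← MvPolynomial.smul_eq_C_mul]
      rfl
    have key'' := DFunLike.congr_fun (congrArg (bracketPoly (𝓖 := 𝓖) 𝓚 p r a b) key') w
    rw [map_sum, map_neg, map_smul, AddMonoidHom.finsetSum_apply, AddMonoidHom.neg_apply] at key''
    refine Eq.trans (Finset.sum_congr rfl fun x _ => ?_) key''
    rw [map_smul]
    rfl
  · have h1 : ∀ x ∈ Finset.HasAntidiagonal.antidiagonal (L + 1), bracketPoly (𝓖 := 𝓖) 𝓚 p r a b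
        (commPoly (MvPolynomial.X 0) (MvPolynomial.X 1) x.1 x.2) w = 0 := by
      intro x hx
      have := (bracketPoly_commPoly (𝓚 := 𝓚) ha hb x.1 x.2).2 w
      rwa [Finset.HasAntidiagonal.mem_antidiagonal.1 hx, h, AddSubgroup.mem_bot] at this
    have h2 := (bracketPoly_term (𝓚 := 𝓚) ha hb L 0 0).2 w
    rw [pow_zero, pow_zero, mul_one, mul_one, add_zero, add_zero, h, AddSubgroup.mem_bot] at h2
    rw [h2, smul_zero, neg_zero]
    exact Finset.sum_eq_zero fun x hx => by rw [h1 x hx, smul_zero]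

/-- The polynomial `1` stands for the constant `[b, a]`, and each factor `s + t` for one `ad x`;
skew-symmetry turns `[b, a]` into `[a, b]`. -/
theorem bracketPoly_pow {a b : 𝔤} (ha : a ∈ 𝓖 p) (hb : b ∈ 𝓖 r) (L : ℕ) :
    bracketPoly (𝓖 := 𝓖) 𝓚 p r a b ((MvPolynomial.X 0 + MvPolynomial.X 1) ^ L) =
      -(koszulSign p r • adIter 𝓚 (p + r) L ⁅a, b⁆) := by
  have h := adPoint_iterate_bracketPoly (𝓚 := 𝓚) ha hb L 1
  rw [mul_one] at h
  -- The sign is written as an even scalar of `k`, so that the linearity of `(ad x)^L` in its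
  -- argument applies.
  have hskew : ⁅b, a⁆ = (((-(koszulSign p r : ℤ) : ℤ) : k)) • ⁅a, b⁆ := by
    rw [Int.cast_smul_eq_zsmul, neg_smul, ← Units.smul_def, koszulSign_comm]
    exact lie_skew 𝓚 hb ha
  have hsmul := adIter_smul (𝓚 := 𝓚) (SetLike.intCast_mem_graded 𝓚 (-(koszulSign p r : ℤ)))
    (lie_mem 𝓚 ha hb) L
  rw [← hskew, zero_add, Int.cast_smul_eq_zsmul, neg_smul, ← Units.smul_def] at hsmul
  rw [← hsmul, ← h, adIter]
  congr 1
  have h0 := bracketPoly_X_pow (𝓚 := 𝓚) (𝓖 := 𝓖) (p := p) (r := r) a b 0 0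
  rw [pow_zero, pow_zero, mul_one] at h0
  rw [h0, adIter_zero, adIter_zero, convBracket_constHom hb (constHom_isHom ha)]
  ext w
  rw [lieComp_apply, constHom_apply, bracketHom_right_smul]
  rfl

/-- The central identity: `a ↦ φ^a` respects brackets of vector fields. On `S^L` both composites
become double sums over `(l, n)`, their difference is a sum of terms `commPoly`, and the functional
equation evaluates the part with `l + n = L + 1`. -/
theorem seriesAd_bracket (h : HasBernoulli 𝓚 𝓖) (a : 𝓖 p) (b : 𝓖 r) :
    (seriesAd 𝓚 (bernoulliSeries (𝓚 0)) a).toFun.comp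
        (vectorField 𝓚 r (seriesAd 𝓚 (bernoulliSeries (𝓚 0)) b).toFun) -
      koszulSign p r • (seriesAd 𝓚 (bernoulliSeries (𝓚 0)) b).toFun.comp
        (vectorField 𝓚 p (seriesAd 𝓚 (bernoulliSeries (𝓚 0)) a).toFun) =
    (seriesAd 𝓚 (bernoulliSeries (𝓚 0))
      (⟨⁅(a : 𝔤), (b : 𝔤)⁆, lie_mem 𝓚 a.2 b.2⟩ : 𝓖 (p + r))).toFun := by
  set c : ℕ → 𝓚 0 := fun n => PowerSeries.coeff n (bernoulliSeries (𝓚 0)) with hc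
  refine hom_ext_power 𝓚 fun L w hw => ?_
  rw [AddMonoidHom.sub_apply, AddMonoidHom.smul_apply, AddMonoidHom.comp_apply,
    AddMonoidHom.comp_apply, seriesAd_vectorField_seriesAd _ a b hw,
    seriesAd_vectorField_seriesAd _ b a hw, seriesAd_apply_of_mem _ _ hw]
  have hterm : ∀ l n, ((c l * c n : 𝓚 0) : k) •
        adIter 𝓚 p n (a : 𝔤) (vectorField 𝓚 r (adIter 𝓚 r l (b : 𝔤)) w) -
      koszulSign p r • (((c n * c l : 𝓚 0) : k) •
        adIter 𝓚 r l (b : 𝔤) (vectorField 𝓚 p (adIter 𝓚 p n (a : 𝔤)) w)) =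
      koszulSign p r • (((c l * c n : 𝓚 0) : k) • bracketPoly (𝓖 := 𝓖) 𝓚 p r (a : 𝔤) (b : 𝔤)
          (commPoly (MvPolynomial.X 0) (MvPolynomial.X 1) l n) w) := by
    intro l n
    have h := DFunLike.congr_fun (adIter_comp_adIter (𝓚 := 𝓚) a.2 b.2 l n) w
    rw [AddMonoidHom.sub_apply, AddMonoidHom.smul_apply, AddMonoidHom.comp_apply,
      AddMonoidHom.comp_apply, AddMonoidHom.smul_apply] at h
    rw [mul_comm (c n), ← units_smul_smul, ← smul_sub, h, units_smul_smul]
  have hsum : ∑ l ∈ Finset.range (L + 2), ∑ n ∈ Finset.range (L + 2), ((c l * c n : 𝓚 0) : k) •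
        adIter 𝓚 p n (a : 𝔤) (vectorField 𝓚 r (adIter 𝓚 r l (b : 𝔤)) w) -
      koszulSign p r • ∑ n ∈ Finset.range (L + 2), ∑ l ∈ Finset.range (L + 2),
        ((c n * c l : 𝓚 0) : k) •
        adIter 𝓚 r l (b : 𝔤) (vectorField 𝓚 p (adIter 𝓚 p n (a : 𝔤)) w) =
      koszulSign p r • ∑ x ∈ Finset.range (L + 2) ×ˢ Finset.range (L + 2),
        (((c x.1 * c x.2 : 𝓚 0) : k) • bracketPoly (𝓖 := 𝓖) 𝓚 p r (a : 𝔤) (b : 𝔤)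
          (commPoly (MvPolynomial.X 0) (MvPolynomial.X 1) x.1 x.2) w) := by
    rw [Finset.sum_comm (s := Finset.range (L + 2)) (t := Finset.range (L + 2))
      (f := fun n l => ((c n * c l : 𝓚 0) : k) •
        adIter 𝓚 r l (b : 𝔤) (vectorField 𝓚 p (adIter 𝓚 p n (a : 𝔤)) w)), Finset.smul_sum,
      ← Finset.sum_sub_distrib, Finset.sum_product, Finset.smul_sum]
    refine Finset.sum_congr rfl fun l _ => ?_
    rw [Finset.smul_sum, ← Finset.sum_sub_distrib, Finset.smul_sum]
    exact Finset.sum_congr rfl fun n _ => hterm l n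
  refine hsum.trans ?_
  -- Outside this antidiagonal the terms have the wrong degree and vanish on `S^L`.
  have hsub : Finset.HasAntidiagonal.antidiagonal (L + 1) ⊆
      Finset.range (L + 2) ×ˢ Finset.range (L + 2) := by
    intro x hx
    rw [Finset.HasAntidiagonal.mem_antidiagonal] at hx
    rw [Finset.mem_product, Finset.mem_range, Finset.mem_range]
    omega
  rw [← Finset.sum_subset hsub, bernoulli_bracketPoly h a.2 b.2, bracketPoly_pow a.2 b.2]
  · rw [AddMonoidHom.neg_apply, AddMonoidHom.smul_apply, smul_neg, smul_neg, smul_neg, neg_neg, units_smul_smul,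
      smul_smul, koszulSign_mul_self, one_smul]
  · intro x _ hx
    rw [Finset.HasAntidiagonal.mem_antidiagonal] at hx
    rw [(bracketPoly_commPoly (𝓚 := 𝓚) a.2 b.2 x.1 x.2).1 L hx w hw, smul_zero]

end Commutator
end SuperSym

/-! ### The enveloping superalgebra: universal property, parity and filtration. -/

namespace SuperEnv

section Basic
set_option linter.unusedSectionVars false

variable {k 𝔤 : Type*} [Ring k] [AddCommGroup 𝔤] [Module k 𝔤] [Module kᵐᵒᵖ 𝔤]
  [Bracket 𝔤 𝔤] {𝓖 : ZMod 2 → AddSubgroup 𝔤}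

/-- The universal property of `U(𝔤)`. -/
def lift {R : Type*} [Ring R] (f : k →+* R) (h : 𝔤 →+ R)
    (hl : ∀ a x, h (a • x) = f a * h x) (hr : ∀ a x, h (MulOpposite.op a • x) = h x * f a)
    (hc : ∀ (i j : ZMod 2) (x y : 𝔤), x ∈ 𝓖 i → y ∈ 𝓖 j →
      h x * h y = koszulSign i j • (h y * h x) + h ⁅x, y⁆) :
    SuperEnv k 𝓖 →+* R :=
  RingQuot.lift ⟨SuperTensor.lift f h hl hr, by
    rintro _ _ ⟨hx, hy⟩
    rw [map_add, units_smul_map]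
    simp only [map_mul, SuperTensor.lift_vec, hc _ _ _ _ hx hy, koszulSign_def]⟩

section
variable {R : Type*} [Ring R] (f : k →+* R) (h : 𝔤 →+ R)
    (hl : ∀ a x, h (a • x) = f a * h x) (hr : ∀ a x, h (MulOpposite.op a • x) = h x * f a)
    (hc : ∀ (i j : ZMod 2) (x y : 𝔤), x ∈ 𝓖 i → y ∈ 𝓖 j →
      h x * h y = koszulSign i j • (h y * h x) + h ⁅x, y⁆)

theorem lift_scalar (a : k) : lift f h hl hr hc (scalar k 𝓖 a) = f a := by
  change RingQuot.lift _ (RingQuot.mkRingHom (Rel k 𝓖) _) = _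
  rw [RingQuot.lift_mkRingHom_apply, SuperTensor.lift_scalar]

theorem lift_vec (x : 𝔤) : lift f h hl hr hc (vec k 𝓖 x) = h x := by
  change RingQuot.lift _ (RingQuot.mkRingHom (Rel k 𝓖) _) = _
  rw [RingQuot.lift_mkRingHom_apply, SuperTensor.lift_vec]
end

theorem hom_ext {R : Type*} [Ring R] {f g : SuperEnv k 𝓖 →+* R}
    (h1 : ∀ a, f (scalar k 𝓖 a) = g (scalar k 𝓖 a)) (h2 : ∀ x, f (vec k 𝓖 x) = g (vec k 𝓖 x)) :
    f = g :=
  RingQuot.ringQuot_ext (r := Rel k 𝓖) f g (SuperTensor.hom_ext h1 h2)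

theorem vec_left (a : k) (x : 𝔤) : vec k 𝓖 (a • x) = scalar k 𝓖 a * vec k 𝓖 x :=
  (congrArg (mk k 𝓖) (SuperTensor.vec_left a x)).trans (map_mul _ _ _)

theorem vec_right (a : k) (x : 𝔤) :
    vec k 𝓖 (MulOpposite.op a • x) = vec k 𝓖 x * scalar k 𝓖 a :=
  (congrArg (mk k 𝓖) (SuperTensor.vec_right a x)).trans (map_mul _ _ _)

theorem vec_mul_vec {i j : ZMod 2} {x y : 𝔤} (hx : x ∈ 𝓖 i) (hy : y ∈ 𝓖 j) :
    vec k 𝓖 x * vec k 𝓖 y = koszulSign i j • (vec k 𝓖 y * vec k 𝓖 x) + vec k 𝓖 ⁅x, y⁆ := by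
  have h := RingQuot.mkRingHom_rel (Rel.comm (k := k) hx hy)
  rw [map_mul, map_add, units_smul_map, map_mul] at h
  exact h

variable {𝓚 : ZMod 2 → AddSubgroup k}

theorem scalar_mem_part {i : ZMod 2} {a : k} (ha : a ∈ 𝓚 i) : scalar k 𝓖 a ∈ part 𝓖 𝓚 i :=
  Submodule.subset_span (ParityWord.scalar ha)

theorem vec_mem_part {i : ZMod 2} {x : 𝔤} (hx : x ∈ 𝓖 i) : vec k 𝓖 x ∈ part 𝓖 𝓚 i :=
  Submodule.subset_span (ParityWord.vec hx)

variable [GradedRing 𝓚]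

instance : SetLike.GradedMonoid (part 𝓖 𝓚) where
  one_mem := by
    rw [← map_one (scalar k 𝓖)]
    exact scalar_mem_part SetLike.GradedOne.one_mem
  mul_mem i j w z hw hz := by
    induction hw, hz using Submodule.span_induction₂ with
    | mem_mem x y hx hy => exact Submodule.subset_span (ParityWord.mul hx hy)
    | zero_left y hy => rw [zero_mul]; exact zero_mem _
    | zero_right y hy => rw [mul_zero]; exact zero_mem _
    | add_left x y z _ _ _ h1 h2 => rw [add_mul]; exact add_mem h1 h2
    | add_right x y z _ _ _ h1 h2 => rw [mul_add]; exact add_mem h1 h2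
    | smul_left r x y _ _ h => rw [smul_mul_assoc]; exact Submodule.smul_mem _ _ h
    | smul_right r x y _ _ h => rw [mul_smul_comm]; exact Submodule.smul_mem _ _ h

variable [CommSuperring 𝓚] [DirectSum.Decomposition 𝓖] [SuperModule 𝓚 𝓖]

theorem scalar_comm {i j : ZMod 2} {a : k} {w : SuperEnv k 𝓖} (ha : a ∈ 𝓚 i)
    (hw : w ∈ part 𝓖 𝓚 j) :
    scalar k 𝓖 a * w = koszulSign i j • (w * scalar k 𝓖 a) := by
  induction hw using Submodule.span_induction with
  | mem w hw =>
    induction hw with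
    | scalar hb =>
      rw [← map_mul, CommSuperring.mul_comm_sign ha hb, units_smul_map, map_mul, koszulSign_def]
    | @vec j x hx =>
      rw [← vec_left, SuperModule.left_smul ha hx, units_smul_map, vec_right, koszulSign_def]
    | @mul j l w z hw hz h1 h2 =>
      rw [← mul_assoc, h1, smul_mul_assoc, mul_assoc, h2, mul_smul_comm, smul_smul, mul_assoc,
        koszulSign_add_right]
  | zero => simp
  | add x y _ _ h1 h2 => rw [mul_add, h1, h2, add_mul, smul_add]
  | smul r x _ h => rw [mul_smul_comm, h, smul_mul_assoc, smul_comm]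

/-- Induction on homogeneous elements of `U(𝔤)`. -/
theorem part_induction {P : ZMod 2 → SuperEnv k 𝓖 → Prop} (zero : ∀ i, P i 0)
    (add : ∀ i w z, P i w → P i z → P i (w + z)) (one : P 0 1)
    (vec_mul : ∀ (q j : ZMod 2) (X : 𝔤) (w : SuperEnv k 𝓖), X ∈ 𝓖 q → w ∈ part 𝓖 𝓚 j →
      P j w → P (q + j) (vec k 𝓖 X * w))
    (mul_scalar : ∀ (i j : ZMod 2) (a : k) (w : SuperEnv k 𝓖), a ∈ 𝓚 i → w ∈ part 𝓖 𝓚 j →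
      P j w → P (j + i) (w * scalar k 𝓖 a))
    {i : ZMod 2} {w : SuperEnv k 𝓖} (hw : w ∈ part 𝓖 𝓚 i) : P i w := by
  have zsmul : ∀ (n : ℤ) (i : ZMod 2) (w : SuperEnv k 𝓖), w ∈ part 𝓖 𝓚 i → P i w →
      P i (n • w) := by
    intro n i w hw h
    have hn : ((n : ℤ) : k) ∈ 𝓚 0 := SetLike.intCast_mem_graded 𝓚 n
    have := mul_scalar 0 i n w hn hw h
    rw [map_intCast, add_zero] at this
    rwa [zsmul_eq_mul, Int.cast_comm]
  have key : ∀ (i : ZMod 2) (z : SuperEnv k 𝓖),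
      ParityWord 𝓚 𝓖 (scalar k 𝓖) (vec k 𝓖) i z →
      ∀ j y, y ∈ part 𝓖 𝓚 j → P j y → P (i + j) (z * y) := by
    intro i z hz
    induction hz with
    | @scalar i a ha =>
      intro j y hy h
      rw [scalar_comm ha hy, Units.smul_def, add_comm]
      exact zsmul _ _ _ (SetLike.GradedMul.mul_mem hy (scalar_mem_part ha))
        (mul_scalar _ _ _ _ ha hy h)
    | vec hx => intro j y hy h; exact vec_mul _ _ _ _ hx hy h
    | @mul i j w z hw hz h1 h2 =>
      intro l y hy h
      rw [mul_assoc, add_assoc]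
      exact h1 _ _ (SetLike.GradedMul.mul_mem (Submodule.subset_span hz) hy) (h2 _ _ hy h)
  have one0 : (1 : SuperEnv k 𝓖) ∈ part 𝓖 𝓚 0 := SetLike.GradedOne.one_mem
  induction hw using Submodule.span_induction with
  | mem w hw => simpa using key _ w hw 0 1 one0 one
  | zero => exact zero _
  | add x y hx hy h1 h2 => exact add _ _ _ h1 h2
  | smul r x hx h => exact zsmul _ _ _ hx h

variable (𝓚) in
/-- Every element of `U(𝔤)` is a sum of homogeneous elements. -/
theorem homogeneous_induction {P : SuperEnv k 𝓖 → Prop} (zero : P 0)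
    (add : ∀ w z, P w → P z → P (w + z)) (homogeneous : ∀ i, ∀ w ∈ part 𝓖 𝓚 i, P w)
    (w : SuperEnv k 𝓖) : P w := by
  -- The sum of the parity parts is closed under products and contains the generators together with
  -- `-1`, so it is everything. Directness of the sum is not needed.
  let T : AddSubmonoid (SuperEnv k 𝓖) := ⨆ i, (part 𝓖 𝓚 i).toAddSubmonoid
  have hT : ∀ {i} {w : SuperEnv k 𝓖}, w ∈ part 𝓖 𝓚 i → w ∈ T := fun {i w} hw =>
    AddSubmonoid.mem_iSup_of_mem i hw
  have hmul : ∀ u ∈ T, ∀ v ∈ T, u * v ∈ T := by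
    intro u hu v hv
    induction hu using AddSubmonoid.iSup_induction' with
    | mem i u hu =>
      induction hv using AddSubmonoid.iSup_induction' with
      | mem j v hv => exact hT (SetLike.GradedMul.mul_mem (A := part 𝓖 𝓚) hu hv)
      | zero => rw [mul_zero]; exact zero_mem _
      | add x y _ _ hx hy => rw [mul_add]; exact add_mem hx hy
    | zero => rw [zero_mul]; exact zero_mem _
    | add x y _ _ hx hy => rw [add_mul]; exact add_mem hx hy
  have hone : (1 : SuperEnv k 𝓖) ∈ T :=
    hT (SetLike.GradedOne.one_mem (A := part 𝓖 𝓚))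
  let R : Subsemiring (SuperEnv k 𝓖) :=
    { T with
      mul_mem' := fun hu hv => hmul _ hu _ hv
      one_mem' := hone }
  have hs : ∀ a : k, scalar k 𝓖 a ∈ T := by
    intro a
    induction a using DirectSum.Decomposition.inductionOn 𝓚 with
    | zero => rw [map_zero]; exact zero_mem _
    | add a b ha hb => rw [map_add]; exact add_mem ha hb
    | homogeneous a => exact hT (scalar_mem_part a.2)
  have hv : ∀ x : 𝔤, vec k 𝓖 x ∈ T := by
    intro x
    induction x using DirectSum.Decomposition.inductionOn 𝓖 with
    | zero => rw [map_zero]; exact zero_mem _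
    | add a b ha hb => rw [map_add]; exact add_mem ha hb
    | homogeneous a => exact hT (vec_mem_part a.2)
  have hw : w ∈ T := by
    obtain ⟨t, rfl⟩ : ∃ t, mk k 𝓖 t = w := RingQuot.mkRingHom_surjective (Rel k 𝓖) w
    obtain ⟨t, rfl⟩ := RingQuot.mkRingHom_surjective (SuperTensor.Rel k 𝔤) t
    induction t using FreeRing.induction_on with
    | hn1 =>
      have h1 : (-1 : SuperEnv k 𝓖) ∈ T := by simpa using hs (-1)
      rw [map_neg, map_one]
      exact (congrArg (· ∈ T) ((map_neg (mk k 𝓖) 1).trans (congrArg _ (map_one _)))).mpr h1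
    | hb x =>
      rcases x with a | x
      · exact hs a
      · exact hv x
    | ha x y hx hy =>
      rw [map_add]
      exact (congrArg (· ∈ T) (map_add (mk k 𝓖) _ _)).mpr (add_mem hx hy)
    | hm x y hx hy =>
      rw [map_mul]
      exact (congrArg (· ∈ T) (map_mul (mk k 𝓖) _ _)).mpr (hmul _ hx _ hy)
  induction hw using AddSubmonoid.iSup_induction' with
  | mem i u hu => exact homogeneous i u hu
  | zero => exact zero
  | add x y _ _ hx hy => exact add _ _ hx hy

variable (𝓚) in
/-- Every element of `U(𝔤)` is obtained from `1` by sums, left multiplications by homogeneous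
elements of `𝔤` and right multiplications by scalars. -/
theorem induction_vec_mul {P : SuperEnv k 𝓖 → Prop}
    (add : ∀ w z, P w → P z → P (w + z)) (one : P 1)
    (vec_mul : ∀ (q : ZMod 2) (X : 𝔤) (w : SuperEnv k 𝓖), X ∈ 𝓖 q → P w → P (vec k 𝓖 X * w))
    (mul_scalar : ∀ (i : ZMod 2) (a : k) (w : SuperEnv k 𝓖), a ∈ 𝓚 i → P w →
      P (w * scalar k 𝓖 a))
    (w : SuperEnv k 𝓖) : P w := by
  have zero : P 0 := by simpa using mul_scalar 0 0 1 (zero_mem _) one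
  exact homogeneous_induction 𝓚 zero add (fun _ _ hw =>
    part_induction (P := fun _ w => P w) (fun _ => zero) (fun _ => add) one
      (fun q _ X w hX _ => vec_mul q X w hX) (fun i _ a w ha _ => mul_scalar i a w ha) hw) w

end Basic

section Filtration
set_option linter.unusedSectionVars false

variable {k 𝔤 : Type*} [Ring k] [AddCommGroup 𝔤] [Module k 𝔤] [Module kᵐᵒᵖ 𝔤]
  [Bracket 𝔤 𝔤] {𝓖 : ZMod 2 → AddSubgroup 𝔤}

theorem prod_mem_filtration {l : List 𝔤} {n : ℕ} (h : l.length ≤ n) :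
    (l.map (vec k 𝓖)).prod ∈ filtration k 𝓖 n :=
  AddSubgroup.subset_closure ⟨l, 1, h, by rw [map_one, mul_one]⟩

theorem one_mem_filtration : (1 : SuperEnv k 𝓖) ∈ filtration k 𝓖 0 :=
  prod_mem_filtration (l := []) le_rfl

theorem vec_mem_filtration (X : 𝔤) : vec k 𝓖 X ∈ filtration k 𝓖 1 := by
  simpa using prod_mem_filtration (k := k) (𝓖 := 𝓖) (l := [X]) (n := 1) le_rfl

theorem filtration_mono {m n : ℕ} (h : m ≤ n) : filtration k 𝓖 m ≤ filtration k 𝓖 n :=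
  AddSubgroup.closure_mono fun _ ⟨l, a, hl, hu⟩ => ⟨l, a, hl.trans h, hu⟩

theorem mul_scalar_mem_filtration (a : k) {n : ℕ} {u : SuperEnv k 𝓖}
    (hu : u ∈ filtration k 𝓖 n) : u * scalar k 𝓖 a ∈ filtration k 𝓖 n := by
  induction hu using AddSubgroup.closure_induction with
  | mem u hu =>
    obtain ⟨l, b, hl, rfl⟩ := hu
    exact AddSubgroup.subset_closure ⟨l, b * a, hl, by rw [map_mul, mul_assoc]⟩
  | zero => rw [zero_mul]; exact zero_mem _
  | add x y _ _ hx hy => rw [add_mul]; exact add_mem hx hy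
  | neg x _ hx => rw [neg_mul]; exact neg_mem hx

theorem vec_mul_mem_filtration (X : 𝔤) {n : ℕ} {u : SuperEnv k 𝓖}
    (hu : u ∈ filtration k 𝓖 n) : vec k 𝓖 X * u ∈ filtration k 𝓖 (n + 1) := by
  induction hu using AddSubgroup.closure_induction with
  | mem u hu =>
    obtain ⟨l, b, hl, rfl⟩ := hu
    exact AddSubgroup.subset_closure ⟨X :: l, b, by simpa using hl, by
      rw [List.map_cons, List.prod_cons, mul_assoc]⟩
  | zero => rw [mul_zero]; exact zero_mem _
  | add x y _ _ hx hy => rw [mul_add]; exact add_mem hx hy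
  | neg x _ hx => rw [mul_neg]; exact neg_mem hx

theorem scalar_mul_mem_filtration (a : k) {n : ℕ} {u : SuperEnv k 𝓖}
    (hu : u ∈ filtration k 𝓖 n) : scalar k 𝓖 a * u ∈ filtration k 𝓖 n := by
  -- The scalar is absorbed by the first letter of the word, through `j(aX) = a j(X)`; for the empty
  -- word it already stands on the right.
  have key : ∀ (l : List 𝔤) (a : k), scalar k 𝓖 a * (l.map (vec k 𝓖)).prod ∈
      filtration k 𝓖 l.length := by
    intro l
    cases l with
    | nil =>
      intro a
      exact AddSubgroup.subset_closure ⟨[], a, le_rfl, by simp⟩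
    | cons X l =>
      intro a
      rw [List.map_cons, List.prod_cons, ← mul_assoc, ← vec_left]
      exact vec_mul_mem_filtration _ (prod_mem_filtration le_rfl)
  induction hu using AddSubgroup.closure_induction with
  | mem u hu =>
    obtain ⟨l, b, hl, rfl⟩ := hu
    rw [← mul_assoc]
    exact mul_scalar_mem_filtration b (filtration_mono hl (key l a))
  | zero => rw [mul_zero]; exact zero_mem _
  | add x y _ _ hx hy => rw [mul_add]; exact add_mem hx hy
  | neg x _ hx => rw [mul_neg]; exact neg_mem hx

theorem mul_mem_filtration {m n : ℕ} {u v : SuperEnv k 𝓖} (hu : u ∈ filtration k 𝓖 m)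
    (hv : v ∈ filtration k 𝓖 n) : u * v ∈ filtration k 𝓖 (m + n) := by
  have key : ∀ (l : List 𝔤) (v : SuperEnv k 𝓖), v ∈ filtration k 𝓖 n →
      (l.map (vec k 𝓖)).prod * v ∈ filtration k 𝓖 (l.length + n) := by
    intro l
    induction l with
    | nil => intro v hv; simpa using hv
    | cons X l ih =>
      intro v hv
      rw [List.map_cons, List.prod_cons, mul_assoc, List.length_cons, add_right_comm]
      exact vec_mul_mem_filtration X (ih v hv)
  induction hu using AddSubgroup.closure_induction with
  | mem u hu =>
    obtain ⟨l, b, hl, rfl⟩ := hu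
    rw [mul_assoc]
    exact filtration_mono (by omega) (key l _ (scalar_mul_mem_filtration b hv))
  | zero => rw [zero_mul]; exact zero_mem _
  | add x y _ _ hx hy => rw [add_mul]; exact add_mem hx hy
  | neg x _ hx => rw [neg_mul]; exact neg_mem hx

theorem filtrationBelow_mul_mem {m n : ℕ} {u v : SuperEnv k 𝓖}
    (hu : u ∈ filtrationBelow k 𝓖 m) (hv : v ∈ filtration k 𝓖 n) :
    u * v ∈ filtrationBelow k 𝓖 (m + n) := by
  cases m with
  | zero =>
    have h : u = 0 := hu
    rw [h, zero_mul]; exact zero_mem _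
  | succ m => rw [add_right_comm]; exact mul_mem_filtration hu hv

theorem mul_filtrationBelow_mem {m n : ℕ} {u v : SuperEnv k 𝓖}
    (hu : u ∈ filtration k 𝓖 m) (hv : v ∈ filtrationBelow k 𝓖 n) :
    u * v ∈ filtrationBelow k 𝓖 (m + n) := by
  cases n with
  | zero =>
    have h : v = 0 := hv
    rw [h, mul_zero]; exact zero_mem _
  | succ n => exact mul_mem_filtration hu hv

theorem exists_mem_filtration (𝓚 : ZMod 2 → AddSubgroup k) [GradedRing 𝓚] [CommSuperring 𝓚]
    [DirectSum.Decomposition 𝓖] [SuperModule 𝓚 𝓖] (u : SuperEnv k 𝓖) : ∃ n, u ∈ filtration k 𝓖 n := by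
  refine induction_vec_mul (P := fun u => ∃ n, u ∈ filtration k 𝓖 n) 𝓚 ?_
    ⟨0, one_mem_filtration⟩ ?_ ?_ u
  · rintro w z ⟨m, hm⟩ ⟨n, hn⟩
    exact ⟨max m n, add_mem (filtration_mono (le_max_left _ _) hm)
      (filtration_mono (le_max_right _ _) hn)⟩
  · rintro q X w _ ⟨n, hn⟩
    exact ⟨n + 1, vec_mul_mem_filtration X hn⟩
  · rintro i a w _ ⟨n, hn⟩
    exact ⟨n, mul_scalar_mem_filtration a hn⟩

end Filtration
end SuperEnv

section

variable {R A : Type*} [Ring R] [AddCommGroup A] (Φ : R →+* AddMonoid.End A)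

theorem addMonoidEnd_map_add (u v : R) (w : A) : Φ (u + v) w = Φ u w + Φ v w := by
  rw [map_add]; rfl

theorem addMonoidEnd_map_mul (u v : R) (w : A) : Φ (u * v) w = Φ u (Φ v w) := by
  rw [map_mul]; rfl

end

namespace SuperSym

/-! ### The representation of `U(𝔤)` on `S(𝔤)`. -/

section Representation
set_option linter.unusedSectionVars false

variable {k 𝔤 : Type*} [Ring k] [AddCommGroup 𝔤] [Module k 𝔤] [Module kᵐᵒᵖ 𝔤]
  [SMulCommClass k kᵐᵒᵖ 𝔤] [Bracket 𝔤 𝔤]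
  {𝓚 : ZMod 2 → AddSubgroup k} {𝓖 : ZMod 2 → AddSubgroup 𝔤}
  [GradedRing 𝓚] [CommSuperring 𝓚] [DirectSum.Decomposition 𝓖] [SuperModule 𝓚 𝓖]
  [LieSuperalgebra 𝓚 𝓖]

variable {p r : ZMod 2} {F : SuperSym k 𝓖 →+ 𝔤}

theorem vectorField_units_smul (hF : IsHom 𝓚 p F) (e : ℤˣ) (w : SuperSym k 𝓖) :
    vectorField 𝓚 p (e • F) w = e • vectorField 𝓚 p F w := by
  rcases Int.units_eq_one_or e with rfl | rfl
  · rw [one_smul, one_smul]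
  · have h := vectorField_sub (IsHom.zero (𝓚 := 𝓚) p) hF w
    rwa [zero_sub, vectorField_zero, zero_sub, ← neg_one_units_smul, ← neg_one_units_smul] at h

theorem vectorField_scalar_mul (hF : IsHom 𝓚 p F) {i : ZMod 2} {a : k} (ha : a ∈ 𝓚 i)
    (w : SuperSym k 𝓖) : vectorField 𝓚 p F (scalar k 𝓖 a * w) =
      koszulSign p i • (scalar k 𝓖 a * vectorField 𝓚 p F w) := by
  induction w using DirectSum.Decomposition.inductionOn (part 𝓖 𝓚) with
  | zero => simp
  | add w z hw hz => rw [mul_add, map_add, hw, hz, map_add, mul_add, smul_add]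
  | @homogeneous j w =>
    rw [scalar_comm 𝓖 𝓚 ha w.2, units_smul_map, vectorField_mul_scalar hF,
      scalar_comm 𝓖 𝓚 ha (vectorField_mem hF w.2), smul_smul, koszulSign_def, koszulSign_def,
      koszulSign_add_right, koszulSign_comm p i, ← mul_assoc, koszulSign_mul_self, one_mul]

/-- The coderivations attached to `t / (e^t - 1)` represent the Lie superalgebra `𝔤`. -/
theorem coderivation_lie (h : HasBernoulli 𝓚 𝓖) {X Y : 𝔤} (hX : X ∈ 𝓖 p) (hY : Y ∈ 𝓖 r)
    (w : SuperSym k 𝓖) :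
    coderivation 𝓚 𝓖 (bernoulliSeries (𝓚 0)) X
        (coderivation 𝓚 𝓖 (bernoulliSeries (𝓚 0)) Y w) =
      koszulSign p r • coderivation 𝓚 𝓖 (bernoulliSeries (𝓚 0)) Y
        (coderivation 𝓚 𝓖 (bernoulliSeries (𝓚 0)) X w) +
      coderivation 𝓚 𝓖 (bernoulliSeries (𝓚 0)) ⁅X, Y⁆ w := by
  have hF := seriesAd_isHom (bernoulliSeries (𝓚 0)) (⟨X, hX⟩ : 𝓖 p)
  have hG := seriesAd_isHom (bernoulliSeries (𝓚 0)) (⟨Y, hY⟩ : 𝓖 r)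
  rw [coderivation_of_mem _ hX, coderivation_of_mem _ hY,
    -- The vector field of `[X, Y]` is replaced by the bracket of vector fields, and the commutator
    -- formula then turns it into a commutator of operators.
    coderivation_of_mem _ (lie_mem 𝓚 hX hY), ← seriesAd_bracket h ⟨X, hX⟩ ⟨Y, hY⟩,
    vectorField_sub (comp_vectorField_isHom hF hG)
      (by rw [add_comm p r]; exact (comp_vectorField_isHom hG hF).units_smul _),
    vectorField_units_smul (by rw [add_comm p r]; exact comp_vectorField_isHom hG hF),
    ← vectorField_commutator hF hG w]
  abel

variable (φ : PowerSeries (𝓚 0))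

theorem coderivation_mul_scalar (X : 𝔤) (w : SuperSym k 𝓖) (a : k) :
    coderivation 𝓚 𝓖 φ X (w * scalar k 𝓖 a) = coderivation 𝓚 𝓖 φ X w * scalar k 𝓖 a := by
  induction X using DirectSum.Decomposition.inductionOn 𝓖 with
  | zero => rw [coderivation_of_mem φ (zero_mem (𝓖 0)),
      vectorField_mul_scalar (seriesAd_isHom φ _)]
  | add x y hx hy =>
    rw [coderivation_add, AddMonoidHom.add_apply, AddMonoidHom.add_apply, hx, hy, add_mul]
  | homogeneous x =>
    rw [coderivation_of_mem φ x.2, vectorField_mul_scalar (seriesAd_isHom φ _)]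

variable (𝓚 𝓖) in
/-- `a ↦ Φ^a` as an additive map. -/
def coderivationHom : 𝔤 →+ AddMonoid.End (SuperSym k 𝓖) :=
  AddMonoidHom.mk' (coderivation 𝓚 𝓖 φ) (coderivation_add φ)

variable (k 𝓖) in
/-- The action of scalars by left multiplication. -/
def scalarHom : k →+* AddMonoid.End (SuperSym k 𝓖) :=
  (Module.toAddMonoidEnd (SuperSym k 𝓖) (SuperSym k 𝓖)).comp (scalar k 𝓖)

theorem coderivationHom_smul (a : k) (X : 𝔤) :
    coderivationHom 𝓚 𝓖 φ (a • X) = scalarHom k 𝓖 a * coderivationHom 𝓚 𝓖 φ X := by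
  induction a using DirectSum.Decomposition.inductionOn 𝓚 with
  | zero => simp
  | add a b ha hb => rw [add_smul, map_add, ha, hb, map_add, add_mul]
  | homogeneous a =>
    induction X using DirectSum.Decomposition.inductionOn 𝓖 with
    | zero => simp
    | add x y hx hy => rw [smul_add, map_add, hx, hy, map_add, mul_add]
    | homogeneous X =>
      exact AddMonoidHom.ext fun w => coderivation_smul_of_mem φ a.2 X.2 w

theorem coderivationHom_op_smul (a : k) (X : 𝔤) :
    coderivationHom 𝓚 𝓖 φ (MulOpposite.op a • X) =
      coderivationHom 𝓚 𝓖 φ X * scalarHom k 𝓖 a := by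
  induction a using DirectSum.Decomposition.inductionOn 𝓚 with
  | zero => simp
  | add a b ha hb => rw [MulOpposite.op_add, add_smul, map_add, ha, hb, map_add, mul_add]
  | homogeneous a =>
    induction X using DirectSum.Decomposition.inductionOn 𝓖 with
    | zero => simp
    | add x y hx hy => rw [smul_add, map_add, hx, hy, map_add, add_mul]
    | @homogeneous j X =>
      rw [op_smul_eq_smul a.2 X.2, units_smul_map, coderivationHom_smul]
      refine AddMonoidHom.ext fun w => ?_
      change koszulSign _ j • (scalar k 𝓖 (a : k) * coderivation 𝓚 𝓖 φ X w) =
        coderivation 𝓚 𝓖 φ X (scalar k 𝓖 a * w)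
      rw [coderivation_of_mem φ X.2, vectorField_scalar_mul (seriesAd_isHom φ _) a.2,
        koszulSign_comm]

theorem coderivation_mem {X : 𝔤} (hX : X ∈ 𝓖 p) {j : ZMod 2} {w : SuperSym k 𝓖}
    (hw : w ∈ part 𝓖 𝓚 j) : coderivation 𝓚 𝓖 φ X w ∈ part 𝓖 𝓚 (p + j) := by
  rw [coderivation_of_mem φ hX]; exact vectorField_mem (seriesAd_isHom φ _) hw

/-- The representation `Φ` of `U(𝔤)` on `S(𝔤)`. -/
def symbolRepresentation (h : HasBernoulli 𝓚 𝓖) :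
    SuperEnv k 𝓖 →+* AddMonoid.End (SuperSym k 𝓖) :=
  SuperEnv.lift (scalarHom k 𝓖) (coderivationHom 𝓚 𝓖 (bernoulliSeries (𝓚 0)))
    (coderivationHom_smul _) (coderivationHom_op_smul _)
    fun _ _ _ _ hX hY => AddMonoidHom.ext fun w => coderivation_lie h hX hY w

theorem symbolRepresentation_isSymbolRepresentation (h : HasBernoulli 𝓚 𝓖) :
    IsSymbolRepresentation 𝓚 𝓖 (symbolRepresentation h) := by
  have hvec : ∀ (a : 𝔤) (w : SuperSym k 𝓖), symbolRepresentation h (SuperEnv.vec k 𝓖 a) w =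
      coderivation 𝓚 𝓖 (bernoulliSeries (𝓚 0)) a w := fun a w =>
    congrArg (fun f : AddMonoid.End (SuperSym k 𝓖) => f w) (SuperEnv.lift_vec _ _ _ _ _ a)
  have hscalar : ∀ (a : k) (w : SuperSym k 𝓖),
      symbolRepresentation h (SuperEnv.scalar k 𝓖 a) w = scalar k 𝓖 a * w := fun a w =>
    congrArg (fun f : AddMonoid.End (SuperSym k 𝓖) => f w) (SuperEnv.lift_scalar _ _ _ _ _ a)
  refine ⟨hvec, hscalar, fun u => ?_, fun {i j u w} hu => ?_⟩
  · refine SuperEnv.induction_vec_mul (P := fun u => ∀ (w : SuperSym k 𝓖) (a : k),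
      symbolRepresentation h u (w * scalar k 𝓖 a) =
        symbolRepresentation h u w * scalar k 𝓖 a) 𝓚 ?_ ?_ ?_ ?_ u
    · intro u v hu hv w a
      rw [addMonoidEnd_map_add, addMonoidEnd_map_add, hu, hv, add_mul]
    · intro w a
      rw [map_one]; rfl
    · intro q X u _ hu w a
      rw [addMonoidEnd_map_mul, addMonoidEnd_map_mul, hu, hvec, hvec,
        coderivation_mul_scalar]
    · intro i b u _ hu w a
      rw [addMonoidEnd_map_mul, addMonoidEnd_map_mul, hscalar, hscalar,
        ← mul_assoc, hu]
  · refine SuperEnv.part_induction (P := fun i u => ∀ (j : ZMod 2) (w : SuperSym k 𝓖),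
      w ∈ part 𝓖 𝓚 j → symbolRepresentation h u w ∈ part 𝓖 𝓚 (i + j)) ?_ ?_ ?_ ?_ ?_ hu j w
    · intro i j w _
      rw [map_zero]; exact zero_mem _
    · intro i u v hu hv j w hw
      rw [map_add]; exact add_mem (hu j w hw) (hv j w hw)
    · intro j w hw
      rw [map_one, zero_add]; exact hw
    · intro q j X u hX _ hu l w hw
      rw [addMonoidEnd_map_mul, hvec, add_assoc]
      exact coderivation_mem _ hX (hu l w hw)
    · intro i j a u ha _ hu l w hw
      rw [addMonoidEnd_map_mul, hscalar, add_assoc]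
      exact hu _ _ (SetLike.GradedMul.mul_mem (scalar_mem_part 𝓖 𝓚 ha) hw)

end Representation

/-! ### Invertibility of factorials. -/

section Bernoulli
set_option linter.unusedSectionVars false

variable {k : Type*} [Ring k] {𝓚 : ZMod 2 → AddSubgroup k} [GradedRing 𝓚]

/-- Multiplication by the even element `m` commutes with taking even components, so the even
component of an inverse of `m` is again an inverse. -/
theorem isUnit_natCast_even {m : ℕ} (h : IsUnit (m : k)) : IsUnit (m : 𝓚 0) := by
  obtain ⟨u, hu⟩ := h
  have hm : (m : k) ∈ 𝓚 0 := SetLike.natCast_mem_graded 𝓚 m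
  have key : (m : k) * (DirectSum.decompose 𝓚 (↑u⁻¹ : k) 0 : 𝓚 0) = 1 := by
    have h1 := DirectSum.coe_decompose_mul_of_left_mem_zero 𝓚 (j := 0) (b := (↑u⁻¹ : k)) hm
    rw [← hu, Units.mul_inv, DirectSum.decompose_of_mem_same 𝓚 SetLike.GradedOne.one_mem] at h1
    rw [← hu]; exact h1.symm
  have hmul : (m : 𝓚 0) * DirectSum.decompose 𝓚 (↑u⁻¹ : k) 0 = 1 := Subtype.ext key
  refine ⟨⟨(m : 𝓚 0), DirectSum.decompose 𝓚 (↑u⁻¹ : k) 0, hmul, ?_⟩, rfl⟩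
  rw [← hmul]; exact (Nat.cast_commute m _).eq.symm

theorem isUnit_natCast_factorial {R : Type*} [Ring R] {n : ℕ}
    (h : ∀ m : ℕ, 2 ≤ m → m ≤ n → IsUnit (m : R)) : IsUnit ((n.factorial : ℕ) : R) := by
  induction n with
  | zero => simp
  | succ n ih =>
    rw [Nat.factorial_succ, Nat.cast_mul]
    refine IsUnit.mul ?_ (ih fun m h2 hm => h m h2 (by omega))
    rcases n.eq_zero_or_pos with rfl | hn
    · simp
    · exact h _ (by omega) le_rfl

theorem isUnit_natCast_of_rat {R : Type*} [Ring R] (f : ℚ →+* R) {m : ℕ} (hm : m ≠ 0) :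
    IsUnit (m : R) := by
  rw [← map_natCast f]
  exact (isUnit_iff_ne_zero.mpr (Nat.cast_ne_zero.mpr hm)).map f

variable {𝔤 : Type*} [AddCommGroup 𝔤] [Module k 𝔤] [Module kᵐᵒᵖ 𝔤] [Bracket 𝔤 𝔤]
  {𝓖 : ZMod 2 → AddSubgroup 𝔤} [LieSuperalgebra 𝓚 𝓖]

/-- The factorials needed for `L` go up to `(L + 2)!`, whose factors are at most `N` as soon as `N >
L + 1`; when `N ≤ L + 1` the lower central series has already died at `L + 1`. -/
theorem HasBernoulli.of_rat_or_nilpotent [SMulCommClass k kᵐᵒᵖ 𝔤] [CommSuperring 𝓚]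
    [DirectSum.Decomposition 𝓖] [SuperModule 𝓚 𝓖] (h : Nonempty (ℚ →+* k) ∨
      ∃ N : ℕ, 2 ≤ N ∧ IsLieNilpotent 𝔤 N ∧ ∀ m : ℕ, 2 ≤ m → m ≤ N → IsUnit (m : k)) :
    HasBernoulli 𝓚 𝓖 := by
  intro L
  rcases h with ⟨⟨f⟩⟩ | ⟨N, _, hN, hu⟩
  · exact Or.inl fun n _ => isUnit_natCast_factorial fun m hm _ =>
      isUnit_natCast_even (isUnit_natCast_of_rat f (by omega))
  · rcases le_or_gt N (L + 1) with hL | hL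
    · exact Or.inr (lowerCentral_eq_bot 𝓚 hN hL)
    · exact Or.inl fun n hn => isUnit_natCast_factorial fun m hm hm' =>
        isUnit_natCast_even (hu m hm (by omega))

end Bernoulli

/-! ### The symbol map and its surjectivity. -/

section Symbol
set_option linter.unusedSectionVars false

variable {k 𝔤 : Type*} [Ring k] [AddCommGroup 𝔤] [Module k 𝔤] [Module kᵐᵒᵖ 𝔤]
  [SMulCommClass k kᵐᵒᵖ 𝔤] [Bracket 𝔤 𝔤]
  {𝓚 : ZMod 2 → AddSubgroup k} {𝓖 : ZMod 2 → AddSubgroup 𝔤}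
  [GradedRing 𝓚] [CommSuperring 𝓚] [DirectSum.Decomposition 𝓖] [SuperModule 𝓚 𝓖]
  [LieSuperalgebra 𝓚 𝓖]

/-- The constant term of `t / (e^t - 1)` is `1`, so `φ^X` takes the value `X` at `1`; this value
alone governs the leading term of the coderivation. -/
theorem coderivation_bernoulli_sub_mem (X : 𝔤) {n : ℕ} {w : SuperSym k 𝓖}
    (hw : w ∈ power k 𝓖 n) :
    coderivation 𝓚 𝓖 (bernoulliSeries (𝓚 0)) X w - vec k 𝓖 X * w ∈ powerLE k 𝓖 n := by
  have hom : ∀ {p : ZMod 2} {X : 𝔤}, X ∈ 𝓖 p →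
      coderivation 𝓚 𝓖 (bernoulliSeries (𝓚 0)) X w - vec k 𝓖 X * w ∈ powerLE k 𝓖 n := by
    intro p X hX
    have h := (vec_mul_sub_vectorField_mem
      (seriesAd_isHom (bernoulliSeries (𝓚 0)) (⟨X, hX⟩ : 𝓖 p)) hw).1
    rw [← coderivation_of_mem _ hX, seriesAd_apply_of_mem _ _ one_mem_power] at h
    have h0 : PowerSeries.coeff 0 (bernoulliSeries (𝓚 0)) = 1 := by
      rw [PowerSeries.coeff_zero_eq_constantCoeff_apply, bernoulliSeries,
        PowerSeries.constantCoeff_invOfUnit]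
      simp
    rw [h0, adIter_zero, constHom_one] at h
    simpa using h
  induction X using DirectSum.Decomposition.inductionOn 𝓖 with
  | zero => exact hom (zero_mem (𝓖 0))
  | add x y hx hy =>
    have h := add_mem hx hy
    rwa [sub_add_sub_comm, ← AddMonoidHom.add_apply, ← coderivation_add, ← add_mul,
      ← map_add] at h
  | homogeneous x => exact hom x.2

/-- The sum of the `S^m(𝔤)` with `m < n`. -/
def powerBelow (k : Type*) {𝔤 : Type*} [Ring k] [AddCommGroup 𝔤] [Module k 𝔤] [Module kᵐᵒᵖ 𝔤]
    (𝓖 : ZMod 2 → AddSubgroup 𝔤) : ℕ → AddSubgroup (SuperSym k 𝓖)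
  | 0 => ⊥
  | n + 1 => powerLE k 𝓖 n

theorem powerLE_le_powerBelow {m n : ℕ} (h : m < n) : powerLE k 𝓖 m ≤ powerBelow k 𝓖 n := by
  obtain ⟨l, rfl⟩ := Nat.exists_eq_add_of_lt h
  exact powerLE_mono (Nat.le_add_right m l)

theorem powerBelow_le (n : ℕ) : powerBelow k 𝓖 n ≤ powerLE k 𝓖 n := by
  cases n with
  | zero => exact bot_le
  | succ n => exact powerLE_mono n.le_succ

theorem mul_scalar_mem_powerBelow (a : k) {n : ℕ} {w : SuperSym k 𝓖}
    (hw : w ∈ powerBelow k 𝓖 n) : w * scalar k 𝓖 a ∈ powerBelow k 𝓖 n := by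
  cases n with
  | zero =>
    have h : w = 0 := hw
    rw [h, zero_mul]; exact zero_mem _
  | succ n => exact mul_scalar_mem_powerLE a hw

theorem power_inf_powerBelow {n : ℕ} {w : SuperSym k 𝓖} (hw : w ∈ power k 𝓖 n)
    (hw' : w ∈ powerBelow k 𝓖 n) : w = 0 := by
  cases n with
  | zero => exact hw'
  | succ n => exact power_inf_powerLE n.lt_succ_self hw hw'

theorem coderivation_bernoulli_mem_powerLE (X : 𝔤) {n : ℕ} {w : SuperSym k 𝓖}
    (hw : w ∈ powerLE k 𝓖 n) :
    coderivation 𝓚 𝓖 (bernoulliSeries (𝓚 0)) X w ∈ powerLE k 𝓖 (n + 1) := by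
  induction hw using AddSubgroup.closure_induction with
  | mem w hw =>
    obtain ⟨m, hm, hw⟩ := hw
    have h := add_mem (powerLE_mono (hm.trans n.le_succ)
      (coderivation_bernoulli_sub_mem (𝓚 := 𝓚) X hw))
      (powerLE_mono (Nat.succ_le_succ hm) (vec_mul_mem_powerLE X (power_le_powerLE le_rfl hw)))
    rwa [sub_add_cancel] at h
  | zero => rw [map_zero]; exact zero_mem _
  | add x y _ _ hx hy => rw [map_add]; exact add_mem hx hy
  | neg x _ hx => rw [map_neg]; exact neg_mem hx

/-- The symbol map `u ↦ Φ(u)(1)`. -/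
def symbol (Φ : SuperEnv k 𝓖 →+* AddMonoid.End (SuperSym k 𝓖)) :
    SuperEnv k 𝓖 →+ SuperSym k 𝓖 :=
  AddMonoidHom.mk' (fun u => Φ u 1) fun u v => addMonoidEnd_map_add Φ u v 1

variable {Φ : SuperEnv k 𝓖 →+* AddMonoid.End (SuperSym k 𝓖)}

theorem _root_.IsSymbolRepresentation.unique (hΦ : IsSymbolRepresentation 𝓚 𝓖 Φ)
    {Ψ : SuperEnv k 𝓖 →+* AddMonoid.End (SuperSym k 𝓖)}
    (hΨ : IsSymbolRepresentation 𝓚 𝓖 Ψ) : Ψ = Φ := by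
  refine SuperEnv.hom_ext (fun a => ?_) (fun x => ?_)
  · exact AddMonoidHom.ext fun w => (hΨ.apply_scalar a w).trans (hΦ.apply_scalar a w).symm
  · exact AddMonoidHom.ext fun w => (hΨ.apply_vec x w).trans (hΦ.apply_vec x w).symm

theorem symbol_vec_mul (hΦ : IsSymbolRepresentation 𝓚 𝓖 Φ)
    (X : 𝔤) (u : SuperEnv k 𝓖) : symbol Φ (SuperEnv.vec k 𝓖 X * u) =
    coderivation 𝓚 𝓖 (bernoulliSeries (𝓚 0)) X (symbol Φ u) :=
  (addMonoidEnd_map_mul Φ _ _ _).trans (hΦ.apply_vec _ _)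

theorem symbol_one (Φ : SuperEnv k 𝓖 →+* AddMonoid.End (SuperSym k 𝓖)) : symbol Φ 1 = 1 :=
  congrArg (fun f : AddMonoid.End (SuperSym k 𝓖) => f 1) (map_one Φ)

theorem symbol_mul_scalar (hΦ : IsSymbolRepresentation 𝓚 𝓖 Φ)
    (u : SuperEnv k 𝓖) (a : k) :
    symbol Φ (u * SuperEnv.scalar k 𝓖 a) = symbol Φ u * scalar k 𝓖 a := by
  refine (addMonoidEnd_map_mul Φ _ _ _).trans ?_
  rw [hΦ.apply_scalar, mul_one]
  nth_rw 1 [← one_mul (scalar k 𝓖 a)]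
  exact hΦ.map_smul u 1 a

theorem symbol_mem (hΦ : IsSymbolRepresentation 𝓚 𝓖 Φ)
    {i : ZMod 2} {u : SuperEnv k 𝓖} (hu : u ∈ SuperEnv.part 𝓖 𝓚 i) :
    symbol Φ u ∈ part 𝓖 𝓚 i := by
  have h := hΦ.map_mem hu (one_mem_part (𝓜 := 𝓖) (𝓚 := 𝓚))
  rwa [add_zero] at h

/-- Each letter acts as multiplication up to terms of lower degree than the product, and raises the
degree of the error already made by at most one. -/
theorem symbol_prod (hΦ : IsSymbolRepresentation 𝓚 𝓖 Φ)
    (l : List 𝔤) :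
    symbol Φ (l.map (SuperEnv.vec k 𝓖)).prod - (l.map (vec k 𝓖)).prod ∈
      powerBelow k 𝓖 l.length := by
  induction l with
  | nil =>
    rw [List.map_nil, List.map_nil, List.prod_nil, List.prod_nil, symbol_one Φ, sub_self]
    exact zero_mem _
  | cons X l ih =>
    simp only [List.map_cons, List.prod_cons, symbol_vec_mul hΦ]
    have h1 := coderivation_bernoulli_sub_mem (𝓚 := 𝓚) X (prod_mem_power (k := k) (𝓖 := 𝓖) l)
    have h2 : coderivation 𝓚 𝓖 (bernoulliSeries (𝓚 0)) X
        (symbol Φ (l.map (SuperEnv.vec k 𝓖)).prod - (l.map (vec k 𝓖)).prod) ∈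
        powerLE k 𝓖 l.length := by
      -- For the empty word the error is exactly zero, in accordance with `powerBelow k 𝓖 0 = ⊥`.
      cases l with
      | nil =>
        rw [List.map_nil, List.map_nil, List.prod_nil, List.prod_nil, symbol_one Φ, sub_self,
          map_zero]
        exact zero_mem _
      | cons Y l => exact coderivation_bernoulli_mem_powerLE X ih
    have h := add_mem h2 h1
    rw [map_sub, sub_add_sub_cancel] at h
    exact h

theorem symbol_mem_powerLE (hΦ : IsSymbolRepresentation 𝓚 𝓖 Φ)
    {n : ℕ} {u : SuperEnv k 𝓖} (hu : u ∈ SuperEnv.filtration k 𝓖 n) :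
    symbol Φ u ∈ powerLE k 𝓖 n := by
  induction hu using AddSubgroup.closure_induction with
  | mem u hu =>
    obtain ⟨l, a, hl, rfl⟩ := hu
    have h := add_mem (powerBelow_le _ (symbol_prod hΦ l))
      (power_le_powerLE le_rfl (prod_mem_power (k := k) (𝓖 := 𝓖) l))
    rw [sub_add_cancel] at h
    rw [symbol_mul_scalar hΦ]
    exact mul_scalar_mem_powerLE a (powerLE_mono hl h)
  | zero => rw [map_zero]; exact zero_mem _
  | add x y _ _ hx hy => rw [map_add]; exact add_mem hx hy
  | neg x _ hx => rw [map_neg]; exact neg_mem hx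

/-- The symbol map is unitriangular: a word in `S(𝔤)` is the symbol of the same word in `U(𝔤)` up to
lower degree, and strong induction corrects the error. Keeping the preimage in `U_n` is what later
gives `β(S^n) ⊆ U_n`. -/
theorem exists_symbol_eq_of_mem_powerLE (hΦ : IsSymbolRepresentation 𝓚 𝓖 Φ)
    {n : ℕ} {w : SuperSym k 𝓖} (hw : w ∈ powerLE k 𝓖 n) :
    ∃ u ∈ SuperEnv.filtration k 𝓖 n, symbol Φ u = w := by
  induction n using Nat.strong_induction_on generalizing w with
  | _ n ih =>
    have below : ∀ m ≤ n, ∀ w ∈ powerBelow k 𝓖 m,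
        ∃ u ∈ SuperEnv.filtration k 𝓖 n, symbol Φ u = w := by
      intro m hm w hw
      cases m with
      | zero => exact ⟨0, zero_mem _, (map_zero _).trans hw.symm⟩
      | succ m =>
        obtain ⟨u, hu, h⟩ := ih m hm hw
        exact ⟨u, SuperEnv.filtration_mono (by omega) hu, h⟩
    let T := (SuperEnv.filtration k 𝓖 n).map (symbol Φ)
    change w ∈ T
    have hpow : ∀ m ≤ n, power k 𝓖 m ≤ T := by
      intro m hm
      refine (AddSubgroup.closure_le _).mpr ?_
      rintro _ ⟨l, a, rfl, rfl⟩
      have h1 : symbol Φ ((l.map (SuperEnv.vec k 𝓖)).prod * SuperEnv.scalar k 𝓖 a) ∈ T :=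
        ⟨_, SuperEnv.mul_scalar_mem_filtration a (SuperEnv.prod_mem_filtration hm), rfl⟩
      have h2 := below _ hm _ (mul_scalar_mem_powerBelow a (symbol_prod hΦ l))
      have h := sub_mem h1 (show _ ∈ T from h2)
      rwa [symbol_mul_scalar hΦ, sub_mul, sub_sub_cancel] at h
    refine (AddSubgroup.closure_le T).mpr ?_ hw
    rintro w ⟨m, hm, hw⟩
    exact hpow m hm hw

theorem symbol_surjective (hΦ : IsSymbolRepresentation 𝓚 𝓖 Φ)
    : Function.Surjective (symbol Φ) := fun w => by
  obtain ⟨n, hn⟩ := exists_mem_powerLE 𝓚 w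
  obtain ⟨u, -, hu⟩ := exists_symbol_eq_of_mem_powerLE hΦ hn
  exact ⟨u, hu⟩

end Symbol
end SuperSym

namespace SuperEnv

/-! ### The associated graded ring of `U(𝔤)`, as a quotient of the Rees ring. -/

section Rees
set_option linter.unusedSectionVars false

variable {k 𝔤 : Type*} [Ring k] [AddCommGroup 𝔤] [Module k 𝔤] [Module kᵐᵒᵖ 𝔤]
  [Bracket 𝔤 𝔤] {𝓖 : ZMod 2 → AddSubgroup 𝔤}

variable (k 𝓖) in
/-- The Rees ring of the filtration of `U(𝔤)`. -/
def rees : Subring (Polynomial (SuperEnv k 𝓖)) where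
  carrier := {q | ∀ n, q.coeff n ∈ filtration k 𝓖 n}
  mul_mem' {q r} hq hr n := by
    rw [Polynomial.coeff_mul]
    refine sum_mem fun x hx => ?_
    rw [← Finset.HasAntidiagonal.mem_antidiagonal.mp hx]
    exact mul_mem_filtration (hq _) (hr _)
  one_mem' n := by
    rw [Polynomial.coeff_one]
    split_ifs
    · exact filtration_mono n.zero_le one_mem_filtration
    · exact zero_mem _
  add_mem' hq hr n := by rw [Polynomial.coeff_add]; exact add_mem (hq n) (hr n)
  zero_mem' n := by rw [Polynomial.coeff_zero]; exact zero_mem _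
  neg_mem' hq n := by rw [Polynomial.coeff_neg]; exact neg_mem (hq n)

variable (k 𝓖) in
/-- The ideal of the Rees ring whose quotient is the associated graded ring of `U(𝔤)`. -/
def reesIdeal : Ideal (rees k 𝓖) where
  carrier := {q | ∀ n, (q : Polynomial (SuperEnv k 𝓖)).coeff n ∈ filtrationBelow k 𝓖 n}
  add_mem' hq hr n := by
    rw [Subring.coe_add, Polynomial.coeff_add]; exact add_mem (hq n) (hr n)
  zero_mem' n := by rw [Subring.coe_zero, Polynomial.coeff_zero]; exact zero_mem _
  smul_mem' q r hr n := by
    rw [smul_eq_mul, Subring.coe_mul, Polynomial.coeff_mul]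
    refine sum_mem fun x hx => ?_
    rw [← Finset.HasAntidiagonal.mem_antidiagonal.mp hx]
    exact mul_filtrationBelow_mem (q.2 _) (hr _)

instance : (reesIdeal k 𝓖).IsTwoSided where
  mul_mem_of_left {q} r hq n := by
    rw [Subring.coe_mul, Polynomial.coeff_mul]
    refine sum_mem fun x hx => ?_
    rw [← Finset.HasAntidiagonal.mem_antidiagonal.mp hx]
    exact filtrationBelow_mul_mem (hq _) (r.2 _)

/-- The element `u zⁿ` of the Rees ring, for `u ∈ U_n`. -/
def reesMonomial (n : ℕ) : filtration k 𝓖 n →+ rees k 𝓖 :=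
  AddMonoidHom.mk' (fun u => ⟨Polynomial.monomial n (u : SuperEnv k 𝓖), fun m => by
      rw [Polynomial.coeff_monomial]
      split_ifs with h
      · rw [← h]; exact u.2
      · exact zero_mem _⟩)
    fun u v => Subtype.ext (map_add (Polynomial.monomial n) (u : SuperEnv k 𝓖) v)

theorem reesMonomial_mem_iff {n : ℕ} (u : filtration k 𝓖 n) :
    reesMonomial n u ∈ reesIdeal k 𝓖 ↔ (u : SuperEnv k 𝓖) ∈ filtrationBelow k 𝓖 n := by
  refine ⟨fun h => ?_, fun h m => ?_⟩
  · have := h n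
    change (Polynomial.monomial n (u : SuperEnv k 𝓖)).coeff n ∈ _ at this
    rwa [Polynomial.coeff_monomial, if_pos rfl] at this
  · change (Polynomial.monomial n (u : SuperEnv k 𝓖)).coeff m ∈ _
    rw [Polynomial.coeff_monomial]
    split_ifs with hm
    · rw [← hm]; exact h
    · exact zero_mem _

theorem reesMonomial_mul {m n : ℕ} (u : filtration k 𝓖 m) (v : filtration k 𝓖 n) :
    reesMonomial m u * reesMonomial n v =
      reesMonomial (m + n) ⟨(u : SuperEnv k 𝓖) * (v : SuperEnv k 𝓖), mul_mem_filtration u.2 v.2⟩ :=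
  Subtype.ext (Polynomial.monomial_mul_monomial _ _ _ _)

variable (k 𝓖) in
/-- The associated graded ring of `U(𝔤)`. -/
abbrev Gr : Type _ := rees k 𝓖 ⧸ reesIdeal k 𝓖

/-- The class in `gr U(𝔤)` of an element of `U_n`. -/
def gr (n : ℕ) : filtration k 𝓖 n →+ Gr k 𝓖 :=
  (Ideal.Quotient.mk (reesIdeal k 𝓖)).toAddMonoidHom.comp (reesMonomial n)

theorem gr_eq_zero_iff {n : ℕ} (u : filtration k 𝓖 n) :
    gr n u = 0 ↔ (u : SuperEnv k 𝓖) ∈ filtrationBelow k 𝓖 n :=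
  Ideal.Quotient.eq_zero_iff_mem.trans (reesMonomial_mem_iff u)

theorem gr_mul {m n : ℕ} (u : filtration k 𝓖 m) (v : filtration k 𝓖 n) :
    gr m u * gr n v = gr (m + n) ⟨(u : SuperEnv k 𝓖) * (v : SuperEnv k 𝓖), mul_mem_filtration u.2 v.2⟩ :=
  (map_mul (Ideal.Quotient.mk (reesIdeal k 𝓖)) _ _).symm.trans
    (congrArg _ (reesMonomial_mul u v))

theorem gr_congr {m n : ℕ} (h : m = n) {u : filtration k 𝓖 m} {v : filtration k 𝓖 n}
    (huv : (u : SuperEnv k 𝓖) = v) : gr m u = gr n v := by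
  subst h; exact congrArg _ (Subtype.ext huv)

theorem scalar_mem_filtration (a : k) : scalar k 𝓖 a ∈ filtration k 𝓖 0 := by
  have h := mul_scalar_mem_filtration a (one_mem_filtration (k := k) (𝓖 := 𝓖))
  rwa [one_mul] at h

variable (k 𝓖) in
/-- The structure map `k → gr U(𝔤)`. -/
def grScalar : k →+* Gr k 𝓖 where
  toFun a := gr 0 ⟨scalar k 𝓖 a, scalar_mem_filtration a⟩
  map_one' := by
    refine (congrArg (Ideal.Quotient.mk (reesIdeal k 𝓖)) (Subtype.ext ?_)).trans (map_one _)
    change Polynomial.monomial 0 (scalar k 𝓖 1) = 1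
    rw [map_one]; rfl
  map_mul' a b := by
    rw [gr_mul]; exact gr_congr rfl (map_mul _ _ _)
  map_zero' := by
    rw [gr_eq_zero_iff]
    change scalar k 𝓖 0 ∈ _
    rw [map_zero]; exact zero_mem _
  map_add' a b := by
    rw [← map_add]; exact gr_congr rfl (map_add _ _ _)

variable (k 𝓖) in
/-- The canonical map `𝔤 → gr U(𝔤)`. -/
def grVec : 𝔤 →+ Gr k 𝓖 :=
  AddMonoidHom.mk' (fun X => gr 1 ⟨vec k 𝓖 X, vec_mem_filtration X⟩) fun X Y => by
    rw [← map_add]; exact gr_congr rfl (map_add _ _ _)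

theorem grVec_apply (X : 𝔤) : grVec k 𝓖 X = gr 1 ⟨vec k 𝓖 X, vec_mem_filtration X⟩ := rfl

theorem grScalar_apply (a : k) :
    grScalar k 𝓖 a = gr 0 ⟨scalar k 𝓖 a, scalar_mem_filtration a⟩ := rfl

/-- For odd `X` the defining relation gives `2 j(X)² = j([X, X])`. Dividing by `2` makes odd squares
vanish in the graded ring, as the relations of `S(𝔤)` demand. -/
theorem vec_mul_self_mem {X : 𝔤} (hX : X ∈ 𝓖 1) (h2 : IsUnit (2 : k)) :
    vec k 𝓖 X * vec k 𝓖 X ∈ filtration k 𝓖 1 := by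
  obtain ⟨c, hc⟩ := h2
  have h := vec_mul_vec (k := k) hX hX
  have h1 : koszulSign 1 1 = -1 := rfl
  rw [h1, neg_one_units_smul] at h
  have h2 : (vec k 𝓖 X * vec k 𝓖 X) * scalar k 𝓖 2 = vec k 𝓖 ⁅X, X⁆ := by
    rw [map_ofNat, mul_two]
    exact eq_neg_add_iff_add_eq.mp h
  have h3 : vec k 𝓖 X * vec k 𝓖 X = vec k 𝓖 ⁅X, X⁆ * scalar k 𝓖 (↑c⁻¹ : k) := by
    rw [← h2, mul_assoc, ← map_mul (scalar k 𝓖), ← hc, Units.mul_inv, map_one, mul_one]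
  rw [h3]
  exact mul_scalar_mem_filtration _ (vec_mem_filtration _)

/-- The canonical map `S(𝔤) → gr U(𝔤)`. -/
def symToGr (h2 : IsUnit (2 : k)) : SuperSym k 𝓖 →+* Gr k 𝓖 :=
  SuperSym.lift (grScalar k 𝓖) (grVec k 𝓖)
    (fun a X => by
      rw [grScalar_apply, grVec_apply, grVec_apply, gr_mul]
      exact gr_congr rfl (vec_left a X))
    (fun a X => by
      rw [grScalar_apply, grVec_apply, grVec_apply, gr_mul]
      exact gr_congr rfl (vec_right a X))
    (fun i j X Y hX hY => by
      rw [koszulSign_def, grVec_apply, grVec_apply, gr_mul, gr_mul, ← units_smul_map,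
        ← sub_eq_zero, ← map_sub, gr_eq_zero_iff]
      have h := vec_mul_vec (k := k) hX hY
      have h' : (vec k 𝓖 X * vec k 𝓖 Y) - koszulSign i j • (vec k 𝓖 Y * vec k 𝓖 X) =
        vec k 𝓖 ⁅X, Y⁆ := by rw [h, add_sub_cancel_left]
      -- Below degree `2` means `U_1`, which contains `j([X, Y])`.
      refine (congrArg (· ∈ filtrationBelow k 𝓖 2) ?_).mpr (vec_mem_filtration ⁅X, Y⁆)
      rw [← h']
      rcases koszulSign_eq_one_or i j with e | e <;> rw [e]
      · rw [one_smul, one_smul]; rfl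
      · rw [neg_one_units_smul, neg_one_units_smul]; rfl)
    (fun X hX => by
      rw [grVec_apply, gr_mul, gr_eq_zero_iff]
      exact vec_mul_self_mem hX h2)

theorem symToGr_prod (h2 : IsUnit (2 : k)) (l : List 𝔤) :
    symToGr h2 (l.map (SuperSym.vec k 𝓖)).prod =
      gr l.length ⟨(l.map (vec k 𝓖)).prod, prod_mem_filtration le_rfl⟩ := by
  induction l with
  | nil =>
    rw [List.map_nil, List.prod_nil, map_one, ← map_one (grScalar k 𝓖), grScalar_apply]
    exact gr_congr rfl (map_one (scalar k 𝓖))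
  | cons X l ih =>
    rw [List.map_cons, List.prod_cons, map_mul, ih, symToGr, SuperSym.lift_vec, grVec_apply,
      gr_mul]
    exact gr_congr (add_comm _ _) rfl

theorem symToGr_prod_mul_scalar (h2 : IsUnit (2 : k)) (l : List 𝔤) (a : k) :
    symToGr h2 ((l.map (SuperSym.vec k 𝓖)).prod * SuperSym.scalar k 𝓖 a) =
      gr l.length ⟨(l.map (vec k 𝓖)).prod * scalar k 𝓖 a,
        mul_scalar_mem_filtration a (prod_mem_filtration le_rfl)⟩ := by
  rw [map_mul, symToGr_prod]
  have h : symToGr h2 (SuperSym.scalar k 𝓖 a) = grScalar k 𝓖 a := SuperSym.lift_scalar _ _ _ _ _ _ _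
  rw [h, grScalar_apply, gr_mul]
  rfl

end Rees
end SuperEnv

namespace SuperSym

/-! ### Injectivity of the symbol map. -/

section Injective
set_option linter.unusedSectionVars false

variable {k 𝔤 : Type*} [Ring k] [AddCommGroup 𝔤] [Module k 𝔤] [Module kᵐᵒᵖ 𝔤]
  [SMulCommClass k kᵐᵒᵖ 𝔤] [Bracket 𝔤 𝔤]
  {𝓚 : ZMod 2 → AddSubgroup k} {𝓖 : ZMod 2 → AddSubgroup 𝔤}
  [GradedRing 𝓚] [CommSuperring 𝓚] [DirectSum.Decomposition 𝓖] [SuperModule 𝓚 𝓖]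
  [LieSuperalgebra 𝓚 𝓖] {Φ : SuperEnv k 𝓖 →+* AddMonoid.End (SuperSym k 𝓖)}

/-- The leading term of the symbol of `u ∈ U_n` represents the class of `u` in `gr U(𝔤)`. -/
theorem exists_leading_term (hΦ : IsSymbolRepresentation 𝓚 𝓖 Φ) (h2 : IsUnit (2 : k)) {n : ℕ}
    {u : SuperEnv k 𝓖} (hu : u ∈ SuperEnv.filtration k 𝓖 n) :
    ∃ v ∈ power k 𝓖 n, symbol Φ u - v ∈ powerBelow k 𝓖 n ∧
      SuperEnv.symToGr h2 v = SuperEnv.gr n ⟨u, hu⟩ := by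
  induction hu using AddSubgroup.closure_induction with
  | mem u hu' =>
    obtain ⟨l, a, hl, rfl⟩ := hu'
    rcases hl.eq_or_lt with rfl | hl
    · refine ⟨(l.map (vec k 𝓖)).prod * scalar k 𝓖 a,
        mul_scalar_mem_power a (prod_mem_power l), ?_, SuperEnv.symToGr_prod_mul_scalar h2 l a⟩
      rw [symbol_mul_scalar hΦ, ← sub_mul]
      exact mul_scalar_mem_powerBelow a (symbol_prod hΦ l)
    -- A word shorter than `n` has leading term zero in degree `n`, and its class in the `n`-th
    -- graded piece is zero as well.
    · have hmem := SuperEnv.mul_scalar_mem_filtration (k := k) (𝓖 := 𝓖) a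
        (SuperEnv.prod_mem_filtration (l := l) le_rfl)
      refine ⟨0, zero_mem _, ?_, ?_⟩
      · rw [sub_zero]
        exact powerLE_le_powerBelow hl (symbol_mem_powerLE hΦ hmem)
      · rw [map_zero, eq_comm, SuperEnv.gr_eq_zero_iff]
        obtain ⟨m, rfl⟩ := Nat.exists_eq_add_of_lt hl
        exact SuperEnv.filtration_mono (Nat.le_add_right _ _) hmem
  | zero =>
    refine ⟨0, zero_mem _, ?_, ?_⟩
    · rw [map_zero, sub_zero]; exact zero_mem _
    · rw [map_zero, eq_comm, SuperEnv.gr_eq_zero_iff]; exact zero_mem _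
  | add x y hx hy ihx ihy =>
    obtain ⟨v, hv, hv1, hv2⟩ := ihx
    obtain ⟨w, hw, hw1, hw2⟩ := ihy
    refine ⟨v + w, add_mem hv hw, ?_, ?_⟩
    · rw [map_add, add_sub_add_comm]; exact add_mem hv1 hw1
    · rw [map_add, hv2, hw2, ← map_add]; rfl
  | neg x hx ih =>
    obtain ⟨v, hv, hv1, hv2⟩ := ih
    refine ⟨-v, neg_mem hv, ?_, ?_⟩
    · rw [map_neg, ← neg_sub_neg, neg_neg, neg_neg, ← neg_sub]; exact neg_mem hv1
    · rw [map_neg, hv2, ← map_neg]; rfl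

/-- If the symbol of `u ∈ U_n` is zero, so is its leading term, by independence of degrees. That
term maps to the class of `u` in `gr U(𝔤)`, so `u ∈ U_{n-1}`; the descent ends at `U_{-1} = 0`. -/
theorem symbol_injective (hΦ : IsSymbolRepresentation 𝓚 𝓖 Φ) (h2 : IsUnit (2 : k)) :
    Function.Injective (symbol Φ) := by
  rw [injective_iff_map_eq_zero]
  intro u hu
  have below : ∀ n, u ∈ SuperEnv.filtration k 𝓖 n → u ∈ SuperEnv.filtrationBelow k 𝓖 n := by
    intro n hn
    obtain ⟨v, hv, hv1, hv2⟩ := exists_leading_term hΦ h2 hn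
    rw [hu, zero_sub, neg_mem_iff] at hv1
    rw [power_inf_powerBelow hv hv1, map_zero, eq_comm, SuperEnv.gr_eq_zero_iff] at hv2
    exact hv2
  obtain ⟨n, hn⟩ := SuperEnv.exists_mem_filtration 𝓚 u
  induction n with
  | zero => exact below 0 hn
  | succ n ih => exact ih (below _ hn)

end Injective
end SuperSym

/-- Criterion used for both `S(𝔤)` and `U(𝔤)`: the Leibniz rule with a generator or a scalar as left
factor propagates to words, and from words to their span. -/
theorem IsDerivationExtension.of_vec_mul {k 𝔤 R : Type*} [Ring k] [AddCommGroup 𝔤] [Ring R]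
    {𝓚 : ZMod 2 → AddSubgroup k} {𝓖 : ZMod 2 → AddSubgroup 𝔤} [DirectSum.Decomposition 𝓖]
    {s : k →+* R} {v : 𝔤 →+ R} {p : ZMod 2} {D : 𝔤 →+ 𝔤} {E : R →+ R} (one : E 1 = 0)
    (vec_mul : ∀ {q : ZMod 2} {X : 𝔤} (w : R), X ∈ 𝓖 q →
      E (v X * w) = v (D X) * w + koszulSign p q • (v X * E w))
    (mul_scalar : ∀ (w : R) (a : k), E (w * s a) = E w * s a)
    (scalar_mul : ∀ {i : ZMod 2} {a : k} (w : R), a ∈ 𝓚 i →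
      E (s a * w) = koszulSign p i • (s a * E w))
    (map_mem : ∀ {i : ZMod 2} {w : R}, w ∈ parityPart 𝓚 𝓖 s v i →
      E w ∈ parityPart 𝓚 𝓖 s v (p + i)) :
    IsDerivationExtension (parityPart 𝓚 𝓖 s v) s v p D E := by
  have scalar : ∀ a, E (s a) = 0 := fun a => by
    have h := mul_scalar 1 a
    rwa [one_mul, one, zero_mul] at h
  have vec : ∀ {q : ZMod 2} {X : 𝔤}, X ∈ 𝓖 q → E (v X) = v (D X) := fun {q X} hX => by
    have h := vec_mul 1 hX
    rwa [mul_one, mul_one, one, mul_zero, smul_zero, add_zero] at h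
  refine ⟨fun X => ?_, mul_scalar, map_mem, fun {i w} z hw => ?_⟩
  · induction X using DirectSum.Decomposition.inductionOn 𝓖 with
    | zero => rw [map_zero, map_zero, map_zero, map_zero]
    | add x y hx hy => rw [map_add, map_add, hx, hy, map_add, map_add]
    | homogeneous x => exact vec x.2
  · rw [koszulSign_def]
    induction hw using Submodule.span_induction generalizing z with
    | mem w hw =>
      induction hw generalizing z with
      | scalar ha => rw [scalar_mul z ha, scalar, zero_mul, zero_add]
      | vec hX => rw [vec_mul z hX, vec hX]
      | mul hw hz h1 h2 =>
        rw [mul_assoc, h1, h2, h1, koszulSign_add_right, mul_add, smul_add, add_mul,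
          mul_smul_comm, smul_mul_assoc, smul_smul, mul_assoc, mul_assoc, mul_assoc, add_assoc]
    | zero => simp
    | add x y _ _ h1 h2 =>
      rw [add_mul, map_add, h1, h2, map_add, add_mul, add_mul, smul_add]; abel
    | smul r x _ h =>
      rw [smul_mul_assoc, map_zsmul, h, map_zsmul, smul_add, smul_mul_assoc, smul_mul_assoc,
        smul_comm]

/-! ### Derivations of `𝔤` acting on `S(𝔤)`. -/

namespace SuperSym

section Derivation
set_option linter.unusedSectionVars false

variable {k 𝔤 : Type*} [Ring k] [AddCommGroup 𝔤] [Module k 𝔤] [Module kᵐᵒᵖ 𝔤]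
  [SMulCommClass k kᵐᵒᵖ 𝔤] [Bracket 𝔤 𝔤]
  {𝓚 : ZMod 2 → AddSubgroup k} {𝓖 : ZMod 2 → AddSubgroup 𝔤}
  [GradedRing 𝓚] [CommSuperring 𝓚] [DirectSum.Decomposition 𝓖] [SuperModule 𝓚 𝓖]
  [LieSuperalgebra 𝓚 𝓖]

variable {p q r : ZMod 2} {F : SuperSym k 𝓖 →+ 𝔤} {D : 𝔤 →+ 𝔤}

theorem vectorField_constHom {X : 𝔤} (hX : X ∈ 𝓖 p) (w : SuperSym k 𝓖) :
    vectorField 𝓚 p (constHom X) w = vec k 𝓖 X * w := by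
  induction w using induction_vec_mul (𝓚 := 𝓚) (𝓜 := 𝓖) with
  | add w z hw hz => rw [map_add, hw, hz, mul_add]
  | one => rw [vectorField_one (constHom_isHom hX), constHom_one, mul_one]
  | vec_mul q Y w hY hw =>
    rw [vectorField_vec_mul (constHom_isHom hX) hY, partialDeriv_constHom, vectorField_zero,
      add_zero, hw, ← mul_assoc, ← mul_assoc, vec_comm hX hY, koszulSign_def, smul_mul_assoc]
  | mul_scalar i a w _ hw => rw [vectorField_mul_scalar (constHom_isHom hX), hw, mul_assoc]

theorem even_smul_eq_op_smul (𝓖 : ZMod 2 → AddSubgroup 𝔤) [DirectSum.Decomposition 𝓖]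
    [SuperModule 𝓚 𝓖] {c : k} (hc : c ∈ 𝓚 0) (Y : 𝔤) : c • Y = MulOpposite.op c • Y := by
  induction Y using DirectSum.Decomposition.inductionOn 𝓖 with
  | zero => rw [smul_zero, smul_zero]
  | add x y hx hy => rw [smul_add, smul_add, hx, hy]
  | homogeneous y => rw [op_smul_eq_smul hc y.2, koszulSign_zero_left, one_smul]

theorem _root_.IsLieDerivation.comp_isHom (hD : IsLieDerivation k 𝓖 p D) (hF : IsHom 𝓚 r F) :
    IsHom 𝓚 (p + r) (D.comp F) where
  map_mem hw := by rw [add_assoc]; exact hD.map_mem (hF.map_mem hw)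
  map_right w a := by
    rw [AddMonoidHom.comp_apply, hF.map_right, hD.map_smul]; rfl

theorem _root_.IsLieDerivation.comp_constHom (hD : IsLieDerivation k 𝓖 p D) (X : 𝔤) :
    D.comp (constHom (k := k) (𝓖 := 𝓖) X) = constHom (D X) :=
  AddMonoidHom.ext fun _ => hD.map_smul X _

/-- The vector field `D ∘ x` attached to a derivation `D` of `𝔤`. -/
abbrev derivationField (k : Type*) {𝔤 : Type*} [Ring k] [AddCommGroup 𝔤] [Module k 𝔤]
    [Module kᵐᵒᵖ 𝔤] [SMulCommClass k kᵐᵒᵖ 𝔤] (𝓖 : ZMod 2 → AddSubgroup 𝔤) (D : 𝔤 →+ 𝔤) :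
    SuperSym k 𝓖 →+ 𝔤 := D.comp (genericPoint 𝓖)

theorem derivationField_isHom (hD : IsLieDerivation k 𝓖 p D) :
    IsHom 𝓚 p (derivationField k 𝓖 D) := by
  have h := hD.comp_isHom (𝓚 := 𝓚) genericPoint_isHom
  rwa [add_zero] at h

theorem partialDeriv_derivationField (hD : IsLieDerivation k 𝓖 p D) (X : 𝔤) :
    partialDeriv X (derivationField k 𝓖 D) = constHom (D X) :=
  (congrArg D.comp (partialDeriv_genericPoint X)).trans (hD.comp_constHom X)

theorem vectorField_derivationField_one (hD : IsLieDerivation k 𝓖 p D) :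
    vectorField 𝓚 p (derivationField k 𝓖 D) 1 = 0 := by
  rw [vectorField_one (derivationField_isHom hD), AddMonoidHom.comp_apply, genericPoint_one,
    map_zero, map_zero]

/-- The derivative of `D ∘ x` along `X` is the constant `DX`, and the coderivation of a constant is
multiplication by it. -/
theorem vectorField_derivationField_vec_mul (hD : IsLieDerivation k 𝓖 p D) {X : 𝔤}
    (hX : X ∈ 𝓖 q) (w : SuperSym k 𝓖) :
    vectorField 𝓚 p (derivationField k 𝓖 D) (vec k 𝓖 X * w) = vec k 𝓖 (D X) * w +
      koszulSign p q • (vec k 𝓖 X * vectorField 𝓚 p (derivationField k 𝓖 D) w) := by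
  rw [vectorField_vec_mul (derivationField_isHom hD) hX, partialDeriv_derivationField hD,
    vectorField_constHom (hD.map_mem hX), add_comm]

/-- A derivation of `𝔤` extends to `S(𝔤)`. -/
theorem isDerivationExtension_vectorField (hD : IsLieDerivation k 𝓖 p D) :
    IsDerivationExtension (part 𝓖 𝓚) (scalar k 𝓖) (vec k 𝓖) p D
      (vectorField 𝓚 p (derivationField k 𝓖 D)) :=
  have hF := derivationField_isHom (𝓚 := 𝓚) hD
  IsDerivationExtension.of_vec_mul (vectorField_derivationField_one hD)
    (fun w hX => vectorField_derivationField_vec_mul hD hX w)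
    (vectorField_mul_scalar hF) (fun w ha => vectorField_scalar_mul hF ha w)
    (fun hw => vectorField_mem hF hw)

theorem _root_.IsDerivationExtension.map_one {R : Type*} [Ring R] {𝓡 : ZMod 2 → Submodule ℤ R}
    [SetLike.GradedMonoid 𝓡] {s : k →+* R} {v : 𝔤 →+ R} {E : R →+ R}
    (hE : IsDerivationExtension 𝓡 s v p D E) : E 1 = 0 := by
  have h := hE.leibniz 1 (SetLike.GradedOne.one_mem (A := 𝓡))
  rwa [mul_one, mul_one, one_mul, mul_zero, uzpow_zero, one_smul, left_eq_add] at h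

theorem eq_vectorField_of_isDerivationExtension (hD : IsLieDerivation k 𝓖 p D)
    {E : SuperSym k 𝓖 →+ SuperSym k 𝓖}
    (hE : IsDerivationExtension (part 𝓖 𝓚) (scalar k 𝓖) (vec k 𝓖) p D E) (w : SuperSym k 𝓖) :
    E w = vectorField 𝓚 p (derivationField k 𝓖 D) w := by
  induction w using induction_vec_mul (𝓚 := 𝓚) (𝓜 := 𝓖) with
  | add w z hw hz => rw [map_add, hw, hz, map_add]
  | one => rw [hE.map_one, vectorField_derivationField_one hD]
  | vec_mul q X w hX hw =>
    rw [hE.leibniz w (vec_mem_part 𝓖 𝓚 hX), hE.map_vec, hw,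
      vectorField_derivationField_vec_mul hD hX, koszulSign_def]
  | mul_scalar i a w _ hw =>
    rw [hE.map_smul, hw, vectorField_mul_scalar (derivationField_isHom hD)]

/-- The vector field `D ∘ x` is linear, so its coderivation preserves degrees; this permits arguing
with `φ^X` one homogeneous component at a time. -/
theorem vectorField_derivationField_mem_power (hD : IsLieDerivation k 𝓖 p D) {n : ℕ}
    {w : SuperSym k 𝓖} (hw : w ∈ power k 𝓖 n) :
    vectorField 𝓚 p (derivationField k 𝓖 D) w ∈ power k 𝓖 n := by
  refine power_induction (P := fun n w =>
    vectorField 𝓚 p (derivationField k 𝓖 D) w ∈ power k 𝓖 n) ?_ ?_ ?_ ?_ hw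
  · intro n w z hw hz
    rw [map_add]; exact add_mem hw hz
  · rw [vectorField_derivationField_one hD]; exact zero_mem _
  · intro q n X w hX hw ih
    rw [vectorField_derivationField_vec_mul hD hX]
    exact add_mem (vec_mul_mem_power _ hw)
      (AddSubgroup.units_smul_mem _ _ (vec_mul_mem_power _ ih))
  · intro n a w ih
    rw [vectorField_mul_scalar (derivationField_isHom hD)]
    exact mul_scalar_mem_power a ih

theorem _root_.IsLieDerivation.map_bracketHom (hD : IsLieDerivation k 𝓖 p D) {X : 𝔤}
    (hX : X ∈ 𝓖 q) (Y : 𝔤) : D (bracketHom 𝓚 𝓖 X Y) =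
      bracketHom 𝓚 𝓖 (D X) Y + koszulSign p q • bracketHom 𝓚 𝓖 X (D Y) :=
  hD.leibniz Y hX

/-- Leibniz rule for the convolution bracket: `D[x, F] = [Dx, F] + [x, DF]`, without sign since `x`
is even. -/
theorem _root_.IsLieDerivation.comp_adPoint (hD : IsLieDerivation k 𝓖 p D) (hF : IsHom 𝓚 r F) :
    D.comp (adPoint 𝓚 r F) = convBracket 𝓚 r (derivationField k 𝓖 D) F +
      adPoint 𝓚 (p + r) (D.comp F) := by
  refine AddMonoidHom.ext fun w => ?_
  have hδ := derivationField_isHom (𝓚 := 𝓚) hD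
  rw [AddMonoidHom.comp_apply, AddMonoidHom.add_apply]
  induction w using induction_vec_mul (𝓚 := 𝓚) (𝓜 := 𝓖) generalizing r F with
  | add w z hw hz => simp only [map_add, hw hF, hz hF]; abel
  | one =>
    rw [adPoint_one hF, adPoint_one (hD.comp_isHom hF), convBracket_one hδ hF,
      AddMonoidHom.comp_apply, genericPoint_one]
    simp
  | vec_mul q X w hX hw =>
    have h := hw (hF.partialDeriv hX)
    rw [adPoint_vec_mul hF hX, map_add, h, adPoint_vec_mul (hD.comp_isHom hF) hX,
      convBracket_vec_mul hδ hF hX, partialDeriv_derivationField hD,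
      convBracket_constHom (hD.map_mem hX) hF, units_smul_map, hD.map_bracketHom hX, smul_add,
      smul_smul, koszulSign_add_left, mul_comm (koszulSign p q), ← add_assoc p r q]
    change _ = _ + _ + (_ + adPoint 𝓚 (p + r + q) (D.comp (partialDeriv X F)) w)
    rw [lieComp_apply, AddMonoidHom.comp_apply]
    abel
  | mul_scalar i a w _ hw =>
    rw [(adPoint_isHom hF).map_right, hD.map_smul, hw hF, smul_add,
      convBracket_mul_scalar hδ hF, (adPoint_isHom (hD.comp_isHom hF)).map_right]

/-- The Leibniz rule for `D` and the chain rule for the coderivation of `D ∘ x` both produce the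
bracket of `D ∘ x` with `(ad x)^n(X)`. These cancel at every step, and only the effect of `D` on `X`
survives. -/
theorem _root_.IsLieDerivation.comp_adIter (hD : IsLieDerivation k 𝓖 p D) {X : 𝔤} (hX : X ∈ 𝓖 q)
    (n : ℕ) : D.comp (adIter 𝓚 q n X) - koszulSign p q •
      (adIter 𝓚 q n X).comp (vectorField 𝓚 p (derivationField k 𝓖 D)) =
        adIter (k := k) (𝓖 := 𝓖) 𝓚 (p + q) n (D X) := by
  have hδ := derivationField_isHom (𝓚 := 𝓚) hD
  induction n with
  | zero =>
    rw [adIter_zero, adIter_zero, hD.comp_constHom, constHom_comp_vectorField X hδ, smul_zero,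
      sub_zero]
  | succ n ih =>
    have hA := adIter_isHom (k := k) (𝓖 := 𝓖) (𝓚 := 𝓚) hX n
    have hB : IsHom 𝓚 (p + q) ((adIter 𝓚 q n X).comp
        (vectorField 𝓚 p (derivationField k 𝓖 D))) := by
      rw [add_comm p q]; exact comp_vectorField_isHom hA hδ
    rw [adIter_succ, adIter_succ, ← ih, hD.comp_adPoint hA, adPoint_comp_vectorField hA hδ,
      sub_eq_add_neg (D.comp _), adPoint_add (hD.comp_isHom hA) (hB.units_smul _).neg,
      ← neg_one_units_smul, adPoint_units_smul (hB.units_smul _), adPoint_units_smul hB,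
      neg_one_units_smul, smul_add, smul_smul, koszulSign_comm q p, koszulSign_mul_self, one_smul,
      add_comm q p]
    abel

variable (φ : PowerSeries (𝓚 0))

theorem _root_.IsLieDerivation.comp_seriesAd (hD : IsLieDerivation k 𝓖 p D) (X : 𝓖 q) :
    D.comp (seriesAd 𝓚 φ X).toFun - koszulSign p q •
      (seriesAd 𝓚 φ X).toFun.comp (vectorField 𝓚 p (derivationField k 𝓖 D)) =
        (seriesAd 𝓚 φ (⟨D X, hD.map_mem X.2⟩ : 𝓖 (p + q))).toFun := by
  refine hom_ext_power 𝓚 fun n w hw => ?_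
  rw [AddMonoidHom.sub_apply, AddMonoidHom.comp_apply, seriesAd_apply_of_mem φ X hw,
    seriesAd_apply_of_mem φ _ hw, ← hD.comp_adIter X.2 n, AddMonoidHom.sub_apply,
    AddMonoidHom.smul_apply, AddMonoidHom.comp_apply,
    seriesAd_apply_of_mem φ X (vectorField_derivationField_mem_power hD hw), smul_sub,
    even_smul_eq_op_smul 𝓖 (PowerSeries.coeff n φ).2, hD.map_smul,
    ← even_smul_eq_op_smul 𝓖 (PowerSeries.coeff n φ).2, AddMonoidHom.smul_apply,
    units_smul_smul]
  rfl

/-- The extension to `S(𝔤)` of a derivation `D` of `𝔤` maps `Φ^X` to `Φ^{DX}`. -/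
theorem vectorField_derivationField_coderivation (hD : IsLieDerivation k 𝓖 p D) {X : 𝔤}
    (hX : X ∈ 𝓖 q) (w : SuperSym k 𝓖) :
    vectorField 𝓚 p (derivationField k 𝓖 D) (coderivation 𝓚 𝓖 φ X w) =
      coderivation 𝓚 𝓖 φ (D X) w + koszulSign p q •
        coderivation 𝓚 𝓖 φ X (vectorField 𝓚 p (derivationField k 𝓖 D) w) := by
  have hδ := derivationField_isHom (𝓚 := 𝓚) hD
  have hF := seriesAd_isHom φ (⟨X, hX⟩ : 𝓖 q)
  have hB : IsHom 𝓚 (p + q) ((seriesAd 𝓚 φ (⟨X, hX⟩ : 𝓖 q)).toFun.comp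
      (vectorField 𝓚 p (derivationField k 𝓖 D))) := by
    rw [add_comm p q]; exact comp_vectorField_isHom hF hδ
  -- One half of the commutator formula simplifies because the generic point composed with `V_G` is
  -- `G`.
  have hcomp : (derivationField k 𝓖 D).comp
      (vectorField 𝓚 q (seriesAd 𝓚 φ (⟨X, hX⟩ : 𝓖 q)).toFun) =
      D.comp (seriesAd 𝓚 φ (⟨X, hX⟩ : 𝓖 q)).toFun :=
    AddMonoidHom.ext fun w => congrArg D (genericPoint_vectorField hF w).1
  have h := vectorField_commutator hδ hF w
  rw [hcomp, ← vectorField_units_smul hB, ← vectorField_sub (hD.comp_isHom hF) (hB.units_smul _),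
    hD.comp_seriesAd, sub_eq_iff_eq_add] at h
  rw [coderivation_of_mem φ hX, coderivation_of_mem φ (hD.map_mem hX)]
  exact h

end Derivation

/-! ### Automorphisms of `𝔤` acting on `S(𝔤)`. -/

section Automorphism
set_option linter.unusedSectionVars false

variable {k 𝔤 : Type*} [Ring k] [AddCommGroup 𝔤] [Module k 𝔤] [Module kᵐᵒᵖ 𝔤]
  [SMulCommClass k kᵐᵒᵖ 𝔤] [Bracket 𝔤 𝔤]
  {𝓚 : ZMod 2 → AddSubgroup k} {𝓖 : ZMod 2 → AddSubgroup 𝔤}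
  [GradedRing 𝓚] [CommSuperring 𝓚] [DirectSum.Decomposition 𝓖] [SuperModule 𝓚 𝓖]
  [LieSuperalgebra 𝓚 𝓖]

variable {q r : ZMod 2} {G G' : SuperSym k 𝓖 →+ 𝔤} {f : 𝔤 ≃+ 𝔤}

theorem _root_.IsLieAutomorphism.map_left_smul (𝓚 : ZMod 2 → AddSubgroup k) [GradedRing 𝓚]
    [SuperModule 𝓚 𝓖] (hf : IsLieAutomorphism k 𝓖 f) (a : k) (X : 𝔤) : f (a • X) = a • f X := by
  induction a using DirectSum.Decomposition.inductionOn 𝓚 with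
  | zero => simp
  | add a b ha hb => rw [add_smul, map_add, ha, hb, add_smul]
  | homogeneous a =>
    induction X using DirectSum.Decomposition.inductionOn 𝓖 with
    | zero => simp
    | add x y hx hy => rw [smul_add, map_add, hx, hy, map_add, smul_add]
    | homogeneous X =>
      rw [SuperModule.left_smul a.2 X.2, units_smul_map, hf.map_smul,
        SuperModule.left_smul a.2 (hf.map_mem X.2)]

theorem exists_isMorphismExtension (𝓚 : ZMod 2 → AddSubgroup k) [GradedRing 𝓚]
    [SuperModule 𝓚 𝓖] (hf : IsLieAutomorphism k 𝓖 f) :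
    ∃ F, IsMorphismExtension (scalar k 𝓖) (vec k 𝓖) f.toAddMonoidHom F :=
  ⟨lift (scalar k 𝓖) ((vec k 𝓖).comp f.toAddMonoidHom)
    (fun a x => (congrArg (vec k 𝓖) (hf.map_left_smul 𝓚 a x)).trans (vec_left _ _))
    (fun a x => (congrArg (vec k 𝓖) (hf.map_smul x a)).trans (vec_right _ _))
    (fun _ _ _ _ hx hy => vec_comm (hf.map_mem hx) (hf.map_mem hy))
    (fun _ hx => vec_sq (hf.map_mem hx)),
    lift_vec _ _ _ _ _ _, lift_scalar _ _ _ _ _ _⟩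

theorem _root_.SuperEnv.exists_isMorphismExtension (𝓚 : ZMod 2 → AddSubgroup k) [GradedRing 𝓚]
    [SuperModule 𝓚 𝓖] (hf : IsLieAutomorphism k 𝓖 f) :
    ∃ F, IsMorphismExtension (SuperEnv.scalar k 𝓖) (SuperEnv.vec k 𝓖) f.toAddMonoidHom F :=
  ⟨SuperEnv.lift (SuperEnv.scalar k 𝓖) ((SuperEnv.vec k 𝓖).comp f.toAddMonoidHom)
    (fun a x => (congrArg (SuperEnv.vec k 𝓖) (hf.map_left_smul 𝓚 a x)).trans
      (SuperEnv.vec_left _ _))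
    (fun a x => (congrArg (SuperEnv.vec k 𝓖) (hf.map_smul x a)).trans (SuperEnv.vec_right _ _))
    (fun _ _ X Y hX hY => (SuperEnv.vec_mul_vec (hf.map_mem hX) (hf.map_mem hY)).trans
      (congrArg (_ + SuperEnv.vec k 𝓖 ·) (hf.map_lie X Y).symm)),
    SuperEnv.lift_vec _ _ _ _ _, SuperEnv.lift_scalar _ _ _ _ _⟩

variable {F : SuperSym k 𝓖 →+* SuperSym k 𝓖}

theorem _root_.IsMorphismExtension.map_mem_power
    (hF : IsMorphismExtension (scalar k 𝓖) (vec k 𝓖) f.toAddMonoidHom F) {n : ℕ}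
    {w : SuperSym k 𝓖} (hw : w ∈ power k 𝓖 n) : F w ∈ power k 𝓖 n := by
  induction hw using AddSubgroup.closure_induction with
  | mem w hw =>
    obtain ⟨l, a, hl, rfl⟩ := hw
    refine AddSubgroup.subset_closure ⟨l.map f, a, by rw [List.length_map, hl], ?_⟩
    rw [map_mul, hF.map_scalar, map_list_prod, List.map_map, List.map_map]
    congr 3
    exact funext fun X => hF.map_vec X
  | zero => rw [map_zero]; exact zero_mem _
  | add x y _ _ hx hy => rw [map_add]; exact add_mem hx hy
  | neg x _ hx => rw [map_neg]; exact neg_mem hx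

theorem partialDeriv_comp_morphism
    (hF : IsMorphismExtension (scalar k 𝓖) (vec k 𝓖) f.toAddMonoidHom F)
    (h : ∀ w, f (G w) = G' (F w)) (X : 𝔤) (w : SuperSym k 𝓖) :
    f (partialDeriv X G w) = partialDeriv (f X) G' (F w) := by
  rw [partialDeriv_apply, partialDeriv_apply, h, map_mul, hF.map_vec]; rfl

/-- Naturality of coderivations: the intertwining relation between `G` and `G'` passes to their
derivatives along `X` and `f X`, so the induction on words applies to all such pairs at once. -/
theorem map_vectorField (hf : IsLieAutomorphism k 𝓖 f)
    (hF : IsMorphismExtension (scalar k 𝓖) (vec k 𝓖) f.toAddMonoidHom F) (hG : IsHom 𝓚 r G)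
    (hG' : IsHom 𝓚 r G') (h : ∀ w, f (G w) = G' (F w)) (w : SuperSym k 𝓖) :
    F (vectorField 𝓚 r G w) = vectorField 𝓚 r G' (F w) := by
  induction w using induction_vec_mul (𝓚 := 𝓚) (𝓜 := 𝓖) generalizing r G G' with
  | add w z hw hz => rw [map_add, map_add, hw hG hG' h, hz hG hG' h, map_add, map_add]
  | one =>
    have h1 : F 1 = 1 := map_one F
    rw [vectorField_one hG, hF.map_vec, h1, vectorField_one hG']
    exact congrArg (vec k 𝓖) ((h 1).trans (congrArg G' h1))
  | vec_mul q X w hX hw =>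
    rw [vectorField_vec_mul hG hX, map_add, units_smul_map, map_mul, map_mul, hF.map_vec,
      hw hG hG' h, hw (hG.partialDeriv hX) (hG'.partialDeriv (hf.map_mem hX))
        (partialDeriv_comp_morphism hF h X)]
    exact (vectorField_vec_mul hG' (hf.map_mem hX) _).symm
  | mul_scalar i a w _ hw =>
    rw [vectorField_mul_scalar hG, map_mul, map_mul, hw hG hG' h, hF.map_scalar,
      vectorField_mul_scalar hG']

theorem map_adPoint (hf : IsLieAutomorphism k 𝓖 f)
    (hF : IsMorphismExtension (scalar k 𝓖) (vec k 𝓖) f.toAddMonoidHom F) (hG : IsHom 𝓚 r G)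
    (hG' : IsHom 𝓚 r G') (h : ∀ w, f (G w) = G' (F w)) (w : SuperSym k 𝓖) :
    f (adPoint 𝓚 r G w) = adPoint 𝓚 r G' (F w) := by
  induction w using induction_vec_mul (𝓚 := 𝓚) (𝓜 := 𝓖) generalizing r G G' with
  | add w z hw hz => rw [map_add, map_add, hw hG hG' h, hz hG hG' h, map_add, map_add]
  | one => rw [adPoint_one hG, map_one, adPoint_one hG', map_zero]
  | vec_mul q X w hX hw =>
    rw [adPoint_vec_mul hG hX, map_add, units_smul_map, hw (hG.partialDeriv hX)
      (hG'.partialDeriv (hf.map_mem hX)) (partialDeriv_comp_morphism hF h X), map_mul, hF.map_vec]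
    refine Eq.trans ?_ (adPoint_vec_mul hG' (hf.map_mem hX) _).symm
    rw [← h]
    exact congrArg (fun y => koszulSign r q • y + _) (hf.map_lie X (G w))
  | mul_scalar i a w _ hw =>
    rw [(adPoint_isHom hG).map_right, hf.map_smul, map_mul, hw hG hG' h, hF.map_scalar,
      (adPoint_isHom hG').map_right]

theorem counit_morphism (𝓚 : ZMod 2 → AddSubgroup k) [GradedRing 𝓚] [CommSuperring 𝓚]
    [SuperModule 𝓚 𝓖] (hF : IsMorphismExtension (scalar k 𝓖) (vec k 𝓖) f.toAddMonoidHom F)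
    (w : SuperSym k 𝓖) : counit 𝓖 (F w) = counit 𝓖 w := by
  induction w using induction_vec_mul (𝓚 := 𝓚) (𝓜 := 𝓖) with
  | add w z hw hz => rw [map_add, map_add, hw, hz, map_add]
  | one => rw [map_one]
  | vec_mul q X w _ _ => rw [map_mul, hF.map_vec, counit_vec_mul, counit_vec_mul]
  | mul_scalar i a w _ hw => rw [map_mul, hF.map_scalar, counit_mul_scalar, counit_mul_scalar, hw]

theorem map_adIter (hf : IsLieAutomorphism k 𝓖 f)
    (hF : IsMorphismExtension (scalar k 𝓖) (vec k 𝓖) f.toAddMonoidHom F) {X : 𝔤} (hX : X ∈ 𝓖 q)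
    (n : ℕ) (w : SuperSym k 𝓖) : f (adIter 𝓚 q n X w) = adIter 𝓚 q n (f X) (F w) := by
  induction n generalizing w with
  | zero =>
    rw [adIter_zero, adIter_zero, constHom_apply, constHom_apply, hf.map_smul,
      counit_morphism 𝓚 hF]
  | succ n ih =>
    rw [adIter_succ, adIter_succ]
    exact map_adPoint hf hF (adIter_isHom hX n) (adIter_isHom (hf.map_mem hX) n) ih w

variable (φ : PowerSeries (𝓚 0))

theorem map_coderivation (hf : IsLieAutomorphism k 𝓖 f)
    (hF : IsMorphismExtension (scalar k 𝓖) (vec k 𝓖) f.toAddMonoidHom F) {X : 𝔤} (hX : X ∈ 𝓖 q)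
    (w : SuperSym k 𝓖) :
    F (coderivation 𝓚 𝓖 φ X w) = coderivation 𝓚 𝓖 φ (f X) (F w) := by
  rw [coderivation_of_mem φ hX, coderivation_of_mem φ (hf.map_mem hX)]
  refine map_vectorField hf hF (seriesAd_isHom φ _) (seriesAd_isHom φ _) (fun w => ?_) w
  have h : f.toAddMonoidHom.comp (seriesAd 𝓚 φ (⟨X, hX⟩ : 𝓖 q)).toFun =
      (seriesAd 𝓚 φ (⟨f X, hf.map_mem hX⟩ : 𝓖 q)).toFun.comp F.toAddMonoidHom := by
    refine hom_ext_power 𝓚 fun n w hw => ?_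
    change f (_) = (seriesAd 𝓚 φ (⟨f X, hf.map_mem hX⟩ : 𝓖 q)).toFun (F w)
    rw [seriesAd_apply_of_mem φ _ hw, seriesAd_apply_of_mem φ _ (hF.map_mem_power hw),
      hf.map_left_smul 𝓚, map_adIter hf hF hX]
  exact DFunLike.congr_fun h w

end Automorphism

/-! ### The strong Poincaré–Birkhoff–Witt property of the inverse symbol map. -/

section StrongPBW
set_option linter.unusedSectionVars false

variable {k 𝔤 : Type*} [Ring k] [AddCommGroup 𝔤] [Module k 𝔤] [Module kᵐᵒᵖ 𝔤]
  [SMulCommClass k kᵐᵒᵖ 𝔤] [Bracket 𝔤 𝔤]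
  {𝓚 : ZMod 2 → AddSubgroup k} {𝓖 : ZMod 2 → AddSubgroup 𝔤}
  [GradedRing 𝓚] [CommSuperring 𝓚] [DirectSum.Decomposition 𝓖] [SuperModule 𝓚 𝓖]
  [LieSuperalgebra 𝓚 𝓖]

variable {Φ : SuperEnv k 𝓖 →+* AddMonoid.End (SuperSym k 𝓖)} {β : SuperSym k 𝓖 →+ SuperEnv k 𝓖}

theorem _root_.SuperEnv.exists_sum_parts (𝓚 : ZMod 2 → AddSubgroup k) [GradedRing 𝓚]
    [CommSuperring 𝓚] [SuperModule 𝓚 𝓖] (u : SuperEnv k 𝓖) :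
    ∃ v : ZMod 2 → SuperEnv k 𝓖, (∀ i, v i ∈ SuperEnv.part 𝓖 𝓚 i) ∧ u = ∑ i, v i := by
  refine SuperEnv.homogeneous_induction (P := fun u => ∃ v : ZMod 2 → SuperEnv k 𝓖,
    (∀ i, v i ∈ SuperEnv.part 𝓖 𝓚 i) ∧ u = ∑ i, v i) 𝓚 ?_ ?_ ?_ u
  · exact ⟨0, fun _ => zero_mem _, by simp⟩
  · rintro _ _ ⟨v, hv, rfl⟩ ⟨w, hw, rfl⟩
    exact ⟨v + w, fun i => add_mem (hv i) (hw i), Finset.sum_add_distrib.symm⟩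
  · intro i u hu
    refine ⟨Pi.single i u, fun j => ?_, (Fintype.sum_pi_single' i u).symm⟩
    rcases eq_or_ne j i with rfl | h
    · rwa [Pi.single_eq_same]
    · rw [Pi.single_eq_of_ne h]; exact zero_mem _

/-- Write `u` as a sum of homogeneous elements. The symbol map preserves parity and `S(𝔤)` is a
direct sum of its parts, so `u` and its component of parity `i` have the same symbol; injectivity
identifies them. -/
theorem mem_part_of_symbol_mem (hΦ : IsSymbolRepresentation 𝓚 𝓖 Φ)
    (hinj : Function.Injective (symbol Φ)) {i : ZMod 2} {u : SuperEnv k 𝓖}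
    (hu : symbol Φ u ∈ part 𝓖 𝓚 i) : u ∈ SuperEnv.part 𝓖 𝓚 i := by
  obtain ⟨v, hv, rfl⟩ := SuperEnv.exists_sum_parts 𝓚 u
  have h : symbol Φ (∑ j, v j) = symbol Φ (v i) := by
    rw [← DirectSum.decompose_of_mem_same (part 𝓖 𝓚) hu, map_sum, DirectSum.decompose_sum,
      DFinsupp.finsetSum_apply, AddSubmonoidClass.coe_finsetSum]
    refine (Finset.sum_eq_single i (fun j _ hj => ?_) (by simp)).trans ?_
    · exact DirectSum.decompose_of_mem_ne (part 𝓖 𝓚) (symbol_mem hΦ (hv j)) hj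
    · exact DirectSum.decompose_of_mem_same (part 𝓖 𝓚) (symbol_mem hΦ (hv i))
  rw [hinj h]
  exact hv i

/-- Through `β` the operators `Φ^X` on `S(𝔤)` correspond to left multiplication by `j(X)` on `U(𝔤)`,
so every assertion about `β` reduces to how the symbol map treats products with a generator. -/
theorem isStrongPBW_of_inverse (hΦ : IsSymbolRepresentation 𝓚 𝓖 Φ)
    (hl : ∀ u, β (symbol Φ u) = u) (hr : ∀ w, symbol Φ (β w) = w) : IsStrongPBW 𝓚 𝓖 β := by
  have hinj : Function.Injective (symbol Φ) := Function.LeftInverse.injective hl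
  have hmem : ∀ {i : ZMod 2} {w : SuperSym k 𝓖}, w ∈ part 𝓖 𝓚 i → β w ∈ SuperEnv.part 𝓖 𝓚 i :=
    fun hw => mem_part_of_symbol_mem hΦ hinj (by rwa [hr])
  have hpow : ∀ {n : ℕ} {w : SuperSym k 𝓖}, w ∈ powerLE k 𝓖 n →
      β w ∈ SuperEnv.filtration k 𝓖 n := by
    intro n w hw
    obtain ⟨u, hu, rfl⟩ := exists_symbol_eq_of_mem_powerLE hΦ hw
    rwa [hl]
  have hsmul : ∀ (w : SuperSym k 𝓖) (a : k),
      β (w * scalar k 𝓖 a) = β w * SuperEnv.scalar k 𝓖 a := fun w a =>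
    hinj (by rw [hr, symbol_mul_scalar hΦ, hr])
  have hscalar : ∀ (a : k) (w : SuperSym k 𝓖),
      β (scalar k 𝓖 a * w) = SuperEnv.scalar k 𝓖 a * β w := fun a w => hinj <| by
    refine (hr _).trans (Eq.symm ((addMonoidEnd_map_mul Φ _ _ _).trans ?_))
    rw [hΦ.apply_scalar]
    exact congrArg _ (hr w)
  have hcoder : ∀ (X : 𝔤) (w : SuperSym k 𝓖),
      β (coderivation 𝓚 𝓖 (bernoulliSeries (𝓚 0)) X w) = SuperEnv.vec k 𝓖 X * β w := fun X w =>
    hinj (by rw [hr, symbol_vec_mul hΦ, hr])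
  refine ⟨⟨Function.LeftInverse.injective hr, Function.RightInverse.surjective hl⟩, hsmul,
    fun n w hw => hpow (power_le_powerLE le_rfl hw), fun l => ?_, fun p D hD => ?_,
    fun f hf => ?_⟩
  · have h := neg_mem (symbol_prod hΦ l)
    rw [neg_sub] at h
    have h' : β (l.map (vec k 𝓖)).prod - (l.map (SuperEnv.vec k 𝓖)).prod =
        β ((l.map (vec k 𝓖)).prod - symbol Φ (l.map (SuperEnv.vec k 𝓖)).prod) := by
      rw [map_sub, hl]
    rw [h']
    -- For the empty word the difference is zero; for a word of length `n + 1` it has degree at most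
    -- `n`, and `β` sends it into `U_n`.
    cases l with
    | nil =>
      have h0 : _ = (0 : SuperSym k 𝓖) := h
      rw [h0, map_zero]; exact zero_mem _
    | cons X l => exact hpow h
  · have hδ := derivationField_isHom (𝓚 := 𝓚) hD
    refine ⟨⟨_, isDerivationExtension_vectorField hD⟩,
      -- The extension of `D` to `U(𝔤)` is transported from `S(𝔤)`; the Leibniz rule for `j(X)u`
      -- comes from the commutation of the transported operator with `Φ^X`.
      ⟨(β.comp (vectorField 𝓚 p (derivationField k 𝓖 D))).comp (symbol Φ),
        IsDerivationExtension.of_vec_mul ?_ ?_ ?_ ?_ ?_⟩, fun E₁ E₂ h₁ h₂ w => ?_⟩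
    · change β (vectorField 𝓚 p _ (symbol Φ 1)) = 0
      rw [symbol_one, vectorField_derivationField_one hD, map_zero]
    · intro q X u hX
      change β (vectorField 𝓚 p _ (symbol Φ _)) = _ +
        koszulSign p q • (SuperEnv.vec k 𝓖 X * β (vectorField 𝓚 p _ (symbol Φ u)))
      rw [symbol_vec_mul hΦ, vectorField_derivationField_coderivation _ hD hX, map_add,
        units_smul_map, hcoder, hcoder, hl]
    · intro u a
      change β (vectorField 𝓚 p _ (symbol Φ _)) = β (vectorField 𝓚 p _ (symbol Φ u)) * _
      rw [symbol_mul_scalar hΦ, vectorField_mul_scalar hδ, hsmul]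
    · intro i a u ha
      change β (vectorField 𝓚 p _ (symbol Φ _)) =
        koszulSign p i • (SuperEnv.scalar k 𝓖 a * β (vectorField 𝓚 p _ (symbol Φ u)))
      have h : symbol Φ (SuperEnv.scalar k 𝓖 a * u) = scalar k 𝓖 a * symbol Φ u := by
        rw [← hr (scalar k 𝓖 a * symbol Φ u), hscalar, hl]
      rw [h, vectorField_scalar_mul hδ ha, units_smul_map, hscalar]
    · intro i u hu
      exact hmem (vectorField_mem hδ (symbol_mem hΦ hu))
    -- Any extension to `S(𝔤)` equals the coderivation of `D ∘ x`, and any extension to `U(𝔤)` is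
    -- controlled on words by its Leibniz rule, so the given extensions may be arbitrary.
    · have key : ∀ u, symbol Φ (E₁ u) = E₂ (symbol Φ u) := by
        intro u
        rw [eq_vectorField_of_isDerivationExtension hD h₂]
        refine SuperEnv.induction_vec_mul (P := fun u => symbol Φ (E₁ u) =
          vectorField 𝓚 p (derivationField k 𝓖 D) (symbol Φ u)) 𝓚 ?_ ?_ ?_ ?_ u
        · intro u v hu hv
          rw [map_add, map_add, hu, hv, map_add, map_add]
        · rw [h₁.map_one, symbol_one, vectorField_derivationField_one hD, map_zero]
        · intro q X u hX hu
          rw [h₁.leibniz u (SuperEnv.vec_mem_part hX), h₁.map_vec, map_add, units_smul_map,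
            symbol_vec_mul hΦ, symbol_vec_mul hΦ, symbol_vec_mul hΦ, hu,
            vectorField_derivationField_coderivation _ hD hX, koszulSign_def]
        · intro i a u _ hu
          rw [h₁.map_smul, symbol_mul_scalar hΦ, hu, symbol_mul_scalar hΦ,
            vectorField_mul_scalar hδ]
      rw [← hl (E₁ (β w)), key, hr]
  · refine ⟨exists_isMorphismExtension 𝓚 hf, SuperEnv.exists_isMorphismExtension 𝓚 hf,
      fun F₁ F₂ h₁ h₂ w => ?_⟩
    have key : ∀ u, symbol Φ (F₁ u) = F₂ (symbol Φ u) := by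
      intro u
      refine SuperEnv.induction_vec_mul (P := fun u => symbol Φ (F₁ u) = F₂ (symbol Φ u))
        𝓚 ?_ ?_ ?_ ?_ u
      · intro u v hu hv
        rw [map_add, map_add, hu, hv, map_add, map_add]
      · rw [map_one, symbol_one, map_one]
      · intro q X u hX hu
        rw [map_mul, h₁.map_vec, symbol_vec_mul hΦ, symbol_vec_mul hΦ, hu,
          map_coderivation _ hf h₂ hX]
        rfl
      · intro i a u _ hu
        rw [map_mul, h₁.map_scalar, symbol_mul_scalar hΦ, hu, symbol_mul_scalar hΦ, map_mul,
          h₂.map_scalar]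
    rw [← hl (F₁ (β w)), key, hr]

end StrongPBW
end SuperSym

end

theorem mainTheorem1 {k 𝔤 : Type*} [Ring k] [AddCommGroup 𝔤] [Module k 𝔤] [Module kᵐᵒᵖ 𝔤]
    [SMulCommClass k kᵐᵒᵖ 𝔤] [Bracket 𝔤 𝔤]
    (𝓚 : ZMod 2 → AddSubgroup k) (𝓖 : ZMod 2 → AddSubgroup 𝔤)
    [GradedRing 𝓚] [CommSuperring 𝓚] [DirectSum.Decomposition 𝓖] [SuperModule 𝓚 𝓖]
    [LieSuperalgebra 𝓚 𝓖]
    (h : Nonempty (ℚ →+* k) ∨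
      ∃ N : ℕ, 2 ≤ N ∧ IsLieNilpotent 𝔤 N ∧ ∀ m : ℕ, 2 ≤ m → m ≤ N → IsUnit (m : k)) :
    ∃ Φ : SuperEnv k 𝓖 →+* AddMonoid.End (SuperSym k 𝓖),
      IsSymbolRepresentation 𝓚 𝓖 Φ ∧
      (∀ Ψ : SuperEnv k 𝓖 →+* AddMonoid.End (SuperSym k 𝓖),
        IsSymbolRepresentation 𝓚 𝓖 Ψ → Ψ = Φ) ∧
      ∃ β : SuperSym k 𝓖 →+ SuperEnv k 𝓖,
        (∀ u : SuperEnv k 𝓖, β (Φ u 1) = u) ∧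
        (∀ w : SuperSym k 𝓖, Φ (β w) 1 = w) ∧
        (∀ (i : ZMod 2) (w : SuperSym k 𝓖), w ∈ SuperSym.part 𝓖 𝓚 i → β w ∈ SuperEnv.part 𝓖 𝓚 i) ∧
        IsStrongPBW 𝓚 𝓖 β := by
  have hb : SuperSym.HasBernoulli 𝓚 𝓖 := SuperSym.HasBernoulli.of_rat_or_nilpotent h
  have h2 : IsUnit (2 : k) := by
    rcases h with ⟨⟨f⟩⟩ | ⟨N, hN, -, hu⟩
    · exact_mod_cast SuperSym.isUnit_natCast_of_rat f two_ne_zero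
    · exact_mod_cast hu 2 le_rfl hN
  have hΦ := SuperSym.symbolRepresentation_isSymbolRepresentation hb
  have hinj := SuperSym.symbol_injective hΦ h2
  let σ := AddEquiv.ofBijective (SuperSym.symbol (SuperSym.symbolRepresentation hb))
    ⟨hinj, SuperSym.symbol_surjective hΦ⟩
  have hl : ∀ u, σ.symm.toAddMonoidHom
      (SuperSym.symbol (SuperSym.symbolRepresentation hb) u) = u := σ.symm_apply_apply
  have hr : ∀ w, SuperSym.symbol (SuperSym.symbolRepresentation hb)
      (σ.symm.toAddMonoidHom w) = w := σ.apply_symm_apply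
  exact ⟨SuperSym.symbolRepresentation hb, hΦ, fun _ hΨ => hΦ.unique hΨ, σ.symm.toAddMonoidHom,
    hl, hr, fun i w hw => SuperSym.mem_part_of_symbol_mem hΦ hinj (by rwa [hr]),
    SuperSym.isStrongPBW_of_inverse hΦ hl hr⟩
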